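/- Let $K\subset\mathbb C$ be an imaginary quadratic field of discriminant $D<0$ with ring of integers $\mathcal O_K$ and $w(D)$ roots of unity, let $\mathfrak m$ be a nonzero integral ideal, and let $k\ge 1$. Let $\xi$ be a Hecke character modulo $\mathfrak m$ of infinity type $\xi_\infty(\alpha)=(\alpha/|\alpha|)^{k-1}$, i.e. a homomorphism from the group of fractional ideals coprime to $\mathfrak m$ to $\mathbb C^\times$ with $\xi(\alpha\mathcal O_K)=\xi_\infty(\alpha)$ for all $\alpha\in K^\times$ with $\alpha\equiv^* 1 \pmod{\mathfrak m}$, i.e. with $v_{\mathfrak p}(\alpha-1)\ge v_{\mathfrak p}(\mathfrak m)$ for all primes $\mathfrak p\mid\mathfrak m$. Let $\xi_{\mathfrak m}$ be the induced character of $(\mathcal O_K/\mathfrak m)^\times$, so that $\xi(\alpha\mathcal O_K)=\xi_{\mathfrak m}(\alpha)\xi_\infty(\alpha)$, extended by $0$ to the non-units modulo $\mathfrak m$, and let $\chi_D=\left(\frac{D}{\cdot}\right)$ be the Kronecker symbol. Write $e(x)=e^{2\pi i x}$, $q=e(\tau)$ with $\tau\in\mathbb H$, and $z=a\tau+b\in\mathbb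 C^2$ with $a,b\in\mathbb R^2$. For each ideal class $C$ choose an integral ideal $\mathfrak a_0=w_1\mathbb Z+w_2\mathbb Z$ in $C$ that is coprime to $\mathfrak m$. For $\alpha=n_1w_1+n_2w_2\in\mathfrak a_0$ put $Q_C(\alpha)=Q_C(n)=N(n_1w_1+n_2w_2)/N(\mathfrak a_0)$, an integral binary quadratic form, extended to $\mathbb C^2$, with bilinear form $B_C(x,y)=Q_C(x+y)-Q_C(x)-Q_C(y)$, and $\alpha+a=(n_1+a_1)w_1+(n_2+a_2)w_2$. Put $$\phi_{\xi,C}(z;\tau)=\sum_{\alpha\in\mathfrak a_0}\xi_{\mathfrak m}(\alpha)(\alpha+a)^{k-1}e(B_C(\alpha,z))\,q^{Q_C(\alpha)},$$ $$\theta_\xi(z;\tau)=\sum_{\mathfrak a\ \text{integral}}\xi(\mathfrak a+a)\,N(\mathfrak a+a)^{\frac{k-1}{2}}\,e(\beta(\mathfrak a,b))\,q^{N(\mathfrak a)+\beta(\mathfrak a,a)},$$ where, for $\mathfrak a=\alpha\mathfrak a_0^{-1}$ with $\alpha\in\mathfrak a_0$, one sets $\xi(\mathfrak a+a)=\xi(\mathfrak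 a_0)^{-1}\xi_{\mathfrak m}(\alpha)\xi_\infty(\alpha+a)$, $N(\mathfrak a+a)=|\alpha+a|^2/N(\mathfrak a_0)$ and $\beta(\mathfrak a,x)=B_C(\alpha,x)$. The summand of $\mathfrak a$ is understood as $1/w(D)$ times the sum over all classes $C$ and all $\alpha\in\mathfrak a_0$ with $\alpha\mathcal O_K=\mathfrak a\mathfrak a_0$: for $\mathfrak a\neq0$ this is the average over the $w(D)$ generators $\alpha$ of $\mathfrak a\mathfrak a_0$, for the one class $C$ in which $\mathfrak a\mathfrak a_0$ is principal; $\mathfrak a=0$ has $\alpha=0$ in every class, and contributes only if $\mathfrak m=\mathcal O_K$. Let $\Lambda\subseteq\mathbb Z^2$ have finite index, let $Q$ be an integral positive definite binary quadratic form with bilinear form $B$, and let $(\mathbb Z^2)'=\{\mu\in\mathbb R^2: B(n,\mu)\in\mathbb Z\ \text{for all}\ n\in\mathbb Z^2\}$. A function $\phi:\mathbb C^2\times\mathbb H\to\mathbb C$ is called a Jacobi form of weight $k$ on $\Gamma_0(M)$ with character $\chi$ and lattice index $(\mathbb Z^2,Q)$, with periods $\Lambda$, if 1. $\phi\left(\frac{z}{c\tau+d};\frac{A\tau+B'}{c\tau+d}\right)=\chi(d)(c\tau+d)^k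 e\left(\frac{cQ(z)}{c\tau+d}\right)\phi(z;\tau)$ for all $\begin{pmatrix}A&B'\\c&d\end{pmatrix}\in\Gamma_0(M)$; 2. $\phi(z+\lambda\tau+\mu;\tau)=e(-B(z,\lambda))\,q^{-Q(\lambda)}\phi(z;\tau)$ for all $\lambda\in\Lambda$ and $\mu\in(\mathbb Z^2)'$; 3. $\phi$ is a polynomial in $a_1,a_2$ of degree at most $k-1$ whose coefficients are holomorphic functions of $(z,\tau)$ (so $\phi$ is holomorphic if $k=1$); 4. for every $\gamma=\begin{pmatrix}A&B'\\c&d\end{pmatrix}\in \mathrm{SL}_2(\mathbb Z)$ and all $a,b\in\mathbb R^2$, the function $e(Q(a)\tau)\,(\phi|\gamma)(a\tau+b;\tau)$ is bounded as $\operatorname{Im}\tau\to\infty$, where $(\phi|\gamma)(z;\tau)=(c\tau+d)^{-k}e\left(\frac{-cQ(z)}{c\tau+d}\right)\phi\left(\frac{z}{c\tau+d};\gamma\tau\right)$. **Theorem.** The series above converge absolutely, and $$\theta_\xi(z;\tau)=\sum_{C\in \mathrm{Cl}(K)}\frac{1}{w(D)}\,\xi(\mathfrak a_0)^{-1}N(\mathfrak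 a_0)^{\frac{1-k}{2}}\,\phi_{\xi,C}(z;\tau).$$ For every class $C$, the function $\phi_{\xi,C}$ is a Jacobi form of weight $k$ on $\Gamma_0(|D|N(\mathfrak m))$ with character $\chi_D\xi_{\mathfrak m}$ and lattice index $(\mathbb Z^2,Q_C)$, with periods $\mathfrak m\mathfrak a_0$ (written in the coordinates $n$; this is all of $\mathbb Z^2$ if $\mathfrak m=\mathcal O_K$). For all $\lambda\in\mathbb Z^2$ and $\mu\in(\mathbb Z^2)'$, $$\phi_{\xi,C}(z+\lambda\tau+\mu;\tau)=e(-B_C(z,\lambda))\,q^{-Q_C(\lambda)}\sum_{\alpha\in\mathfrak a_0}\xi_{\mathfrak m}(\alpha-\lambda)(\alpha+a)^{k-1}e(B_C(\alpha,z))\,q^{Q_C(\alpha)},$$ where $\lambda$ is identified with $\lambda_1w_1+\lambda_2w_2$. In this sense $\theta_\xi$ is a linear combination of Jacobi forms of weight $k$ on $\Gamma_0(|D|N(\mathfrak m))$ with character $\chi_D\xi_{\mathfrak m}$; if $K$ has class number one, $\theta_\xi$ is itself such a Jacobi form, of lattice index $(\mathbb Z^2,Q_C)$ and with periods $\mathfrak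 m\mathfrak a_0$. -/

import Mathlib

open NumberField UpperHalfPlane
open scoped nonZeroDivisors MatrixGroups

namespace CMJacobi

noncomputable section

/-- `e(x) = exp(2πix)`. -/
def e (x : ℂ) : ℂ := Complex.exp (2 * (Real.pi : ℂ) * Complex.I * x)

/-- The Kronecker symbol `(D/n)`. -/
def kronecker (D n : ℤ) : ℤ :=
  if n = 0 then (if D.natAbs = 1 then 1 else 0)
  else (if n < 0 ∧ D < 0 then -1 else 1) * ZMod.χ₈ (D : ZMod 8) ^ padicValNat 2 n.natAbs *
    jacobiSym D (n.natAbs / 2 ^ padicValNat 2 n.natAbs)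

section Hecke

variable {K : Type*} [Field K] [NumberField K]

/-- The group `I(𝔪)` of fractional ideals of `K` coprime to `𝔪`. -/
def idealGroup (𝔪 : Ideal (𝓞 K)) : Subgroup (FractionalIdeal (𝓞 K)⁰ K)ˣ where
  carrier := {I | ∀ v : IsDedekindDomain.HeightOneSpectrum (𝓞 K), v.asIdeal ∣ 𝔪 →
    FractionalIdeal.count K v (I : FractionalIdeal (𝓞 K)⁰ K) = 0}
  one_mem' := by
    intro v _
    simp [FractionalIdeal.count_one]
  mul_mem' := by
    intro I J hI hJ v hv
    rw [Units.val_mul, FractionalIdeal.count_mul K v I.ne_zero J.ne_zero, hI v hv, hJ v hv,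
      add_zero]
  inv_mem' := by
    intro I hI v hv
    rw [Units.val_inv_eq_inv_val, FractionalIdeal.count_inv, hI v hv, neg_zero]

/-- `α ≡* 1 (mod 𝔪)`: `v_𝔭(α - 1) ≥ v_𝔭(𝔪)` for all primes `𝔭 ∣ 𝔪`, i.e. `v_𝔭(α - 1) ≥ n`
whenever `n ≥ 1` and `𝔭 ^ n ∣ 𝔪`. -/
def CongrOne (𝔪 : Ideal (𝓞 K)) (α : K) : Prop :=
  ∀ (v : IsDedekindDomain.HeightOneSpectrum (𝓞 K)) (n : ℕ), 0 < n → v.asIdeal ^ n ∣ 𝔪 →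
    v.valuation K (α - 1) ≤ WithZero.exp (-(n : ℤ))

/-- The infinity type `(x/|x|)^m` on complex numbers. -/
def infType (m : ℕ) (x : ℂ) : ℂ := (x / (‖x‖ : ℂ)) ^ m

/-- Hecke characters modulo `𝔪` of infinity type `(α/|α|)^m`; here `σ` is the fixed embedding of
`K` into `ℂ`. -/
structure HeckeChar (σ : K →+* ℂ) (𝔪 : Ideal (𝓞 K)) (m : ℕ) where
  toHom : idealGroup 𝔪 →* ℂˣ
  map_principal : ∀ (α : Kˣ) (hα : toPrincipalIdeal (𝓞 K) K α ∈ idealGroup 𝔪),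
    CongrOne 𝔪 (α : K) →
      ((toHom ⟨toPrincipalIdeal (𝓞 K) K α, hα⟩ : ℂˣ) : ℂ) = infType m (σ α)

variable {σ : K →+* ℂ} {𝔪 : Ideal (𝓞 K)} {m : ℕ}

open Classical in
/-- The value `ξ(I)`, extended by `0` to the fractional ideals not coprime to `𝔪`. -/
def HeckeChar.value (ξ : HeckeChar σ 𝔪 m) (I : (FractionalIdeal (𝓞 K)⁰ K)ˣ) : ℂ :=
  if h : I ∈ idealGroup 𝔪 then ((ξ.toHom ⟨I, h⟩ : ℂˣ) : ℂ) else 0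

open Classical in
/-- The character `ξ_𝔪` induced by `ξ` on `(𝓞 K / 𝔪)ˣ`, as a function on `𝓞 K`:
`ξ_𝔪(α) = ξ(α 𝓞 K) / ξ_∞(α)` if `α` is a unit modulo `𝔪`, and `0` otherwise. (If `0` is a unit
modulo `𝔪` then `𝔪 = 𝓞 K` and `ξ_𝔪` is trivial.) -/
def HeckeChar.finitePart (ξ : HeckeChar σ 𝔪 m) (α : 𝓞 K) : ℂ :=
  if IsUnit (Ideal.Quotient.mk 𝔪 α) then
    if h : (α : K) = 0 then 1
    else ξ.value (toPrincipalIdeal (𝓞 K) K (Units.mk0 (α : K) h)) / infType m (σ α)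
  else 0

/-- The Nebentypus `χ_D ξ_𝔪` on the integers. -/
def HeckeChar.nebentypus (ξ : HeckeChar σ 𝔪 m) (d : ℤ) : ℂ :=
  (kronecker (discr K) d : ℂ) * ξ.finitePart (d : 𝓞 K)

end Hecke

section Forms

variable {K : Type*} [Field K] [NumberField K]

/-- A nonzero integral ideal `𝔞₀` together with a `ℤ`-basis `𝔞₀ = w₁ ℤ + w₂ ℤ`. -/
structure BasedIdeal (K : Type*) [Field K] [NumberField K] where
  ideal : (Ideal (𝓞 K))⁰
  basis : Module.Basis (Fin 2) ℤ (ideal : Ideal (𝓞 K))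

namespace BasedIdeal

variable (σ : K →+* ℂ) (A : BasedIdeal K)

/-- The norm `N(𝔞₀)`. -/
def norm : ℝ := (Ideal.absNorm (A.ideal : Ideal (𝓞 K)) : ℝ)

/-- The basis vector `wᵢ` as a complex number. -/
def w (i : Fin 2) : ℂ := σ ((A.basis i : 𝓞 K) : K)

/-- The quadratic form `Q_{𝔞₀}`, extended to `ℂ²`. -/
def quad (z : Fin 2 → ℂ) : ℂ :=
  (A.w σ 0 * star (A.w σ 0) * z 0 ^ 2
    + (A.w σ 0 * star (A.w σ 1) + star (A.w σ 0) * A.w σ 1) * (z 0 * z 1)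
    + A.w σ 1 * star (A.w σ 1) * z 1 ^ 2) / (A.norm : ℂ)

/-- The bilinear form attached to a quadratic form. -/
def _root_.CMJacobi.polar (Q : (Fin 2 → ℂ) → ℂ) (z z' : Fin 2 → ℂ) : ℂ :=
  Q (z + z') - Q z - Q z'

/-- The coordinates `(n₁, n₂)` of `α = n₁ w₁ + n₂ w₂ ∈ 𝔞₀`. -/
def coord (α : (A.ideal : Ideal (𝓞 K))) : Fin 2 → ℂ := fun i => ((A.basis.repr α i : ℤ) : ℂ)

/-- `α + a = (n₁ + a₁) w₁ + (n₂ + a₂) w₂` for `a ∈ ℝ²`. -/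
def shift (α : (A.ideal : Ideal (𝓞 K))) (a : Fin 2 → ℝ) : ℂ :=
  ∑ i, (((A.basis.repr α i : ℤ) : ℂ) + (a i : ℂ)) * A.w σ i

/-- The sublattice `𝔪𝔞₀` of `𝔞₀`, in coordinates. -/
def sublattice (𝔪 : Ideal (𝓞 K)) : AddSubgroup (Fin 2 → ℤ) where
  carrier := {n | ((∑ i, n i • A.basis i : (A.ideal : Ideal (𝓞 K))) : 𝓞 K) ∈
    𝔪 * (A.ideal : Ideal (𝓞 K))}
  zero_mem' := by simp
  add_mem' := by
    intro n n' hn hn'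
    simp only [Set.mem_ofPred_eq, Pi.add_apply, add_smul, Finset.sum_add_distrib,
      Submodule.coe_add] at hn hn' ⊢
    exact Ideal.add_mem _ hn hn'
  neg_mem' := by
    intro n hn
    have h : (∑ i, (-n) i • A.basis i) = -(∑ i, n i • A.basis i) := by
      simp only [Pi.neg_apply, Fin.sum_univ_two]
      module
    simp only [Set.mem_ofPred_eq] at hn ⊢
    rw [h, Submodule.coe_neg]
    exact neg_mem hn

end BasedIdeal

/-- In `z = aτ + b` with `a, b ∈ ℝ²`, the vector `a`. -/
def aPart (z : Fin 2 → ℂ) (τ : ℍ) : Fin 2 → ℝ := fun i => (z i).im / τ.im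

/-- In `z = aτ + b` with `a, b ∈ ℝ²`, the vector `b`. -/
def bPart (z : Fin 2 → ℂ) (τ : ℍ) : Fin 2 → ℝ := fun i => (z i).re - aPart z τ i * τ.re

/-- A real vector as a complex vector. -/
def toC (x : Fin 2 → ℝ) : Fin 2 → ℂ := fun i => (x i : ℂ)

/-- An integral vector as a complex vector. -/
def intToC (x : Fin 2 → ℤ) : Fin 2 → ℂ := fun i => (x i : ℂ)

/-- The term `f(α) (α + a)^{k-1} e(B(α, z)) q^{Q(α)}`. -/
def cmTerm (σ : K →+* ℂ) (A : BasedIdeal K) (k : ℕ) (f : 𝓞 K → ℂ) (z : Fin 2 → ℂ) (τ : ℍ)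
    (α : (A.ideal : Ideal (𝓞 K))) : ℂ :=
  f (α : 𝓞 K) * A.shift σ α (aPart z τ) ^ (k - 1) *
    e (polar (A.quad σ) (A.coord α) z) * e (A.quad σ (A.coord α) * (τ : ℂ))

/-- `∑_{α ∈ 𝔞₀} f(α) (α + a)^{k-1} e(B(α, z)) q^{Q(α)}`. -/
def cmSeries (σ : K →+* ℂ) (A : BasedIdeal K) (k : ℕ) (f : 𝓞 K → ℂ) (z : Fin 2 → ℂ) (τ : ℍ) : ℂ :=
  ∑' α : (A.ideal : Ideal (𝓞 K)), cmTerm σ A k f z τ α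

variable {σ : K →+* ℂ} {𝔪 : Ideal (𝓞 K)} {k : ℕ}

/-- `φ_{ξ,C}(z; τ) = ∑_{α ∈ 𝔞₀} ξ_𝔪(α) (α + a)^{k-1} e(B_C(α, z)) q^{Q_C(α)}`. -/
def phi (ξ : HeckeChar σ 𝔪 (k - 1)) (A : BasedIdeal K) (z : Fin 2 → ℂ) (τ : ℍ) : ℂ :=
  cmSeries σ A k ξ.finitePart z τ

/-- For `𝔞 = α 𝔞₀⁻¹`: `ξ(𝔞 + a) = ξ(𝔞₀)⁻¹ ξ_𝔪(α) ξ_∞(α + a)`. -/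
def shiftedChar (ξ : HeckeChar σ 𝔪 (k - 1)) (A : BasedIdeal K) (α : (A.ideal : Ideal (𝓞 K)))
    (a : Fin 2 → ℝ) : ℂ :=
  (ξ.value (FractionalIdeal.mk0 K A.ideal))⁻¹ * ξ.finitePart (α : 𝓞 K) *
    infType (k - 1) (A.shift σ α a)

/-- For `𝔞 = α 𝔞₀⁻¹`: `N(𝔞 + a) = N(α + a) / N(𝔞₀)`. -/
def shiftedNorm (σ : K →+* ℂ) (A : BasedIdeal K) (α : (A.ideal : Ideal (𝓞 K)))
    (a : Fin 2 → ℝ) : ℝ :=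
  ‖A.shift σ α a‖ ^ 2 / A.norm

/-- The contribution of an integral ideal `𝔞` to `θ_ξ(z; τ)`. The quantities
`ξ(𝔞 + a)`, `N(𝔞 + a)` and `β(𝔞, ·)` depend on the chosen `α` with `𝔞 𝔞₀ = α 𝓞 K`; as `α` is
determined only up to the `w(D)` roots of unity of `K`, one averages over all the choices. (A
nonzero `𝔞` has such an `α` for exactly one class. The zero ideal has `α = 0` for every class; it
contributes only if `𝔪 = 𝓞 K`, because `ξ_𝔪(0) = 0` otherwise.) -/
def thetaTerm (ξ : HeckeChar σ 𝔪 (k - 1)) (A : ClassGroup (𝓞 K) → BasedIdeal K)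
    (z : Fin 2 → ℂ) (τ : ℍ) (𝔞 : Ideal (𝓞 K)) : ℂ :=
  ((Units.torsionOrder K : ℕ) : ℂ)⁻¹ * ∑ C : ClassGroup (𝓞 K),
    ∑ᶠ α : {α : ((A C).ideal : Ideal (𝓞 K)) //
        Ideal.span {(α : 𝓞 K)} = 𝔞 * ((A C).ideal : Ideal (𝓞 K))},
      shiftedChar ξ (A C) α.1 (aPart z τ) *
        ((shiftedNorm σ (A C) α.1 (aPart z τ) ^ (((k : ℝ) - 1) / 2) : ℝ) : ℂ) *
        e (polar ((A C).quad σ) ((A C).coord α.1) (toC (bPart z τ))) *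
        e (((Ideal.absNorm 𝔞 : ℂ)
          + polar ((A C).quad σ) ((A C).coord α.1) (toC (aPart z τ))) * (τ : ℂ))

/-- `θ_ξ(z; τ) = ∑_{𝔞 integral} ξ(𝔞 + a) N(𝔞 + a)^{(k-1)/2} e(β(𝔞, b)) q^{N(𝔞) + β(𝔞, a)}`. -/
def theta (ξ : HeckeChar σ 𝔪 (k - 1)) (A : ClassGroup (𝓞 K) → BasedIdeal K)
    (z : Fin 2 → ℂ) (τ : ℍ) : ℂ :=
  ∑' 𝔞 : Ideal (𝓞 K), thetaTerm ξ A z τ 𝔞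

end Forms

/-- The action `γτ = (aτ + b)/(cτ + d)` is that of Mathlib; this is `cτ + d`. -/
def autFactor (γ : SL(2, ℤ)) (τ : ℍ) : ℂ := ((γ 1 0 : ℤ) : ℂ) * (τ : ℂ) + ((γ 1 1 : ℤ) : ℂ)

/-- The slash operator of weight `k` and index `Q`,
`(φ|γ)(z; τ) = (cτ + d)^{-k} e(-c Q(z)/(cτ + d)) φ(z/(cτ + d); γτ)`. -/
def slash (k : ℕ) (Q : (Fin 2 → ℂ) → ℂ) (γ : SL(2, ℤ)) (φ : (Fin 2 → ℂ) → ℍ → ℂ)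
    (z : Fin 2 → ℂ) (τ : ℍ) : ℂ :=
  (autFactor γ τ ^ k)⁻¹ * e (-(((γ 1 0 : ℤ) : ℂ) * Q z / autFactor γ τ)) *
    φ ((autFactor γ τ)⁻¹ • z) (γ • τ)

/-- `φ : ℂ² × ℍ → ℂ` is a Jacobi form of weight `k` on `Γ₀(N)` with character `χ` and lattice index
`(ℤ², Q)`, whose elliptic transformation law has periods `λ` in the sublattice `Λ ⊆ ℤ²` of finite
index (and `μ` in the dual of `ℤ²`).

Regularity is the almost holomorphic one: with `z = aτ + b`, `φ` is a polynomial in `a` of degree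
at most `k - 1` whose coefficients are holomorphic in `(z, τ)`; for `k = 1` this says that `φ` is
holomorphic. The condition at the cusps is boundedness of `e(Q(a)τ) (φ|γ)(aτ + b; τ)`; for
holomorphic `φ` it says that only `q^n e(B(r, z))` with `n ≥ Q(r)` occur in the Fourier expansions
at the cusps. -/
structure IsJacobiForm (k N : ℕ) (χ : ℤ → ℂ) (Q : (Fin 2 → ℂ) → ℂ) (Λ : AddSubgroup (Fin 2 → ℤ))
    (φ : (Fin 2 → ℂ) → ℍ → ℂ) : Prop where
  index_posDef : ∃ p r s : ℤ, 0 < p ∧ r ^ 2 < 4 * p * s ∧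
    ∀ z, Q z = (p : ℂ) * z 0 ^ 2 + (r : ℂ) * (z 0 * z 1) + (s : ℂ) * z 1 ^ 2
  finiteIndex : Λ.FiniteIndex
  modular : ∀ γ ∈ CongruenceSubgroup.Gamma0 N, ∀ (z : Fin 2 → ℂ) (τ : ℍ),
    φ ((autFactor γ τ)⁻¹ • z) (γ • τ) =
      χ (γ 1 1) * autFactor γ τ ^ k * e (((γ 1 0 : ℤ) : ℂ) * Q z / autFactor γ τ) * φ z τ
  elliptic : ∀ l ∈ Λ, ∀ μ : Fin 2 → ℝ,
    (∀ n : Fin 2 → ℤ, ∃ j : ℤ, polar Q (intToC n) (toC μ) = (j : ℂ)) →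
    ∀ (z : Fin 2 → ℂ) (τ : ℍ), φ (z + (τ : ℂ) • intToC l + toC μ) τ =
      e (-(polar Q z (intToC l))) * e (-(Q (intToC l) * (τ : ℂ))) * φ z τ
  almostHolomorphic : ∃ f : ℕ → ℕ → (Fin 2 → ℂ) × ℂ → ℂ,
    (∀ i j, DifferentiableOn ℂ (f i j) {p | 0 < p.2.im}) ∧
    ∀ (z : Fin 2 → ℂ) (τ : ℍ), φ z τ =
      ∑ i ∈ Finset.range k, ∑ j ∈ Finset.range (k - i),
        (aPart z τ 0 : ℂ) ^ i * (aPart z τ 1 : ℂ) ^ j * f i j (z, (τ : ℂ))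
  cusps : ∀ (γ : SL(2, ℤ)) (a b : Fin 2 → ℝ), IsBoundedAtImInfty (fun τ : ℍ =>
    e (Q (toC a) * (τ : ℂ)) * slash k Q γ φ ((τ : ℂ) • toC a + toC b) τ)

end

end CMJacobi

open CMJacobi

open NumberField UpperHalfPlane
open scoped nonZeroDivisors MatrixGroups

namespace CMJacobi

noncomputable section

open scoped ComplexConjugate

/-! Scaling the embedding by `√N(𝔞₀)` turns `Q_C` into `|x|²` on a lattice in `ℂ`, and on `ℂ²` the
form splits as `u u'` with `u = lin z`, `u' = colin z`. Let `L` be the image of `𝔪𝔞₀`. Because `ξ_𝔪`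
is periodic, `φ_{ξ,C}` is a finite combination, over the cosets `h + L` of `𝔪𝔞₀` in `𝔞₀`, of the
series `∑ (x + s)^(k-1) e(x u' + x̄ u + |x|² τ)`, `x ∈ h + L`, `s = lin a` (`cmSeries_eq_sum`).

Without the polynomial factor these are binary theta series of weight one. Poisson summation in two
variables gives their law under `τ ↦ -1/τ` (`theta_eq`). If the lower right entry of `γ` is an odd
prime `p`, write `γτ = B/p + τ₃`, split the lattice modulo `p`, invert each piece, evaluate the
Gauss sum modulo `p` that appears at every dual vector, and invert back: the coset `h` goes to `Ah`
with the factor `(-disc L / p) = (D / p)` (`theta_smul_prime`). Dirichlet's theorem reduces the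
other `γ` to this case, since right multiplication by `T^j` replaces `d` by `d + cj` and `T` fixes
the series of cosets of integral norm. Periodicity of the Kronecker symbol identifies the factor
with `χ_D(d)`.

The polynomial factor is obtained from a generating function. The weight one identity holds for
every `u'`; replacing `u'` by `u' + t` makes both sides exponential series in `t`, and comparing
moments (`wtheta_smul`) gives the weight `x + s` on one side and `(x + js - cu)/j` on the other,
with `j = cτ + d`. Here `js - cu` is `lin` of the transformed `a` (`toC_aPart_smul`), so each factor
`α + a` raises the weight by one. Finally `h ↦ Ah` permutes the cosets, and `ξ_𝔪(h) = ξ_𝔪(d)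
ξ_𝔪(Ah)` yields the rest of the character (`slash_phi`).

The elliptic law is the substitution `α ↦ α + λ`. Almost holomorphy comes from expanding `(α +
a)^(k-1)` and differentiating termwise. At the cusps, the span of the theta series of all dual
cosets is stable under `SL₂(ℤ)`, and after completing the square every such series is dominated by a
fixed Gaussian sum. Sorting `α` by the ideal `α𝔞₀⁻¹` gives the formula for `θ_ξ`. -/

theorem e_add (x y : ℂ) : e (x + y) = e x * e y := by
  simp only [e, mul_add, Complex.exp_add]

theorem e_zero : e 0 = 1 := by simp [e]

theorem e_ne_zero (x : ℂ) : e x ≠ 0 := Complex.exp_ne_zero _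

theorem e_neg (x : ℂ) : e (-x) = (e x)⁻¹ := by
  rw [e, mul_neg, Complex.exp_neg, e]

theorem e_intCast (n : ℤ) : e (n : ℂ) = 1 := by
  rw [e, Complex.exp_eq_one_iff]
  exact ⟨n, by ring⟩

theorem e_add_intCast (x : ℂ) (n : ℤ) : e (x + n) = e x := by
  rw [e_add, e_intCast, mul_one]

theorem e_eq_of_sub_eq_intCast {x y : ℂ} (n : ℤ) (h : x - y = n) : e x = e y := by
  rw [← e_add_intCast y n, ← h]
  ring_nf

theorem norm_e (x : ℂ) : ‖e x‖ = Real.exp (-(2 * Real.pi * x.im)) := by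
  rw [e, Complex.norm_exp]
  congr 1
  simp [Complex.mul_re, Complex.mul_im]

theorem norm_e_ofReal (x : ℝ) : ‖e (x : ℂ)‖ = 1 := by
  simp [norm_e]

/-! ### Convergence of Gaussian sums -/

/-- These are the norms of Jacobi theta terms with purely imaginary parameters. -/
theorem summable_exp_linear_sub_sq (l : ℝ) {c : ℝ} (hc : 0 < c) :
    Summable fun n : ℤ => Real.exp (l * n - c * (n : ℝ) ^ 2) := by
  have hπ := Real.pi_pos
  have h := ((summable_jacobiTheta₂_term_iff (⟨0, -l / (2 * Real.pi)⟩ : ℂ)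
    (⟨0, c / Real.pi⟩ : ℂ)).2 (by positivity)).norm
  refine h.congr fun n => ?_
  rw [norm_jacobiTheta₂_term]
  congr 1
  field_simp
  ring

/-- The lower bound of a positive definite binary quadratic form by a multiple of the standard
one. -/
theorem exists_pos_mul_sq_add_sq_le {p r s : ℝ} (hs : 0 < s) (hΔ : 0 < 4 * p * s - r ^ 2) :
    ∃ c : ℝ, 0 < c ∧ ∀ x y : ℝ, c * (x ^ 2 + y ^ 2) ≤ p * x ^ 2 + r * (x * y) + s * y ^ 2 := by
  have hp : 0 < p := by
    by_contra! h
    nlinarith [sq_nonneg r, mul_nonpos_of_nonpos_of_nonneg h hs.le]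
  -- Determinant over trace of the Gram matrix: the product of the eigenvalues over their sum, hence
  -- at most the smaller one.
  refine ⟨(4 * p * s - r ^ 2) / (4 * (p + s)), by positivity, fun x y => ?_⟩
  have hps : 0 < 4 * (p + s) := by positivity
  rw [div_mul_eq_mul_div, div_le_iff₀ hps]
  nlinarith [sq_nonneg (2 * p * x + r * y), sq_nonneg (r * x + 2 * s * y)]

theorem summable_exp_linear_sub_quadratic (l₁ l₂ : ℝ) {p r s : ℝ} (hs : 0 < s)
    (hΔ : 0 < 4 * p * s - r ^ 2) :
    Summable fun n : ℤ × ℤ => Real.exp (l₁ * n.1 + l₂ * n.2 -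
      (p * (n.1 : ℝ) ^ 2 + r * ((n.1 : ℝ) * n.2) + s * (n.2 : ℝ) ^ 2)) := by
  obtain ⟨c, hc, h⟩ := exists_pos_mul_sq_add_sq_le hs hΔ
  refine Summable.of_nonneg_of_le (fun _ => (Real.exp_pos _).le) (fun n => ?_)
    ((summable_exp_linear_sub_sq l₁ hc).mul_of_nonneg (summable_exp_linear_sub_sq l₂ hc)
      (fun _ => (Real.exp_pos _).le) (fun _ => (Real.exp_pos _).le))
  rw [← Real.exp_add]
  exact Real.exp_le_exp.2 (by linarith [h n.1 n.2])

/-! ### The functional equation of binary theta series -/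

/-- One-dimensional Poisson summation: the functional equation of `jacobiTheta₂` at `(z, 2aτ)`, with
its exponential prefactor absorbed by completing the square. -/
theorem tsum_gaussian {a : ℝ} (ha : 0 < a) (z : ℂ) {τ : ℂ} (hτ : τ ≠ 0) :
    ∑' n : ℤ, e (n * z + a * (n : ℂ) ^ 2 * τ) =
      1 / (-Complex.I * (2 * a * τ)) ^ (1 / 2 : ℂ) * ∑' m : ℤ, e (-((z - m) ^ 2 / (4 * a * τ))) := by
  have h := jacobiTheta₂_functional_equation z (2 * a * τ)
  have ha' : (a : ℂ) ≠ 0 := by exact_mod_cast ha.ne'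
  have h1 : ∑' n : ℤ, e (n * z + a * (n : ℂ) ^ 2 * τ) = jacobiTheta₂ z (2 * a * τ) := by
    refine tsum_congr fun n => ?_
    rw [jacobiTheta₂_term, e]
    ring_nf
  rw [h1, h, mul_assoc, jacobiTheta₂, ← tsum_mul_left]
  congr 1
  refine tsum_congr fun n => ?_
  rw [jacobiTheta₂_term, e, ← Complex.exp_add]
  congr 1
  field_simp
  ring

theorem summable_gaussian {p r s : ℝ} (hs : 0 < s) (hΔ : 0 < 4 * p * s - r ^ 2) (z₁ z₂ : ℂ)
    {τ : ℂ} (hτ : 0 < τ.im) :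
    Summable fun n : ℤ × ℤ => e (n.1 * z₁ + n.2 * z₂ +
      (p * (n.1 : ℂ) ^ 2 + r * (n.1 * n.2) + s * (n.2 : ℂ) ^ 2) * τ) := by
  have hc : 0 < 2 * Real.pi * τ.im := by positivity
  refine Summable.of_norm ((summable_exp_linear_sub_quadratic (-(2 * Real.pi * z₁.im))
    (-(2 * Real.pi * z₂.im)) (p := 2 * Real.pi * τ.im * p) (r := 2 * Real.pi * τ.im * r)
    (s := 2 * Real.pi * τ.im * s) (by positivity) ?_).congr fun n => ?_)
  · have : 0 < (2 * Real.pi * τ.im) ^ 2 * (4 * p * s - r ^ 2) := by positivity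
    linarith
  · rw [norm_e]
    congr 1
    have : ((p : ℂ) * (n.1 : ℂ) ^ 2 + r * (n.1 * n.2) + s * (n.2 : ℂ) ^ 2) =
        ((p * (n.1 : ℝ) ^ 2 + r * (n.1 * n.2) + s * (n.2 : ℝ) ^ 2 : ℝ) : ℂ) := by push_cast; ring
    rw [this, Complex.add_im, Complex.im_ofReal_mul, Complex.add_im]
    have h1 : ∀ (m : ℤ) (z : ℂ), ((m : ℂ) * z).im = m * z.im := fun m z => by
      simp [Complex.mul_im]
    rw [h1, h1]
    ring

/-- Positive scalars pull out of the principal square root, so both factors carry the same root of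
`-iτ` and the product has no branch ambiguity. -/
theorem sqrt_mul_sqrt_neg_I {a b : ℝ} (ha : 0 < a) (hb : 0 < b) {τ : ℂ} (hτ : τ ≠ 0) :
    (-Complex.I * (2 * a * τ)) ^ (1 / 2 : ℂ) * (-Complex.I * (2 * b * τ)) ^ (1 / 2 : ℂ) =
      -Complex.I * τ * (Real.sqrt (4 * a * b) : ℂ) := by
  have h1 : ∀ {c : ℝ}, 0 < c → (-Complex.I * (2 * c * τ)) ^ (1 / 2 : ℂ) =
      (Real.sqrt (2 * c) : ℂ) * (-Complex.I * τ) ^ (1 / 2 : ℂ) := by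
    intro c hc
    have : -Complex.I * (2 * c * τ) = ((2 * c : ℝ) : ℂ) * (-Complex.I * τ) := by push_cast; ring
    have hτ' : -Complex.I * τ ≠ 0 := mul_ne_zero (neg_ne_zero.2 Complex.I_ne_zero) hτ
    have hc' : ((2 * c : ℝ) : ℂ) ≠ 0 := by exact_mod_cast (by positivity : (2 * c : ℝ) ≠ 0)
    rw [this, Complex.cpow_def_of_ne_zero (mul_ne_zero hc' hτ'),
      Complex.log_ofReal_mul (by positivity) hτ', add_mul, Complex.exp_add,
      Complex.cpow_def_of_ne_zero hτ', Real.sqrt_eq_rpow, Complex.ofReal_cpow (by positivity),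
      Complex.cpow_def_of_ne_zero hc', Complex.ofReal_log (by positivity)]
    norm_num
  rw [h1 ha, h1 hb]
  have h2 : (-Complex.I * τ) ^ (1 / 2 : ℂ) * (-Complex.I * τ) ^ (1 / 2 : ℂ) = -Complex.I * τ := by
    rw [← Complex.cpow_add _ _ (mul_ne_zero (neg_ne_zero.2 Complex.I_ne_zero) hτ)]; norm_num
  have h3 : Real.sqrt (4 * a * b) = Real.sqrt (2 * a) * Real.sqrt (2 * b) := by
    rw [← Real.sqrt_mul (by positivity)]
    congr 1; ring
  rw [h3, Complex.ofReal_mul]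
  linear_combination (Real.sqrt (2 * a) : ℂ) * Real.sqrt (2 * b) * h2

/-- Justifies interchanging the two sums between the two Poisson steps. The first factor involves
`q.1` alone; in the second, `q.1` enters only through a real phase, so its norm depends on `q.2`
alone. -/
theorem summable_gaussian_mixed {s Δ : ℝ} (hs : 0 < s) (hΔ : 0 < Δ) (r : ℝ) (z₁ z₂ : ℂ)
    {τ : ℂ} (hτ : 0 < τ.im) :
    Summable fun q : ℤ × ℤ => e (-((z₂ - q.1) ^ 2 / (4 * s * τ))) *
      e (q.2 * (z₁ - r * (z₂ - q.1) / (2 * s)) + (Δ / (4 * s) : ℝ) * (q.2 : ℂ) ^ 2 * τ) := by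
  have hτ0 : τ ≠ 0 := by rintro rfl; simp at hτ
  have hs0 : (s : ℂ) ≠ 0 := by exact_mod_cast hs.ne'
  refine Summable.of_norm ?_
  have h1 : Summable fun m : ℤ => ‖e (-((z₂ - m) ^ 2 / (4 * s * τ)))‖ := by
    have hc : 0 < 2 * Real.pi * (-(1 / (4 * s * τ))).im := by
      have : (-(1 / (4 * s * τ))).im = τ.im / (4 * s * Complex.normSq τ) := by
        have : (4 * (s : ℂ) * τ) = ((4 * s : ℝ) : ℂ) * τ := by push_cast; ring
        rw [this, Complex.neg_im, one_div, mul_inv, ← Complex.ofReal_inv, Complex.im_ofReal_mul,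
          Complex.inv_im]
        field_simp
      rw [this]
      have := Complex.normSq_pos.2 hτ0
      positivity
    have hA := summable_exp_linear_sub_sq
      (4 * Real.pi * (-(z₂ * (1 / (4 * s * τ)))).im) hc
    refine (hA.mul_left (Real.exp (2 * Real.pi * (z₂ ^ 2 * (1 / (4 * s * τ))).im))).congr
      fun m => ?_
    rw [norm_e, ← Real.exp_add]
    congr 1
    have : -((z₂ - m) ^ 2 / (4 * s * τ)) = -(z₂ ^ 2 * (1 / (4 * s * τ))) -
        ((2 * m : ℝ) : ℂ) * (-(z₂ * (1 / (4 * s * τ)))) +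
        ((m ^ 2 : ℝ) : ℂ) * (-(1 / (4 * s * τ))) := by
      push_cast
      field_simp
      ring
    rw [this, Complex.add_im, Complex.sub_im, Complex.im_ofReal_mul, Complex.im_ofReal_mul,
      Complex.neg_im (z₂ ^ 2 * _)]
    ring
  have h2 : Summable fun n : ℤ =>
      Real.exp (-(2 * Real.pi * z₁.im) * n + (2 * Real.pi * r / (2 * s) * z₂.im) * n -
        2 * Real.pi * (Δ / (4 * s)) * τ.im * (n : ℝ) ^ 2) := by
    refine (summable_exp_linear_sub_sq
      (-(2 * Real.pi * z₁.im) + (2 * Real.pi * r / (2 * s) * z₂.im))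
      (c := 2 * Real.pi * (Δ / (4 * s)) * τ.im) (by positivity)).congr fun n => ?_
    ring_nf
  refine (h1.mul_of_nonneg h2 (fun _ => norm_nonneg _) fun _ => (Real.exp_pos _).le).congr
    fun q => ?_
  simp only [norm_mul]
  congr 1
  rw [norm_e]
  congr 1
  have : (q.2 : ℂ) * (z₁ - r * (z₂ - q.1) / (2 * s)) +
      (Δ / (4 * s) : ℝ) * (q.2 : ℂ) ^ 2 * τ =
      ((q.2 : ℝ) : ℂ) * z₁ - ((q.2 * r / (2 * s) : ℝ) : ℂ) * z₂ +
        ((q.2 * r / (2 * s) * q.1 : ℝ) : ℂ) +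
        ((Δ / (4 * s) * (q.2 : ℝ) ^ 2 : ℝ) : ℂ) * τ := by
    push_cast
    field_simp
    ring
  rw [this, Complex.add_im, Complex.add_im, Complex.sub_im, Complex.im_ofReal_mul,
    Complex.im_ofReal_mul, Complex.im_ofReal_mul, Complex.ofReal_im]
  ring

/-- Up to a constant factor these are the terms of `summable_gaussian` for the adjugate form divided
by the discriminant, at `-1/τ`. -/
theorem summable_gaussian_dual {p r s : ℝ} (hp : 0 < p) (hΔ' : 0 < 4 * p * s - r ^ 2)
    (z₁ z₂ : ℂ) {τ : ℂ} (hτ : 0 < τ.im) :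
    Summable fun m : ℤ × ℤ =>
      e (-((s * (z₁ - m.1) ^ 2 - r * ((z₁ - m.1) * (z₂ - m.2)) + p * (z₂ - m.2) ^ 2) /
        ((4 * p * s - r ^ 2) * τ))) := by
  have hτ0 : τ ≠ 0 := by rintro rfl; simp at hτ
  obtain ⟨Δ, hΔdef⟩ : ∃ Δ : ℝ, Δ = 4 * p * s - r ^ 2 := ⟨_, rfl⟩
  have hΔ : 0 < Δ := hΔdef ▸ hΔ'
  have hΔ0 : (Δ : ℂ) ≠ 0 := by exact_mod_cast hΔ.ne'
  have hΔc : (4 * p * s - r ^ 2 : ℂ) = Δ := by rw [hΔdef]; push_cast; ring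
  rw [hΔc]
  have hτ' : 0 < (-1 / τ).im := by
    rw [neg_div, Complex.neg_im, one_div, Complex.inv_im, neg_div, neg_neg]
    exact div_pos hτ (Complex.normSq_pos.2 hτ0)
  have h := summable_gaussian (p := s / Δ) (r := -(r / Δ)) (s := p / Δ) (by positivity)
    (by
      have : 4 * (s / Δ) * (p / Δ) - (-(r / Δ)) ^ 2 = (4 * p * s - r ^ 2) / Δ ^ 2 := by
        field_simp
      rw [this, ← hΔdef]; positivity)
    ((2 * s * z₁ - r * z₂) / (Δ * τ)) ((2 * p * z₂ - r * z₁) / (Δ * τ)) hτ'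
  refine (h.mul_left (e (-((s * z₁ ^ 2 - r * (z₁ * z₂) + p * z₂ ^ 2) / (Δ * τ))))).congr
    fun m => ?_
  rw [← e_add]
  congr 1
  push_cast
  field_simp
  ring

/-- The functional equation of the theta series of a real positive definite binary quadratic
form. -/
theorem tsum_gaussian_prod {p r s : ℝ} (hs : 0 < s) (hΔ : 0 < 4 * p * s - r ^ 2) (z₁ z₂ : ℂ)
    {τ : ℂ} (hτ : 0 < τ.im) :
    ∑' n : ℤ × ℤ, e (n.1 * z₁ + n.2 * z₂ +
        (p * (n.1 : ℂ) ^ 2 + r * (n.1 * n.2) + s * (n.2 : ℂ) ^ 2) * τ) =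
      Complex.I / (τ * Real.sqrt (4 * p * s - r ^ 2)) * ∑' m : ℤ × ℤ,
        e (-((s * (z₁ - m.1) ^ 2 - r * ((z₁ - m.1) * (z₂ - m.2)) + p * (z₂ - m.2) ^ 2) /
          ((4 * p * s - r ^ 2) * τ))) := by
  have hτ0 : τ ≠ 0 := by rintro rfl; simp at hτ
  have hp : 0 < p := by
    by_contra! h
    nlinarith [sq_nonneg r, mul_nonpos_of_nonpos_of_nonneg h hs.le]
  set Δ : ℝ := 4 * p * s - r ^ 2 with hΔdef
  have hs0 : (s : ℂ) ≠ 0 := by exact_mod_cast hs.ne'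
  have hΔ0 : (Δ : ℂ) ≠ 0 := by exact_mod_cast hΔ.ne'
  have hΔc : (Δ : ℂ) = 4 * p * s - r ^ 2 := by rw [hΔdef]; push_cast; ring
  -- The summand after Poisson summation in the second variable; completing the square leaves `p -
  -- r²/(4s) = Δ/(4s)` as the coefficient of `n²`.
  set G : ℤ → ℤ → ℂ := fun m n => e (-((z₂ - m) ^ 2 / (4 * s * τ))) *
    e (n * (z₁ - r * (z₂ - m) / (2 * s)) + (Δ / (4 * s) : ℝ) * (n : ℂ) ^ 2 * τ) with hG
  have hGs : Summable fun q : ℤ × ℤ => G q.1 q.2 := by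
    simpa only [hG] using summable_gaussian_mixed hs hΔ r z₁ z₂ hτ
  have hin : ∀ n : ℤ, ∑' m : ℤ, e (n * z₁ + m * z₂ +
      (p * (n : ℂ) ^ 2 + r * (n * m) + s * (m : ℂ) ^ 2) * τ) =
      1 / (-Complex.I * (2 * s * τ)) ^ (1 / 2 : ℂ) * ∑' m : ℤ, G m n := by
    intro n
    have h := tsum_gaussian hs (z₂ + r * n * τ) hτ0
    calc _ = ∑' m : ℤ, e (n * z₁ + p * (n : ℂ) ^ 2 * τ) *
          e (m * (z₂ + r * n * τ) + s * (m : ℂ) ^ 2 * τ) := by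
          refine tsum_congr fun m => ?_
          rw [← e_add]; ring_nf
      _ = _ := by
          rw [tsum_mul_left, h, mul_left_comm, ← tsum_mul_left]
          congr 1
          refine tsum_congr fun m => ?_
          rw [hG]
          simp only [← e_add]
          congr 1
          push_cast
          rw [hΔc]
          field_simp
          ring
  rw [(summable_gaussian hs hΔ z₁ z₂ hτ).tsum_prod]
  simp_rw [hin]
  rw [tsum_mul_left, Summable.tsum_comm (f := G) hGs]
  have hout : ∀ m : ℤ, ∑' n : ℤ, G m n =
      1 / (-Complex.I * (2 * (Δ / (4 * s) : ℝ) * τ)) ^ (1 / 2 : ℂ) * ∑' n : ℤ,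
        e (-((s * (z₁ - n) ^ 2 - r * ((z₁ - n) * (z₂ - m)) + p * (z₂ - m) ^ 2) / (Δ * τ))) := by
    intro m
    rw [hG]
    simp only
    rw [tsum_mul_left, tsum_gaussian (by positivity) _ hτ0, mul_left_comm, ← tsum_mul_left]
    congr 1
    refine tsum_congr fun n => ?_
    rw [← e_add]
    congr 1
    have hpc : (p : ℂ) = (Δ + r ^ 2) / (4 * s) := by
      rw [hΔc]
      field_simp
      ring
    push_cast
    rw [hpc]
    field_simp
    ring
  simp_rw [hout]
  rw [tsum_mul_left, ← mul_assoc]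
  have hconst : 1 / (-Complex.I * (2 * s * τ)) ^ (1 / 2 : ℂ) *
      (1 / (-Complex.I * (2 * (Δ / (4 * s) : ℝ) * τ)) ^ (1 / 2 : ℂ)) =
      Complex.I / (τ * Real.sqrt Δ) := by
    rw [one_div_mul_one_div_rev, sqrt_mul_sqrt_neg_I (by positivity) hs hτ0]
    have h1 : 4 * (Δ / (4 * s)) * s = Δ := by field_simp
    rw [h1]
    have h2 : (Real.sqrt Δ : ℂ) ≠ 0 := by exact_mod_cast (Real.sqrt_pos.2 hΔ).ne'
    field_simp
    simp
  rw [hconst]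
  congr 1
  have hsum := summable_gaussian_dual hp hΔ z₁ z₂ hτ
  rw [← hΔc] at hsum ⊢
  rw [← (Equiv.prodComm ℤ ℤ).tsum_eq, Summable.tsum_prod]
  · rfl
  · exact (Equiv.prodComm ℤ ℤ).summable_iff.2 hsum

/-! ### Coefficients of exponential series -/

/-- Termwise differentiation: the hypothesis, for all powers `m` and radii `r`, dominates every
derivative uniformly on every disc. -/
theorem iteratedDeriv_tsum_exp {ι : Type*} (c x : ι → ℂ)
    (hs : ∀ (m : ℕ) (r : ℝ), Summable fun i => ‖c i‖ * ‖x i‖ ^ m * Real.exp (r * ‖x i‖)) (m : ℕ) :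
    iteratedDeriv m (fun t : ℂ => ∑' i, c i * Complex.exp (t * x i)) =
      fun t => ∑' i, c i * x i ^ m * Complex.exp (t * x i) := by
  have hle : ∀ (t : ℂ) (y : ℂ) (r : ℝ), ‖t‖ ≤ r → ‖Complex.exp (t * y)‖ ≤ Real.exp (r * ‖y‖) := by
    intro t y r h
    refine (Complex.norm_exp_le_exp_norm _).trans (Real.exp_le_exp.2 ?_)
    rw [norm_mul]
    exact mul_le_mul_of_nonneg_right h (norm_nonneg _)
  induction m with
  | zero => simp
  | succ m ih =>
    rw [iteratedDeriv_succ, ih]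
    funext t
    refine HasDerivAt.deriv ?_
    have ht : t ∈ Metric.ball (0 : ℂ) (‖t‖ + 1) := by simp
    refine hasDerivAt_tsum_of_isPreconnected (𝕜 := ℂ)
      (g := fun i (t : ℂ) => c i * x i ^ m * Complex.exp (t * x i))
      (g' := fun i (t : ℂ) => c i * x i ^ (m + 1) * Complex.exp (t * x i)) (hs (m + 1) (‖t‖ + 1)) Metric.isOpen_ball
      (convex_ball _ _).isPreconnected (fun i y _ => ?_) (fun i y hy => ?_) ht ?_ ht
    · have h := ((hasDerivAt_mul_const (x i) (x := y)).cexp).const_mul (c i * x i ^ m)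
      exact h.congr_deriv (by ring)
    · rw [norm_mul, norm_mul, norm_pow]
      exact mul_le_mul_of_nonneg_left (hle _ _ _ (mem_ball_zero_iff.1 hy).le) (by positivity)
    · refine Summable.of_norm_bounded (hs m ‖t‖) fun i => ?_
      rw [norm_mul, norm_mul, norm_pow]
      exact mul_le_mul_of_nonneg_left (hle _ _ _ le_rfl) (by positivity)

/-- Two exponential series which agree as functions of `t` have the same moments. -/
theorem tsum_mul_pow_eq_of_tsum_exp_eq {ι κ : Type*} {c x : ι → ℂ} {c' x' : κ → ℂ}
    (hs : ∀ (m : ℕ) (r : ℝ), Summable fun i => ‖c i‖ * ‖x i‖ ^ m * Real.exp (r * ‖x i‖))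
    (hs' : ∀ (m : ℕ) (r : ℝ), Summable fun i => ‖c' i‖ * ‖x' i‖ ^ m * Real.exp (r * ‖x' i‖))
    (h : ∀ t : ℂ, ∑' i, c i * Complex.exp (t * x i) = ∑' i, c' i * Complex.exp (t * x' i))
    (m : ℕ) : ∑' i, c i * x i ^ m = ∑' i, c' i * x' i ^ m := by
  have h1 := congr_fun (iteratedDeriv_tsum_exp c x hs m) 0
  rw [funext h, iteratedDeriv_tsum_exp c' x' hs' m] at h1
  simpa using h1.symm

/-! ### Lattices in `ℂ` with integral norm form, and their theta series -/

/-- A lattice in `ℂ` on which the norm form `|x|²` is integral. -/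
structure NormLattice where
  w₁ : ℂ
  w₂ : ℂ
  P : ℤ
  R : ℤ
  S : ℤ
  norm_w₁ : w₁ * conj w₁ = P
  trace_w : w₁ * conj w₂ + conj w₁ * w₂ = R
  norm_w₂ : w₂ * conj w₂ = S
  disc_pos : 0 < 4 * P * S - R ^ 2

/-- The theta term `e(x u' + x̄ u + |x|² τ)`. -/
def gterm (x u u' τ : ℂ) : ℂ := e (x * u' + conj x * u + x * conj x * τ)

theorem norm_gterm (x u u' τ : ℂ) : ‖gterm x u u' τ‖ =
    Real.exp (-(2 * Real.pi * ((x * u' + conj x * u).im + ‖x‖ ^ 2 * τ.im))) := by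
  rw [gterm, norm_e, Complex.mul_conj, Complex.add_im, Complex.im_ofReal_mul,
    Complex.normSq_eq_norm_sq]

theorem norm_gterm_le (x u u' τ : ℂ) : ‖gterm x u u' τ‖ ≤
    Real.exp (2 * Real.pi * (‖u‖ + ‖u'‖) * ‖x‖ - 2 * Real.pi * τ.im * ‖x‖ ^ 2) := by
  have hπ := Real.pi_pos
  rw [norm_gterm]
  refine Real.exp_le_exp.2 ?_
  have h1 : |(x * u' + conj x * u).im| ≤ ‖x‖ * ‖u'‖ + ‖x‖ * ‖u‖ := by
    refine (Complex.abs_im_le_norm _).trans ((norm_add_le _ _).trans ?_)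
    rw [norm_mul, norm_mul, Complex.norm_conj]
  have h2 := (abs_le.1 h1).1
  nlinarith

/-- Shifting `u'` inserts the exponential `e(x t)`, whose moments later produce the polynomial
weights. -/
theorem gterm_add_right (x u u' t τ : ℂ) : gterm x u (u' + t) τ = gterm x u u' τ * e (x * t) := by
  rw [gterm, gterm, ← e_add]
  ring_nf

/-- The Gram determinant of the lattice. -/
def NormLattice.disc (L : NormLattice) : ℤ := 4 * L.P * L.S - L.R ^ 2

namespace NormLattice

variable (L : NormLattice)

/-- The lattice vector with coordinates `n`. -/
def vec (n : ℤ × ℤ) : ℂ := n.1 * L.w₁ + n.2 * L.w₂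

/-- The vector of the dual lattice with dual coordinates `m`. -/
def dvec (m : ℤ × ℤ) : ℂ :=
  ((2 * L.S * m.1 - L.R * m.2) * L.w₁ + (2 * L.P * m.2 - L.R * m.1) * L.w₂) / L.disc

/-- The norm form on dual coordinates, multiplied by the discriminant. -/
def dualForm (m : ℤ × ℤ) : ℤ := L.S * m.1 ^ 2 - L.R * (m.1 * m.2) + L.P * m.2 ^ 2

/-- The norm form in coordinates. -/
def form (n : ℤ × ℤ) : ℤ := L.P * n.1 ^ 2 + L.R * (n.1 * n.2) + L.S * n.2 ^ 2

/-- The theta series of the coset `h + L`. -/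
def theta (h u u' τ : ℂ) : ℂ := ∑' n : ℤ × ℤ, gterm (h + L.vec n) u u' τ

theorem disc_ne_zero : (L.disc : ℂ) ≠ 0 := by
  exact_mod_cast L.disc_pos.ne'

theorem S_pos : 0 < L.S := by
  have h : (0 : ℝ) ≤ L.S := by
    have := congrArg Complex.re L.norm_w₂
    rw [Complex.mul_conj, Complex.ofReal_re, Complex.intCast_re] at this
    exact this ▸ Complex.normSq_nonneg _
  have h' : 0 ≤ L.S := by exact_mod_cast h
  rcases h'.lt_or_eq with h | h
  · exact h
  · have := L.disc_pos
    rw [← h] at this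
    nlinarith [sq_nonneg L.R]

theorem conj_vec (n : ℤ × ℤ) : conj (L.vec n) = n.1 * conj L.w₁ + n.2 * conj L.w₂ := by
  simp [vec]

theorem conj_dvec (m : ℤ × ℤ) : conj (L.dvec m) =
    ((2 * L.S * m.1 - L.R * m.2) * conj L.w₁ + (2 * L.P * m.2 - L.R * m.1) * conj L.w₂) /
      L.disc := by
  simp [dvec, Complex.conj_ofNat]

theorem vec_add (n n' : ℤ × ℤ) : L.vec (n + n') = L.vec n + L.vec n' := by
  simp [vec]; ring

theorem vec_neg (n : ℤ × ℤ) : L.vec (-n) = -L.vec n := by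
  simp [vec]; ring

theorem vec_smul (c : ℤ) (n : ℤ × ℤ) : L.vec (c • n) = c * L.vec n := by
  simp [vec]; ring

theorem vec_mul_conj (n : ℤ × ℤ) : L.vec n * conj (L.vec n) = L.form n := by
  rw [conj_vec, vec, form]
  push_cast
  linear_combination (n.1 : ℂ) ^ 2 * L.norm_w₁ + (n.1 * n.2 : ℂ) * L.trace_w +
    (n.2 : ℂ) ^ 2 * L.norm_w₂

theorem disc_eq : (L.disc : ℂ) = 4 * L.P * L.S - L.R ^ 2 := by
  rw [disc]; push_cast; ring

/-- The pairing of the lattice with its dual. -/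
theorem vec_dvec (n m : ℤ × ℤ) : L.vec n * conj (L.dvec m) + conj (L.vec n) * L.dvec m =
    n.1 * m.1 + n.2 * m.2 := by
  have hd := L.disc_ne_zero
  rw [conj_vec, conj_dvec, vec, dvec]
  field_simp
  rw [disc_eq]
  linear_combination (2 * n.1 * (2 * L.S * m.1 - L.R * m.2) : ℂ) * L.norm_w₁ +
    (n.1 * (2 * L.P * m.2 - L.R * m.1) + n.2 * (2 * L.S * m.1 - L.R * m.2) : ℂ) * L.trace_w +
    (2 * n.2 * (2 * L.P * m.2 - L.R * m.1) : ℂ) * L.norm_w₂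

theorem dvec_mul_conj (m : ℤ × ℤ) : L.dvec m * conj (L.dvec m) = L.dualForm m / L.disc := by
  have hd := L.disc_ne_zero
  rw [conj_dvec, dvec, dualForm]
  field_simp
  rw [disc_eq]
  push_cast
  linear_combination (2 * L.S * m.1 - L.R * m.2 : ℂ) ^ 2 * L.norm_w₁ +
    ((2 * L.P * m.2 - L.R * m.1) * (2 * L.S * m.1 - L.R * m.2) : ℂ) * L.trace_w +
    (2 * L.P * m.2 - L.R * m.1 : ℂ) ^ 2 * L.norm_w₂

theorem normSq_add_vec (h : ℂ) (n : ℤ × ℤ) : ‖h + L.vec n‖ ^ 2 =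
    ‖h‖ ^ 2 + (2 * (h * conj L.w₁).re) * n.1 + (2 * (h * conj L.w₂).re) * n.2 +
      (L.P * (n.1 : ℝ) ^ 2 + L.R * ((n.1 : ℝ) * n.2) + L.S * (n.2 : ℝ) ^ 2) := by
  have key : (h + L.vec n) * conj (h + L.vec n) = h * conj h + (h * conj L.w₁ +
      conj (h * conj L.w₁)) * n.1 + (h * conj L.w₂ + conj (h * conj L.w₂)) * n.2 + L.form n := by
    rw [← vec_mul_conj, map_add, conj_vec, vec]
    simp only [map_mul, Complex.conj_conj]
    ring
  rw [Complex.add_conj, Complex.add_conj, Complex.mul_conj, Complex.mul_conj,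
    Complex.normSq_eq_norm_sq, Complex.normSq_eq_norm_sq, form] at key
  exact_mod_cast key

theorem summable_exp_neg_norm_sq (h : ℂ) {c : ℝ} (hc : 0 < c) :
    Summable fun n : ℤ × ℤ => Real.exp (-(c * ‖h + L.vec n‖ ^ 2)) := by
  have hS : (0 : ℝ) < L.S := by exact_mod_cast L.S_pos
  have hd : (0 : ℝ) < 4 * L.P * L.S - L.R ^ 2 := by exact_mod_cast L.disc_pos
  refine ((summable_exp_linear_sub_quadratic (-(c * (2 * (h * conj L.w₁).re)))
    (-(c * (2 * (h * conj L.w₂).re))) (p := c * L.P) (r := c * L.R) (s := c * L.S)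
    (by positivity) ?_).mul_left (Real.exp (-(c * ‖h‖ ^ 2)))).congr fun n => ?_
  · have := mul_pos (pow_pos hc 2) hd
    linarith
  · rw [normSq_add_vec, ← Real.exp_add]
    ring_nf

/-- Theta series converge absolutely, with arbitrary polynomial weights and exponential factors. -/
theorem summable_norm_pow_mul_exp (h : ℂ) (j : ℕ) (a : ℝ) {c : ℝ} (hc : 0 < c) :
    Summable fun n : ℤ × ℤ => ‖h + L.vec n‖ ^ j *
      Real.exp (a * ‖h + L.vec n‖ - c * ‖h + L.vec n‖ ^ 2) := by
  -- The bound `x^j ≤ j! e^x` raises the linear exponent from `a` to `a + 1`; half of the Gaussian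
  -- decay then absorbs it by completing the square.
  refine Summable.of_nonneg_of_le (fun _ => by positivity) (fun n => ?_)
    ((L.summable_exp_neg_norm_sq h (half_pos hc)).mul_left
      ((j.factorial : ℝ) * Real.exp ((a + 1) ^ 2 / (2 * c))))
  set x := ‖h + L.vec n‖
  have hx : 0 ≤ x := norm_nonneg _
  have h1 : x ^ j ≤ j.factorial * Real.exp x := by
    have := Real.pow_div_factorial_le_exp x hx j
    rwa [div_le_iff₀' (by positivity)] at this
  calc x ^ j * Real.exp (a * x - c * x ^ 2)
      ≤ j.factorial * Real.exp x * Real.exp (a * x - c * x ^ 2) := by gcongr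
    _ = j.factorial * Real.exp ((a + 1) * x - c * x ^ 2) := by
        rw [mul_assoc, ← Real.exp_add]; ring_nf
    _ ≤ j.factorial * Real.exp ((a + 1) ^ 2 / (2 * c) + -(c / 2 * x ^ 2)) := by
        gcongr
        have : 0 ≤ (a + 1 - c * x) ^ 2 / (2 * c) := by positivity
        have h2 : (a + 1 - c * x) ^ 2 / (2 * c) = (a + 1) ^ 2 / (2 * c) - (a + 1) * x +
          c / 2 * x ^ 2 := by field_simp; ring
        linarith
    _ = _ := by rw [Real.exp_add]; ring

theorem summable_weighted_gterm (h : ℂ) (j : ℕ) (r : ℝ) (u u' : ℂ) {τ : ℂ} (hτ : 0 < τ.im) :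
    Summable fun n : ℤ × ℤ => ‖gterm (h + L.vec n) u u' τ‖ * ‖h + L.vec n‖ ^ j *
      Real.exp (r * ‖h + L.vec n‖) := by
  have hπ := Real.pi_pos
  refine Summable.of_nonneg_of_le (fun _ => by positivity) (fun n => ?_)
    (L.summable_norm_pow_mul_exp h j (2 * Real.pi * (‖u‖ + ‖u'‖) + r)
      (c := 2 * Real.pi * τ.im) (by positivity))
  calc _ ≤ Real.exp (2 * Real.pi * (‖u‖ + ‖u'‖) * ‖h + L.vec n‖ -
        2 * Real.pi * τ.im * ‖h + L.vec n‖ ^ 2) * ‖h + L.vec n‖ ^ j *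
        Real.exp (r * ‖h + L.vec n‖) := by
        gcongr
        exact norm_gterm_le _ _ _ _
    _ = _ := by
        rw [mul_right_comm, ← Real.exp_add]; ring_nf

theorem summable_gterm (h u u' : ℂ) {τ : ℂ} (hτ : 0 < τ.im) :
    Summable fun n : ℤ × ℤ => gterm (h + L.vec n) u u' τ := by
  refine Summable.of_norm ((L.summable_weighted_gterm h 0 0 u u' hτ).congr fun n => ?_)
  simp

/-! ### Transformation of theta series of cosets -/

/-- The functional equation under `τ ↦ -1/τ`. -/
theorem theta_eq (h u u' : ℂ) {τ : ℂ} (hτ : 0 < τ.im) :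
    L.theta h u u' τ = Complex.I / (τ * Real.sqrt L.disc) * e (-(u * u' / τ)) *
      ∑' m : ℤ × ℤ, e (h * conj (L.dvec m) + conj h * L.dvec m) *
        gterm (L.dvec m) (u / τ) (u' / τ) (-1 / τ) := by
  have hτ0 : τ ≠ 0 := by rintro rfl; simp at hτ
  have hS : (0 : ℝ) < L.S := by exact_mod_cast L.S_pos
  have hd : (0 : ℝ) < 4 * L.P * L.S - L.R ^ 2 := by exact_mod_cast L.disc_pos
  have hd0 := L.disc_ne_zero
  have key := tsum_gaussian_prod (p := L.P) (r := L.R) hS hd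
    (L.w₁ * u' + conj L.w₁ * u + (L.w₁ * conj h + conj L.w₁ * h) * τ)
    (L.w₂ * u' + conj L.w₂ * u + (L.w₂ * conj h + conj L.w₂ * h) * τ) hτ
  set z₁ := L.w₁ * u' + conj L.w₁ * u + (L.w₁ * conj h + conj L.w₁ * h) * τ with hz₁
  set z₂ := L.w₂ * u' + conj L.w₂ * u + (L.w₂ * conj h + conj L.w₂ * h) * τ with hz₂
  have hdr : ((L.disc : ℤ) : ℝ) = 4 * L.P * L.S - L.R ^ 2 := by rw [disc]; push_cast; ring
  rw [← hdr] at key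
  calc L.theta h u u' τ
      = ∑' n : ℤ × ℤ, e (h * u' + conj h * u + h * conj h * τ) *
          e (n.1 * z₁ + n.2 * z₂ + (((L.P : ℝ) : ℂ) * (n.1 : ℂ) ^ 2 +
            ((L.R : ℝ) : ℂ) * (n.1 * n.2) + ((L.S : ℝ) : ℂ) * (n.2 : ℂ) ^ 2) * τ) := by
        refine tsum_congr fun n => ?_
        rw [gterm, ← e_add]
        congr 1
        have := L.vec_mul_conj n
        rw [form] at this
        push_cast at this ⊢
        rw [← this, map_add, conj_vec, vec, hz₁, hz₂]
        ring
    _ = _ := by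
        rw [tsum_mul_left, key, ← tsum_mul_left, ← tsum_mul_left, ← tsum_mul_left]
        refine tsum_congr fun m => ?_
        rw [mul_left_comm, gterm, ← e_add, ← e_add, mul_assoc (Complex.I / _), ← e_add]
        congr 2
        -- `z₁`, `z₂` pair the basis with `(u + hτ, u' + h̄τ)`, so the adjugate form returns the
        -- discriminant times the product of these two coordinates.
        have h1 : (L.S : ℂ) * z₁ ^ 2 - L.R * (z₁ * z₂) + L.P * z₂ ^ 2 =
            L.disc * ((u + h * τ) * (u' + conj h * τ)) := by
          rw [disc_eq, hz₁, hz₂, ← L.norm_w₁, ← L.norm_w₂, ← L.trace_w]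
          ring
        have h2 : L.dvec m * (u' + conj h * τ) + conj (L.dvec m) * (u + h * τ) =
            (2 * L.S * (m.1 * z₁) - L.R * (m.1 * z₂ + m.2 * z₁) + 2 * L.P * (m.2 * z₂)) /
              L.disc := by
          rw [conj_dvec, dvec, hz₁, hz₂]
          field_simp
          ring
        have h3 : (L.S : ℂ) * (z₁ - m.1) ^ 2 - L.R * ((z₁ - m.1) * (z₂ - m.2)) +
            L.P * (z₂ - m.2) ^ 2 = L.disc * ((u + h * τ) * (u' + conj h * τ) -
              (L.dvec m * (u' + conj h * τ) + conj (L.dvec m) * (u + h * τ)) +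
              L.dvec m * conj (L.dvec m)) := by
          rw [h2, dvec_mul_conj, dualForm, mul_add (L.disc : ℂ), mul_sub (L.disc : ℂ), ← h1]
          field_simp
          push_cast
          ring
        have h5 : (4 * ((L.P : ℝ) : ℂ) * ((L.S : ℝ) : ℂ) - ((L.R : ℝ) : ℂ) ^ 2) = L.disc := by
          rw [disc_eq]; push_cast; ring
        simp only [Complex.ofReal_intCast] at h5 ⊢
        rw [h5, h3]
        field_simp
        ring

end NormLattice

/-! ### Binary quadratic Gauss sums -/

section GaussSum

variable {F : Type*} [Field F] [Fintype F] [DecidableEq F] {ψ : AddChar F ℂ}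

/-- The quadratic character with complex values. -/
abbrev quadCharC (F : Type*) [Field F] [Fintype F] [DecidableEq F] : MulChar F ℂ :=
  (quadraticChar F).ringHomComp (Int.castRingHom ℂ)

/-- An element `t` has `1 + χ(t)` square roots, and the sum of `ψ(a t)` over all `t` vanishes. -/
theorem sum_addChar_mul_sq (hF : ringChar F ≠ 2) (hψ : ψ.IsPrimitive) {a : F} (ha : a ≠ 0) :
    ∑ x, ψ (a * x ^ 2) = quadCharC F a * gaussSum (quadCharC F) ψ := by
  have h1 : ∑ x, ψ (a * x ^ 2) = ∑ t, (quadCharC F t + 1) * ψ (a * t) := by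
    rw [← Finset.sum_fiberwise' Finset.univ (fun x : F => x ^ 2) (fun t => ψ (a * t))]
    refine Finset.sum_congr rfl fun t _ => ?_
    rw [Finset.sum_const, nsmul_eq_mul]
    congr 1
    have := quadraticChar_card_sqrts hF t
    have h2 : (Finset.univ.filter fun x : F => x ^ 2 = t) = {x : F | x ^ 2 = t}.toFinset := by
      ext; simp
    rw [h2, MulChar.ringHomComp_apply]
    have := congrArg (Int.castRingHom ℂ) this
    simpa using this
  have h3 : ∑ t, ψ (a * t) = 0 := by
    have := AddChar.sum_mulShift a hψ
    simpa [mul_comm, ha] using this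
  have h4 := gaussSum_mulShift_eq (quadCharC F) ψ (Units.mk0 a ha)
  rw [h1]
  simp only [add_mul, one_mul, Finset.sum_add_distrib, h3, add_zero]
  have h5 : (quadCharC F)⁻¹ = quadCharC F := ((quadraticChar_isQuadratic F).comp _).inv
  rw [h5] at h4
  exact h4

/-- For `P ≠ 0`, completing the square in `x` diagonalises the form; the two one-variable sums
produce the square of the Gauss sum, and `b` enters twice, so its character disappears. For `P = 0`
the sum over `x` is orthogonality and forces `y = 0`. -/
theorem sum_addChar_binary (hF : ringChar F ≠ 2) (hψ : ψ.IsPrimitive) {P R S b : F} (hb : b ≠ 0)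
    (hΔ : 4 * P * S - R ^ 2 ≠ 0) :
    ∑ r : F × F, ψ (b * (P * r.1 ^ 2 + R * (r.1 * r.2) + S * r.2 ^ 2)) =
      (Fintype.card F : ℂ) * quadraticChar F (-(4 * P * S - R ^ 2)) := by
  have h2 : (2 : F) ≠ 0 := Ring.two_ne_zero hF
  rw [Fintype.sum_prod_type_right]
  by_cases hP : P = 0
  · subst hP
    have hR : R ≠ 0 := by rintro rfl; simp at hΔ
    have h1 : ∀ y : F, ∑ x : F, ψ (b * (0 * x ^ 2 + R * (x * y) + S * y ^ 2)) =
        if y = 0 then (Fintype.card F : ℂ) else 0 := by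
      intro y
      have : ∀ x : F, ψ (b * (0 * x ^ 2 + R * (x * y) + S * y ^ 2)) =
          ψ (b * S * y ^ 2) * ψ (x * (b * R * y)) := fun x => by
        rw [← AddChar.map_add_eq_mul]; ring_nf
      simp_rw [this, ← Finset.mul_sum, AddChar.sum_mulShift _ hψ]
      by_cases hy : y = 0 <;> simp [hy, hb, hR]
    simp_rw [h1]
    have : -(4 * 0 * S - R ^ 2) = R ^ 2 := by ring
    rw [this, quadraticChar_sq_one' hR]
    simp
  · have hd : b * ((4 * P * S - R ^ 2) / (4 * P)) ≠ 0 := by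
      have h4 : (4 : F) ≠ 0 := by
        have : (4 : F) = 2 * 2 := by norm_num
        rw [this]; exact mul_ne_zero h2 h2
      exact mul_ne_zero hb (div_ne_zero hΔ (mul_ne_zero h4 hP))
    have h4P : 2 * P ≠ 0 := mul_ne_zero h2 hP
    have h1 : ∀ y : F, ∑ x : F, ψ (b * (P * x ^ 2 + R * (x * y) + S * y ^ 2)) =
        ψ (b * ((4 * P * S - R ^ 2) / (4 * P)) * y ^ 2) * ∑ x : F, ψ (b * P * x ^ 2) := by
      intro y
      rw [← Equiv.sum_comp (Equiv.addRight (R * y / (2 * P))) (fun x => ψ (b * P * x ^ 2)),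
        Finset.mul_sum]
      refine Finset.sum_congr rfl fun x _ => ?_
      rw [← AddChar.map_add_eq_mul]
      congr 1
      simp only [Equiv.coe_addRight]
      have : (4 : F) * P = 2 * (2 * P) := by ring
      rw [this]
      field_simp
      ring
    simp_rw [h1]
    rw [← Finset.sum_mul, sum_addChar_mul_sq hF hψ hd, sum_addChar_mul_sq hF hψ (mul_ne_zero hb hP)]
    have hg := gaussSum_sq (χ := quadCharC F) (ψ := ψ)
      (by
        rw [Ne, MulChar.ringHomComp_eq_one_iff Int.cast_injective]
        exact quadraticChar_ne_one hF)
      ((quadraticChar_isQuadratic F).comp _) hψ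
    have hmul : quadCharC F (b * ((4 * P * S - R ^ 2) / (4 * P))) * quadCharC F (b * P) *
        quadCharC F (-1) = quadCharC F (-(4 * P * S - R ^ 2)) := by
      rw [← map_mul, ← map_mul]
      have : b * ((4 * P * S - R ^ 2) / (4 * P)) * (b * P) * -1 =
          (b / 2) ^ 2 * -(4 * P * S - R ^ 2) := by
        have : (4 : F) * P = 2 * (2 * P) := by ring
        rw [this]
        field_simp
      rw [this, map_mul]
      have h6 : quadraticChar F ((b / 2) ^ 2) = 1 := quadraticChar_sq_one' (div_ne_zero hb h2)
      rw [MulChar.ringHomComp_apply, h6]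
      simp
    have h7 : (quadraticChar F (-(4 * P * S - R ^ 2)) : ℂ) = quadCharC F (-(4 * P * S - R ^ 2)) := by
      rw [MulChar.ringHomComp_apply]; simp
    rw [h7, ← hmul]
    linear_combination (quadCharC F (b * ((4 * P * S - R ^ 2) / (4 * P)))) * quadCharC F (b * P) * hg

/-- A Gauss sum with a linear term, evaluated by completing the square. -/
theorem sum_addChar_binary_linear (hF : ringChar F ≠ 2) (hψ : ψ.IsPrimitive) {P R S b : F}
    (hb : b ≠ 0) (hΔ : 4 * P * S - R ^ 2 ≠ 0) (m : F × F) :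
    ∑ r : F × F, ψ (b * (P * r.1 ^ 2 + R * (r.1 * r.2) + S * r.2 ^ 2) +
        (r.1 * m.1 + r.2 * m.2)) =
      ψ (-((S * m.1 ^ 2 - R * (m.1 * m.2) + P * m.2 ^ 2) / (b * (4 * P * S - R ^ 2)))) *
        ((Fintype.card F : ℂ) * quadraticChar F (-(4 * P * S - R ^ 2))) := by
  rw [← sum_addChar_binary hF hψ hb hΔ, Finset.mul_sum]
  refine Fintype.sum_equiv (Equiv.addRight (((2 * S * m.1 - R * m.2) / (b * (4 * P * S - R ^ 2)),
      (2 * P * m.2 - R * m.1) / (b * (4 * P * S - R ^ 2))) : F × F)) _ _ fun r => ?_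
  rw [← AddChar.map_add_eq_mul]
  congr 1
  simp only [Equiv.coe_addRight, Prod.fst_add, Prod.snd_add]
  obtain ⟨Δ, hΔd⟩ : ∃ Δ, Δ = 4 * P * S - R ^ 2 := ⟨_, rfl⟩
  rw [← hΔd] at hΔ ⊢
  field_simp
  rw [hΔd]
  ring

end GaussSum

/-! ### Splitting sums over residue classes -/

theorem e_div_eq_stdAddChar (p : ℕ) [NeZero p] (j : ℤ) :
    e ((j : ℂ) / p) = ZMod.stdAddChar (j : ZMod p) := by
  rw [ZMod.stdAddChar_coe, e]
  ring_nf

/-- Integers as pairs of a quotient and a remainder. -/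
def intEquivProdZMod (p : ℕ) [NeZero p] : ℤ ≃ ℤ × ZMod p where
  toFun n := (n / p, n)
  invFun q := q.1 * p + q.2.val
  left_inv n := by
    simp only [ZMod.val_intCast]
    exact Int.ediv_mul_add_emod n p
  right_inv q := by
    have hp : (p : ℤ) ≠ 0 := by exact_mod_cast NeZero.ne p
    have h : (q.2.val : ℤ) / p = 0 :=
      Int.ediv_eq_zero_of_lt (by positivity) (by exact_mod_cast ZMod.val_lt q.2)
    ext
    · simp only
      rw [Int.add_comm, Int.add_mul_ediv_right _ _ hp, h, zero_add]
    · simp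

/-- Pairs of integers modulo `p`. -/
def intPairEquiv (p : ℕ) [NeZero p] : (ZMod p × ZMod p) × (ℤ × ℤ) ≃ ℤ × ℤ :=
  ((Equiv.prodComm _ _).trans (Equiv.prodProdProdComm ℤ ℤ (ZMod p) (ZMod p))).trans
    (Equiv.prodCongr (intEquivProdZMod p) (intEquivProdZMod p)).symm

/-- The standard representative of a pair of residue classes. -/
def residueRep {p : ℕ} (r : ZMod p × ZMod p) : ℤ × ℤ := (r.1.val, r.2.val)

theorem intPairEquiv_apply (p : ℕ) [NeZero p] (q : (ZMod p × ZMod p) × (ℤ × ℤ)) :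
    intPairEquiv p q = (p : ℤ) • q.2 + residueRep q.1 := by
  ext <;> simp [intPairEquiv, intEquivProdZMod, residueRep, mul_comm]

theorem tsum_intPair_residue {f : ℤ × ℤ → ℂ} (hf : Summable f) (p : ℕ) [NeZero p] :
    ∑' n, f n = ∑ r : ZMod p × ZMod p, ∑' n : ℤ × ℤ, f ((p : ℤ) • n + residueRep r) := by
  have h : Summable fun q => f (intPairEquiv p q) := (intPairEquiv p).summable_iff.2 hf
  rw [← (intPairEquiv p).tsum_eq f, h.tsum_prod, tsum_fintype]
  simp only [intPairEquiv_apply]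

/-! ### Matrices whose lower right entry is an odd prime -/

namespace NormLattice

variable (L : NormLattice)

theorem theta_add_vec (h : ℂ) (n : ℤ × ℤ) (u u' τ : ℂ) :
    L.theta (h + L.vec n) u u' τ = L.theta h u u' τ := by
  rw [theta, theta, ← (Equiv.addLeft n).tsum_eq (fun n => gterm (h + L.vec n) u u' τ)]
  refine tsum_congr fun m => ?_
  rw [Equiv.coe_addLeft, vec_add, add_assoc]

/-- Elements of the dual lattice. -/
def IsDual (h : ℂ) : Prop :=
  ∀ n : ℤ × ℤ, ∃ j : ℤ, h * conj (L.vec n) + conj h * L.vec n = j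

theorem norm_e_add_conj (x y : ℂ) : ‖e (x * conj y + conj x * y)‖ = 1 := by
  have : x * conj y + conj x * y = ((2 * (x * conj y).re : ℝ) : ℂ) := by
    rw [← Complex.add_conj, map_mul, Complex.conj_conj]
  rw [this, norm_e_ofReal]

/-- The norms of dual vectors are integral only after multiplication by the discriminant, so the
results on `NormLattice` do not apply to them; the Gaussian bound is taken for the adjugate form
instead. -/
theorem summable_gterm_dvec (h u u' : ℂ) {τ : ℂ} (hτ : 0 < τ.im) :
    Summable fun m : ℤ × ℤ => e (h * conj (L.dvec m) + conj h * L.dvec m) *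
      gterm (L.dvec m) u u' τ := by
  have hd : (0 : ℝ) < L.disc := by exact_mod_cast L.disc_pos
  have hd' : (L.disc : ℝ) = 4 * L.P * L.S - L.R ^ 2 := by rw [disc]; push_cast; ring
  have hS : (0 : ℝ) < L.S := by exact_mod_cast L.S_pos
  have hP : (0 : ℝ) < L.P := by
    by_contra! h0
    nlinarith [sq_nonneg (L.R : ℝ), mul_nonpos_of_nonpos_of_nonneg h0 hS.le]
  obtain ⟨κ, hκ⟩ : ∃ κ, κ = 2 * Real.pi * τ.im / L.disc := ⟨_, rfl⟩
  have hκ0 : 0 < κ := by rw [hκ]; positivity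
  set v₁ : ℂ := (2 * L.S * L.w₁ - L.R * L.w₂) / L.disc with hv₁
  set v₂ : ℂ := (2 * L.P * L.w₂ - L.R * L.w₁) / L.disc with hv₂
  refine Summable.of_norm ((summable_exp_linear_sub_quadratic
    (-(2 * Real.pi * (v₁ * u' + conj v₁ * u).im)) (-(2 * Real.pi * (v₂ * u' + conj v₂ * u).im))
    (p := κ * L.S) (r := -(κ * L.R)) (s := κ * L.P) (by positivity) ?_).congr fun m => ?_)
  · have := mul_pos (pow_pos hκ0 2) hd
    rw [hd'] at this
    linarith
  · rw [norm_mul, norm_e_add_conj, one_mul, norm_gterm]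
    congr 1
    have h1 : L.dvec m = (m.1 : ℝ) * v₁ + (m.2 : ℝ) * v₂ := by
      rw [dvec, hv₁, hv₂]; push_cast; ring
    have h2 : L.dvec m * u' + conj (L.dvec m) * u = (m.1 : ℝ) * (v₁ * u' + conj v₁ * u) +
        (m.2 : ℝ) * (v₂ * u' + conj v₂ * u) := by
      rw [h1]
      simp only [map_add, map_mul, Complex.conj_ofReal]
      ring
    have h3 : ‖L.dvec m‖ ^ 2 = L.dualForm m / L.disc := by
      have := L.dvec_mul_conj m
      rw [Complex.mul_conj, Complex.normSq_eq_norm_sq] at this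
      exact_mod_cast this
    rw [h2, h3, Complex.add_im (((m.1 : ℝ) : ℂ) * _), Complex.im_ofReal_mul, Complex.im_ofReal_mul, dualForm, hκ]
    push_cast
    field_simp
    ring

theorem form_smul_add (p : ℤ) (n r : ℤ × ℤ) : ∃ k : ℤ, L.form (p • n + r) = L.form r + p * k := by
  refine ⟨p * L.form n + (2 * L.P * n.1 * r.1 + L.R * (n.1 * r.2 + n.2 * r.1) +
    2 * L.S * n.2 * r.2), ?_⟩
  simp only [form, Prod.smul_fst, Prod.smul_snd, Prod.fst_add, Prod.snd_add, smul_eq_mul]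
  ring

theorem gterm_add_rat (x u u' τ : ℂ) (s : ℂ) :
    gterm x u u' (s + τ) = e (x * conj x * s) * gterm x u u' τ := by
  rw [gterm, gterm, ← e_add]
  ring_nf

theorem gterm_natCast_mul (p : ℕ) (x u u' τ : ℂ) :
    gterm (p * x) u u' τ = gterm x (p * u) (p * u') (p ^ 2 * τ) := by
  rw [gterm, gterm, map_mul, Complex.conj_natCast]
  ring_nf

/-- Since `ch ∈ L` and `Ap - Bc = 1`, the point `pAh` lies in `h + L`. Hence each vector of residue
`r` modulo `p` is `p` times a vector of `Ah + r/p + L`. The integral norm and the duality of `h`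
make the phase `e(|x|² B/p)` depend on `r` alone. -/
theorem theta_split {p : ℕ} [NeZero p] (A B c : ℤ) (hdet : A * p - B * c = 1) {h : ℂ}
    (hN : ∃ j : ℤ, h * conj h = j) (hB : L.IsDual h) (hch : ∃ n, (c : ℂ) * h = L.vec n)
    (u u' : ℂ) {τ : ℂ} (hτ : 0 < τ.im) :
    L.theta h u u' (B / p + τ) = ∑ r : ZMod p × ZMod p, e (((B * L.form (residueRep r) : ℤ) : ℂ) / p) *
      L.theta (A * h + L.vec (residueRep r) / p) (p * u) (p * u') (p ^ 2 * τ) := by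
  have hp : (p : ℂ) ≠ 0 := by exact_mod_cast NeZero.ne p
  obtain ⟨j₁, hj₁⟩ := hN
  obtain ⟨n₀, hn₀⟩ := hch
  have hdet' : (A : ℂ) * p - B * c = 1 := by exact_mod_cast hdet
  have hτ' : 0 < ((B : ℂ) / p + τ).im := by
    have : ((B : ℂ) / p) = ((B / p : ℝ) : ℂ) := by push_cast; ring
    rw [this, Complex.add_im, Complex.ofReal_im, zero_add]
    exact hτ
  have h1 : p * (A * h) = h + L.vec (B • n₀) := by
    rw [vec_smul, ← hn₀]
    linear_combination h * hdet'
  rw [← L.theta_add_vec h (B • n₀), ← h1, theta, tsum_intPair_residue (L.summable_gterm _ u u' hτ') p]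
  refine Finset.sum_congr rfl fun r _ => ?_
  rw [theta, ← tsum_mul_left]
  refine tsum_congr fun n => ?_
  have hx : p * (A * h) + L.vec ((p : ℤ) • n + residueRep r) =
      p * ((A * h + L.vec (residueRep r) / p) + L.vec n) := by
    rw [vec_add, vec_smul]
    push_cast
    field_simp
    ring
  obtain ⟨j₂, hj₂⟩ := hB ((p : ℤ) • n + residueRep r)
  obtain ⟨k, hk⟩ := L.form_smul_add p n (residueRep r)
  rw [gterm_add_rat]
  congr 1
  · refine e_eq_of_sub_eq_intCast (B * (p * A ^ 2 * j₁ + A * j₂ + k)) ?_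
    have h3 : (p * (A * h) + L.vec ((p : ℤ) • n + residueRep r)) *
        conj (p * (A * h) + L.vec ((p : ℤ) • n + residueRep r)) =
        p ^ 2 * A ^ 2 * j₁ + p * A * j₂ + (L.form (residueRep r) + p * k) := by
      have h4 := L.vec_mul_conj ((p : ℤ) • n + residueRep r)
      rw [hk] at h4
      push_cast at h4
      rw [← h4, ← hj₁, ← hj₂]
      simp only [map_add, map_mul, Complex.conj_natCast, map_intCast]
      ring
    rw [h3]
    push_cast
    field_simp
    ring
  · rw [hx, gterm_natCast_mul]

theorem legendre_cast {p : ℕ} [Fact p.Prime] (a : ℤ) :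
    ((quadraticChar (ZMod p) (a : ZMod p) : ℤ) : ℂ) = legendreSym p a := rfl

/-- The transformation of a theta series under a matrix of `Γ₀(N)` whose lower right entry is an
odd prime. -/
theorem theta_smul_prime {p : ℕ} [Fact p.Prime] (hp2 : p ≠ 2) (A B c : ℤ)
    (hdet : A * p - B * c = 1) {h : ℂ} (hN : ∃ j : ℤ, h * conj h = j) (hB : L.IsDual h)
    (hch : ∃ n, (c : ℂ) * h = L.vec n) (hc : ∀ m, L.disc ∣ c * L.dualForm m)
    (hpd : ¬ (p : ℤ) ∣ L.disc) (u u' : ℂ) {τ : ℂ} (hτ : 0 < τ.im) :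
    L.theta h (u / (c * τ + p)) (u' / (c * τ + p)) ((A * τ + B) / (c * τ + p)) =
      legendreSym p (-L.disc) * (c * τ + p) * e (c * (u * u') / (c * τ + p)) *
        L.theta (A * h) u u' τ := by
  have hpP := (Fact.out : p.Prime)
  have : NeZero p := ⟨hpP.ne_zero⟩
  have hp : (p : ℂ) ≠ 0 := by exact_mod_cast hpP.ne_zero
  have hp' : (p : ℝ) ≠ 0 := by exact_mod_cast hpP.ne_zero
  have hτ0 : τ ≠ 0 := by rintro rfl; simp at hτ
  have hdet' : (A : ℂ) * p - B * c = 1 := by exact_mod_cast hdet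
  have hj : (c * τ + p : ℂ) ≠ 0 := by
    intro h0
    have h1 := congrArg Complex.im h0
    simp only [Complex.add_im, Complex.mul_im, Complex.intCast_re, Complex.intCast_im, zero_mul,
      add_zero, Complex.natCast_im, Complex.zero_im, mul_eq_zero, hτ.ne', or_false] at h1
    have hc0 : c = 0 := by exact_mod_cast h1
    simp [hc0, hp] at h0
  set j : ℂ := c * τ + p with hjdef
  set τ₃ : ℂ := τ / (p * j) with hτ₃
  have hτ₃im : 0 < τ₃.im := by
    have h1 : τ₃.im = τ.im / (Complex.normSq j) := by
      have h2 : τ₃ = ((1 / p : ℝ) : ℂ) * (τ / j) := by rw [hτ₃]; push_cast; field_simp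
      rw [h2, Complex.im_ofReal_mul, Complex.div_im, hjdef]
      simp only [Complex.add_re, Complex.mul_re, Complex.intCast_re, Complex.intCast_im, zero_mul,
        Complex.natCast_re, Complex.add_im, Complex.mul_im, Complex.natCast_im]
      field_simp
      ring
    rw [h1]
    exact div_pos hτ (Complex.normSq_pos.2 hj)
  -- `τ₃` is what remains after the rational point `B/p`. As `-1/(p²τ₃) = -c/p - 1/τ`, inverting the
  -- pieces at `p²τ₃` becomes comparable with inverting at `τ`.
  have hγ : (A * τ + B) / j = B / p + τ₃ := by
    rw [hτ₃]
    field_simp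
    rw [hjdef]
    linear_combination τ * hdet'
  have hτ'im : 0 < ((p : ℂ) ^ 2 * τ₃).im := by
    have : (p : ℂ) ^ 2 = ((p ^ 2 : ℝ) : ℂ) := by push_cast; ring
    rw [this, Complex.im_ofReal_mul]
    positivity
  have hτ' : (p : ℂ) ^ 2 * τ₃ = p * τ / j := by rw [hτ₃]; field_simp
  rw [hγ, L.theta_split A B c hdet hN hB hch _ _ hτ₃im]
  have hsum : ∀ h' : ℂ, Summable fun m : ℤ × ℤ => e (h' * conj (L.dvec m) + conj h' * L.dvec m) *
      gterm (L.dvec m) (p * (u / j) / (p ^ 2 * τ₃)) (p * (u' / j) / (p ^ 2 * τ₃))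
        (-1 / (p ^ 2 * τ₃)) := by
    intro h'
    refine L.summable_gterm_dvec h' _ _ ?_
    rw [neg_div, Complex.neg_im, one_div, Complex.inv_im, neg_div, neg_neg]
    exact div_pos hτ'im (Complex.normSq_pos.2 fun h0 => by simp [h0] at hτ'im)
  set G : ℂ := (p : ℂ) * legendreSym p (-L.disc) with hG
  -- The sum over `r` at a fixed dual vector. Completing the square gives the phase `-dualForm m /
  -- (B disc)` modulo `p`, and `Bc ≡ -1` turns it into `|dvec m|² c/p`, an integer over `p` by `hc`.
  have hGauss : ∀ m : ℤ × ℤ, ∑ r : ZMod p × ZMod p,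
      e (((B * L.form (residueRep r) : ℤ) : ℂ) / p) *
        e (((residueRep r).1 * m.1 + (residueRep r).2 * m.2 : ℂ) / p) =
      e (L.dvec m * conj (L.dvec m) * (c / p)) * G := by
    intro m
    obtain ⟨k, hk⟩ := hc m
    have hk' : (c : ZMod p) * (L.S * m.1 ^ 2 - L.R * (m.1 * m.2) + L.P * m.2 ^ 2) =
        (4 * L.P * L.S - L.R ^ 2) * k := by
      have := congrArg (fun x : ℤ => (x : ZMod p)) hk
      simpa [dualForm, disc] using this
    have hΔ : (4 * L.P * L.S - L.R ^ 2 : ZMod p) ≠ 0 := by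
      intro h0
      refine hpd ((ZMod.intCast_zmod_eq_zero_iff_dvd _ _).1 ?_)
      rw [disc]
      push_cast
      exact h0
    have hBc : (B : ZMod p) * c = -1 := by
      have := congrArg (fun x : ℤ => (x : ZMod p)) hdet
      simp only [Int.cast_sub, Int.cast_mul, Int.cast_natCast, CharP.cast_eq_zero, mul_zero,
        zero_sub, Int.cast_one] at this
      rw [← this, neg_neg]
    have hB0 : (B : ZMod p) ≠ 0 := by
      rintro h0
      rw [h0, zero_mul] at hBc
      exact one_ne_zero (neg_eq_zero.1 hBc.symm)
    have key := sum_addChar_binary_linear (F := ZMod p) (ψ := ZMod.stdAddChar)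
      (by rwa [ZMod.ringChar_zmod_n]) (ZMod.isPrimitive_stdAddChar p) (P := L.P) (R := L.R)
      (S := L.S) hB0 hΔ (m.1, m.2)
    have hphase : (-(((L.S : ZMod p) * m.1 ^ 2 - L.R * (m.1 * m.2) + L.P * m.2 ^ 2) /
        (B * (4 * L.P * L.S - L.R ^ 2)))) = k := by
      rw [neg_eq_iff_eq_neg, div_eq_iff (mul_ne_zero hB0 hΔ)]
      linear_combination (-(B : ZMod p)) * hk' + ((L.S : ZMod p) * m.1 ^ 2 - L.R * (m.1 * m.2) + L.P * m.2 ^ 2) * hBc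
    have hk'' : L.dvec m * conj (L.dvec m) * (c / p) = (k : ℂ) / p := by
      rw [dvec_mul_conj]
      have hd := L.disc_ne_zero
      field_simp
      have : ((c * L.dualForm m : ℤ) : ℂ) = ((L.disc * k : ℤ) : ℂ) := by rw [hk]
      push_cast at this
      linear_combination this
    rw [hk'', e_div_eq_stdAddChar, ← hphase]
    have hcard : G = (Fintype.card (ZMod p) : ℂ) *
        ((quadraticChar (ZMod p) (-(4 * L.P * L.S - L.R ^ 2)) : ℤ) : ℂ) := by
      rw [hG, ZMod.card, ← legendre_cast, disc]
      push_cast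
      rfl
    rw [hcard, ← key]
    refine Finset.sum_congr rfl fun r _ => ?_
    have : ((residueRep r).1 * m.1 + (residueRep r).2 * m.2 : ℂ) =
        (((residueRep r).1 * m.1 + (residueRep r).2 * m.2 : ℤ) : ℂ) := by push_cast; ring
    rw [this, e_div_eq_stdAddChar, e_div_eq_stdAddChar, ← AddChar.map_add_eq_mul]
    congr 1
    simp [form, residueRep]
  -- The phase of the Gauss sum cancels the one caused by `-c/p`; what is left is the right side of
  -- `theta_eq` for `Ah` at `τ`.
  have hfinal : ∀ m : ℤ × ℤ, ∑ r : ZMod p × ZMod p, e (((B * L.form (residueRep r) : ℤ) : ℂ) / p) *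
      (e ((A * h + L.vec (residueRep r) / p) * conj (L.dvec m) +
        conj (A * h + L.vec (residueRep r) / p) * L.dvec m) *
        gterm (L.dvec m) (p * (u / j) / (p ^ 2 * τ₃)) (p * (u' / j) / (p ^ 2 * τ₃))
          (-1 / (p ^ 2 * τ₃))) =
      G * (e (A * h * conj (L.dvec m) + conj (A * h) * L.dvec m) *
        gterm (L.dvec m) (u / τ) (u' / τ) (-1 / τ)) := by
    intro m
    have hg : gterm (L.dvec m) (p * (u / j) / (p ^ 2 * τ₃)) (p * (u' / j) / (p ^ 2 * τ₃))
          (-1 / (p ^ 2 * τ₃)) = (e (L.dvec m * conj (L.dvec m) * (c / p)))⁻¹ *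
        gterm (L.dvec m) (u / τ) (u' / τ) (-1 / τ) := by
      rw [← e_neg, ← mul_neg, ← gterm_add_rat, hτ']
      congr 1
      · field_simp
      · field_simp
      · rw [hjdef]; field_simp; ring
    have hr : ∀ r : ZMod p × ZMod p, e ((A * h + L.vec (residueRep r) / p) * conj (L.dvec m) +
        conj (A * h + L.vec (residueRep r) / p) * L.dvec m) =
        e (((residueRep r).1 * m.1 + (residueRep r).2 * m.2 : ℂ) / p) *
          e (A * h * conj (L.dvec m) + conj (A * h) * L.dvec m) := by
      intro r
      rw [← e_add, ← vec_dvec]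
      congr 1
      simp only [map_add, map_div₀, Complex.conj_natCast]
      ring
    simp_rw [hr, hg]
    have := hGauss m
    have he := e_ne_zero (L.dvec m * conj (L.dvec m) * (c / p))
    calc _ = (∑ r : ZMod p × ZMod p, e (((B * L.form (residueRep r) : ℤ) : ℂ) / p) *
        e (((residueRep r).1 * m.1 + (residueRep r).2 * m.2 : ℂ) / p)) *
        (e (A * h * conj (L.dvec m) + conj (A * h) * L.dvec m) *
          ((e (L.dvec m * conj (L.dvec m) * (c / p)))⁻¹ *
          gterm (L.dvec m) (u / τ) (u' / τ) (-1 / τ))) := by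
          rw [Finset.sum_mul]
          refine Finset.sum_congr rfl fun r _ => ?_
          ring
      _ = _ := by
          rw [this]
          generalize e (L.dvec m * conj (L.dvec m) * (c / p)) = X at he
          field_simp
  simp_rw [L.theta_eq _ _ _ hτ'im]
  rw [L.theta_eq _ _ _ hτ]
  simp_rw [mul_left_comm (e (((B * L.form _ : ℤ) : ℂ) / p))]
  rw [← Finset.mul_sum]
  simp_rw [← tsum_mul_left (a := e (((B * L.form _ : ℤ) : ℂ) / p))]
  rw [← Summable.tsum_finsetSum (fun r _ => (hsum _).mul_left _)]
  simp_rw [hfinal]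
  rw [tsum_mul_left, ← mul_assoc, ← mul_assoc _ _ (tsum _)]
  congr 1
  have hexp : e (-(p * (u / j) * (p * (u' / j)) / (p ^ 2 * τ₃))) =
      e (c * (u * u') / j) * e (-(u * u' / τ)) := by
    rw [← e_add, hτ']
    congr 1
    field_simp
    rw [hjdef]
    ring
  rw [hexp, hτ', hG]
  have hs : (Real.sqrt L.disc : ℂ) ≠ 0 := by
    have : (0 : ℝ) < L.disc := by exact_mod_cast L.disc_pos
    exact_mod_cast (Real.sqrt_pos.2 this).ne'
  field_simp

end NormLattice

section Slash

open ModularGroup (T)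

/-! ### The slash operator in weight one -/

theorem autFactor_ne_zero (γ : SL(2, ℤ)) (τ : ℍ) : autFactor γ τ ≠ 0 := by
  have h := UpperHalfPlane.denom_ne_zero (γ : GL (Fin 2) ℝ) τ
  simpa [autFactor, UpperHalfPlane.denom] using h

theorem coe_smul_eq (γ : SL(2, ℤ)) (τ : ℍ) : ((γ • τ : ℍ) : ℂ) =
    ((γ 0 0 : ℤ) * (τ : ℂ) + (γ 0 1 : ℤ)) / autFactor γ τ := by
  rw [UpperHalfPlane.specialLinearGroup_apply]
  simp [autFactor]

theorem det_eq (γ : SL(2, ℤ)) : γ 0 0 * γ 1 1 - γ 0 1 * γ 1 0 = 1 := by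
  have := γ.det_coe
  rwa [Matrix.det_fin_two] at this

theorem mul_entry (γ γ' : SL(2, ℤ)) (i j : Fin 2) :
    (γ * γ') i j = γ i 0 * γ' 0 j + γ i 1 * γ' 1 j := by
  rw [Matrix.SpecialLinearGroup.coe_mul, Matrix.mul_apply, Fin.sum_univ_two]

theorem autFactor_mul (γ γ' : SL(2, ℤ)) (τ : ℍ) :
    autFactor (γ * γ') τ = autFactor γ (γ' • τ) * autFactor γ' τ := by
  have h := autFactor_ne_zero γ' τ
  rw [autFactor, autFactor, coe_smul_eq, mul_entry, mul_entry, add_mul, mul_assoc,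
    div_mul_cancel₀ _ h, autFactor]
  push_cast
  ring

/-- The slash operator of weight one in the coordinates in which `Q(u, u') = u u'`. -/
def slashOne (γ : SL(2, ℤ)) (ψ : ℂ → ℂ → ℍ → ℂ) (u u' : ℂ) (τ : ℍ) : ℂ :=
  (autFactor γ τ)⁻¹ * e (-((γ 1 0 : ℤ) * (u * u') / autFactor γ τ)) *
    ψ (u / autFactor γ τ) (u' / autFactor γ τ) (γ • τ)

/-- This is a right action because the automorphy factor is a cocycle and so is the exponent `c u
u'/(cτ + d)`; the latter uses that the determinant is one. -/
theorem slashOne_mul (γ γ' : SL(2, ℤ)) (ψ : ℂ → ℂ → ℍ → ℂ) :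
    slashOne (γ * γ') ψ = slashOne γ' (slashOne γ ψ) := by
  funext u u' τ
  have h := autFactor_ne_zero γ' τ
  have h' := autFactor_ne_zero γ (γ' • τ)
  simp only [slashOne]
  rw [autFactor_mul, mul_smul, mul_entry]
  have h1 : e (-(((γ 1 0 * γ' 0 0 + γ 1 1 * γ' 1 0 : ℤ) : ℂ) * (u * u') /
      (autFactor γ (γ' • τ) * autFactor γ' τ))) =
      e (-((γ' 1 0 : ℤ) * (u * u') / autFactor γ' τ)) * e (-((γ 1 0 : ℤ) *
        (u / autFactor γ' τ * (u' / autFactor γ' τ)) / autFactor γ (γ' • τ))) := by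
    rw [← e_add]
    congr 1
    have hdet : ((γ' 0 0 : ℤ) : ℂ) * (γ' 1 1 : ℤ) - (γ' 0 1 : ℤ) * (γ' 1 0 : ℤ) = 1 := by
      exact_mod_cast det_eq γ'
    have hJ : autFactor γ (γ' • τ) * autFactor γ' τ = (γ 1 0 : ℤ) * ((γ' 0 0 : ℤ) * (τ : ℂ) +
        (γ' 0 1 : ℤ)) + (γ 1 1 : ℤ) * autFactor γ' τ := by
      rw [autFactor, coe_smul_eq]; field_simp
    have hj : autFactor γ' τ = (γ' 1 0 : ℤ) * (τ : ℂ) + (γ' 1 1 : ℤ) := rfl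
    field_simp
    push_cast
    linear_combination (-(γ 1 0 : ℤ) * u * u' : ℂ) * hdet + (γ' 1 0 : ℤ) * (u * u') * hJ -
      (u * u' * (γ 1 0 : ℤ) * (γ' 0 0 : ℤ)) * hj
  rw [h1, mul_inv, div_div, div_div, mul_comm (autFactor γ' τ) (autFactor γ (γ' • τ))]
  ring

theorem slashOne_one (ψ : ℂ → ℂ → ℍ → ℂ) : slashOne 1 ψ = ψ := by
  funext u u' τ
  simp [slashOne, autFactor, e_zero]

theorem slashOne_add (γ : SL(2, ℤ)) (ψ ψ' : ℂ → ℂ → ℍ → ℂ) :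
    slashOne γ (ψ + ψ') = slashOne γ ψ + slashOne γ ψ' := by
  funext u u' τ
  simp only [slashOne, Pi.add_apply]
  ring

theorem slashOne_smul (γ : SL(2, ℤ)) (c : ℂ) (ψ : ℂ → ℂ → ℍ → ℂ) :
    slashOne γ (c • ψ) = c • slashOne γ ψ := by
  funext u u' τ
  simp only [slashOne, Pi.smul_apply, smul_eq_mul]
  ring

theorem slashOne_zero (γ : SL(2, ℤ)) : slashOne γ 0 = 0 := by
  funext u u' τ
  simp [slashOne]

theorem slashOne_T_zpow (n : ℤ) (ψ : ℂ → ℂ → ℍ → ℂ) (u u' : ℂ) (τ : ℍ) :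
    slashOne (T ^ n) ψ u u' τ = ψ u u' ((n : ℝ) +ᵥ τ) := by
  have h1 : autFactor (T ^ n) τ = 1 := by simp [autFactor, ModularGroup.coe_T_zpow]
  rw [slashOne, h1, UpperHalfPlane.modular_T_zpow_smul]
  simp [ModularGroup.coe_T_zpow, e_zero]

theorem slashOne_S (ψ : ℂ → ℂ → ℍ → ℂ) (u u' : ℂ) (τ : ℍ) :
    slashOne ModularGroup.S ψ u u' τ = (τ : ℂ)⁻¹ * e (-(u * u' / τ)) * ψ (u / τ) (u' / τ) (ModularGroup.S • τ) := by
  have h1 : autFactor ModularGroup.S τ = τ := by simp [autFactor, ModularGroup.coe_S]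
  rw [slashOne, h1]
  simp [ModularGroup.coe_S]

/-! ### Sums over cosets -/

theorem tsum_eq_sum_quotient {A B : Type*} [AddCommGroup A] [AddCommGroup B] (φ : B →+ A)
    (hφ : Function.Injective φ) [Fintype (A ⧸ φ.range)] {f : A → ℂ} (hf : Summable f) :
    ∑' a, f a = ∑ q : A ⧸ φ.range, ∑' b, f (q.out + φ b) := by
  have hbij : Function.Bijective fun q : (A ⧸ φ.range) × B => q.1.out + φ q.2 := by
    constructor
    · rintro ⟨q, b⟩ ⟨q', b'⟩ h
      simp only at h
      have h1 : q = q' := by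
        rw [← q.out_eq', ← q'.out_eq']
        refine QuotientAddGroup.eq.2 ⟨b - b', ?_⟩
        rw [map_sub]
        have := eq_sub_of_add_eq h
        rw [this]
        abel
      subst h1
      rw [hφ (add_left_cancel h)]
    · intro a
      obtain ⟨b, hb⟩ : -(a : A ⧸ φ.range).out + a ∈ φ.range :=
        QuotientAddGroup.eq.1 (Quotient.out_eq' _)
      exact ⟨(a, b), by simp [hb]⟩
  have h : Summable fun q : (A ⧸ φ.range) × B => f (q.1.out + φ q.2) :=
    (Equiv.ofBijective _ hbij).summable_iff.2 hf
  rw [← (Equiv.ofBijective _ hbij).tsum_eq f]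
  simp only [Equiv.ofBijective_apply]
  rw [h.tsum_prod, tsum_fintype]

/-! ### The theta series of dual cosets under `SL₂(ℤ)` -/

namespace NormLattice

variable (L : NormLattice)

/-- The Gram map, sending a lattice vector to its dual coordinates. -/
def gram : ℤ × ℤ →+ ℤ × ℤ where
  toFun n := (2 * L.P * n.1 + L.R * n.2, L.R * n.1 + 2 * L.S * n.2)
  map_zero' := by simp
  map_add' n n' := by
    ext <;> simp <;> ring

/-- The adjugate inverts the Gram matrix up to the discriminant, so `disc • ℤ²` lies in the image of
`gram` and the quotient is finite. -/
theorem gram_adjugate (n : ℤ × ℤ) :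
    L.gram (2 * L.S * n.1 - L.R * n.2, 2 * L.P * n.2 - L.R * n.1) = L.disc • n := by
  ext <;> simp [gram, disc] <;> ring

theorem adjugate_gram (n : ℤ × ℤ) : 2 * L.S * (L.gram n).1 - L.R * (L.gram n).2 = L.disc * n.1 ∧
    2 * L.P * (L.gram n).2 - L.R * (L.gram n).1 = L.disc * n.2 := by
  constructor <;> simp [gram, disc] <;> ring

theorem gram_injective : Function.Injective L.gram := by
  intro n n' h
  have hd : L.disc ≠ 0 := L.disc_pos.ne'
  obtain ⟨h1, h2⟩ := L.adjugate_gram n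
  obtain ⟨h1', h2'⟩ := L.adjugate_gram n'
  rw [h] at h1 h2
  ext
  · exact mul_left_cancel₀ hd (h1.symm.trans h1')
  · exact mul_left_cancel₀ hd (h2.symm.trans h2')

theorem dvec_gram (n : ℤ × ℤ) : L.dvec (L.gram n) = L.vec n := by
  obtain ⟨h1, h2⟩ := L.adjugate_gram n
  have h1' : (2 * L.S * (L.gram n).1 - L.R * (L.gram n).2 : ℂ) = L.disc * n.1 := by
    exact_mod_cast h1
  have h2' : (2 * L.P * (L.gram n).2 - L.R * (L.gram n).1 : ℂ) = L.disc * n.2 := by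
    exact_mod_cast h2
  have hd := L.disc_ne_zero
  rw [dvec, h1', h2', vec]
  field_simp

theorem dvec_add (m m' : ℤ × ℤ) : L.dvec (m + m') = L.dvec m + L.dvec m' := by
  rw [dvec, dvec, dvec, ← add_div]
  congr 1
  simp only [Prod.fst_add, Prod.snd_add]
  push_cast
  ring

instance finite_quotient_gram : Finite ((ℤ × ℤ) ⧸ L.gram.range) := by
  have hd : L.disc.natAbs ≠ 0 := Int.natAbs_ne_zero.2 L.disc_pos.ne'
  have : NeZero L.disc.natAbs := ⟨hd⟩
  refine Finite.of_surjective (fun r : ZMod L.disc.natAbs × ZMod L.disc.natAbs =>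
    ((residueRep r : ℤ × ℤ) : (ℤ × ℤ) ⧸ L.gram.range)) fun q => ?_
  obtain ⟨⟨r, n⟩, hrn⟩ := (intPairEquiv L.disc.natAbs).surjective q.out
  refine ⟨r, ?_⟩
  rw [← q.out_eq', ← hrn, intPairEquiv_apply]
  refine QuotientAddGroup.eq.2 ?_
  have : (L.disc.natAbs : ℤ) = L.disc := Int.natAbs_of_nonneg L.disc_pos.le
  rw [this, neg_add_eq_sub, add_sub_cancel_right, ← gram_adjugate]
  exact ⟨_, rfl⟩

instance fintypeQuotientGram : Fintype ((ℤ × ℤ) ⧸ L.gram.range) := Fintype.ofFinite _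

theorem isDual_dvec (m : ℤ × ℤ) : L.IsDual (L.dvec m) := by
  intro n
  refine ⟨n.1 * m.1 + n.2 * m.2, ?_⟩
  have := L.vec_dvec n m
  push_cast
  rw [← this]
  ring

variable {L}

theorem IsDual.intCast_mul {h : ℂ} (hh : L.IsDual h) (A : ℤ) : L.IsDual (A * h) := by
  intro n
  obtain ⟨j, hj⟩ := hh n
  refine ⟨A * j, ?_⟩
  push_cast
  rw [← hj, map_mul, map_intCast]
  ring

theorem IsDual.neg {h : ℂ} (hh : L.IsDual h) : L.IsDual (-h) := by
  have := hh.intCast_mul (-1)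
  simpa using this

/-- Theta series of integral translates behave simply under translations of `τ`. -/
theorem theta_add_int {h : ℂ} (hh : L.IsDual h) (u u' : ℂ) (n : ℤ) (τ : ℂ) :
    L.theta h u u' (n + τ) = e (h * conj h * n) * L.theta h u u' τ := by
  rw [theta, theta, ← tsum_mul_left]
  refine tsum_congr fun m => ?_
  rw [gterm_add_rat]
  congr 1
  obtain ⟨j, hj⟩ := hh m
  refine e_eq_of_sub_eq_intCast (n * (j + L.form m)) ?_
  push_cast
  rw [← vec_mul_conj, ← hj, map_add]
  ring

variable (L)

theorem theta_neg (h u u' τ : ℂ) : L.theta h (-u) (-u') τ = L.theta (-h) u u' τ := by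
  rw [theta, theta, ← (Equiv.neg (ℤ × ℤ)).tsum_eq (fun n => gterm (-h + L.vec n) u u' τ)]
  refine tsum_congr fun n => ?_
  rw [Equiv.neg_apply, vec_neg, gterm, gterm, ← neg_add]
  congr 1
  simp only [map_neg]
  ring

/-- The theta series of a coset as a function on `ℂ² × ℍ`. -/
def thetaFun (h : ℂ) (u u' : ℂ) (τ : ℍ) : ℂ := L.theta h u u' τ

/-- `theta_eq` at `-1/τ` gives a sum over dual vectors `y`. As `h` is dual, the character `e(h ȳ +
h̄ y)` is constant on cosets of the lattice in its dual, which groups the sum into finitely many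
theta series. -/
theorem slashOne_S_thetaFun {h : ℂ} (hh : L.IsDual h) : ∃ c : (ℤ × ℤ) ⧸ L.gram.range → ℂ,
    slashOne ModularGroup.S (L.thetaFun h) = ∑ q, c q • L.thetaFun (-L.dvec q.out) := by
  refine ⟨fun q => -Complex.I / Real.sqrt L.disc *
    e (h * conj (L.dvec q.out) + conj h * L.dvec q.out), ?_⟩
  funext u u' τ
  have hτ0 : (τ : ℂ) ≠ 0 := τ.ne_zero
  have hτ : 0 < (-1 / (τ : ℂ)).im := by
    rw [neg_div, Complex.neg_im, one_div, Complex.inv_im, neg_div, neg_neg]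
    exact div_pos τ.im_pos (Complex.normSq_pos.2 hτ0)
  have hs : (Real.sqrt L.disc : ℂ) ≠ 0 := by
    have : (0 : ℝ) < L.disc := by exact_mod_cast L.disc_pos
    exact_mod_cast (Real.sqrt_pos.2 this).ne'
  have hSτ : ((ModularGroup.S • τ : ℍ) : ℂ) = -1 / τ := by
    rw [coe_smul_eq]
    simp [autFactor, ModularGroup.coe_S]
  have key := L.theta_eq h (u / τ) (u' / τ) hτ
  have hu : ∀ v : ℂ, v / τ / (-1 / τ) = -v := fun v => by field_simp
  have hτ' : -1 / (-1 / (τ : ℂ)) = τ := by field_simp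
  rw [hu, hu, hτ'] at key
  rw [slashOne_S, thetaFun, hSτ, key,
    tsum_eq_sum_quotient L.gram L.gram_injective (L.summable_gterm_dvec h (-u) (-u') τ.im_pos)]
  have he : e (-(u / τ * (u' / τ) / (-1 / τ))) = e (u * u' / τ) := by
    congr 1
    field_simp
  rw [he, e_neg]
  have := e_ne_zero (u * u' / τ)
  simp only [Finset.sum_apply, Pi.smul_apply, smul_eq_mul, thetaFun, ← theta_neg]
  rw [Finset.mul_sum, Finset.mul_sum]
  refine Finset.sum_congr rfl fun q _ => ?_
  have hq : ∀ n, e (h * conj (L.dvec (q.out + L.gram n)) + conj h * L.dvec (q.out + L.gram n)) =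
      e (h * conj (L.dvec q.out) + conj h * L.dvec q.out) := by
    intro n
    obtain ⟨j, hj⟩ := hh n
    refine e_eq_of_sub_eq_intCast j ?_
    rw [dvec_add, dvec_gram, ← hj, map_add]
    ring
  simp_rw [hq, dvec_add, dvec_gram]
  rw [tsum_mul_left, theta]
  generalize e (u * u' / τ) = X at this
  field_simp

/-- The space spanned by the theta series of the cosets in the dual lattice. -/
def thetaSpace : Submodule ℂ (ℂ → ℂ → ℍ → ℂ) :=
  Submodule.span ℂ (L.thetaFun '' {h | L.IsDual h})

variable {L}

theorem slashOne_mem_thetaSpace_of_generator {γ : SL(2, ℤ)}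
    (hγ : ∀ h, L.IsDual h → slashOne γ (L.thetaFun h) ∈ L.thetaSpace) {ψ : ℂ → ℂ → ℍ → ℂ}
    (hψ : ψ ∈ L.thetaSpace) : slashOne γ ψ ∈ L.thetaSpace := by
  refine Submodule.span_induction ?_ ?_ ?_ ?_ hψ
  · rintro _ ⟨h, hh, rfl⟩
    exact hγ h hh
  · rw [slashOne_zero]
    exact zero_mem _
  · intro x y _ _ hx hy
    rw [slashOne_add]
    exact add_mem hx hy
  · intro a x _ hx
    rw [slashOne_smul]
    exact Submodule.smul_mem _ _ hx

theorem thetaFun_mem {h : ℂ} (hh : L.IsDual h) : L.thetaFun h ∈ L.thetaSpace :=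
  Submodule.subset_span ⟨h, hh, rfl⟩

theorem slashOne_T_thetaFun {h : ℂ} (hh : L.IsDual h) (n : ℤ) :
    slashOne (T ^ n) (L.thetaFun h) = e (h * conj h * n) • L.thetaFun h := by
  funext u u' τ
  rw [slashOne_T_zpow, thetaFun, UpperHalfPlane.coe_vadd]
  simpa [thetaFun] using theta_add_int hh u u' n τ

/-- `S` and `T` generate the modular group. Stability under `γ` and under `γ⁻¹` is proved
simultaneously, so that the induction also passes through inverses. -/
theorem slashOne_mem_thetaSpace (γ : SL(2, ℤ)) {ψ : ℂ → ℂ → ℍ → ℂ} (hψ : ψ ∈ L.thetaSpace) :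
    slashOne γ ψ ∈ L.thetaSpace := by
  have hS : ∀ ψ ∈ L.thetaSpace, slashOne ModularGroup.S ψ ∈ L.thetaSpace := fun ψ hψ => by
    refine slashOne_mem_thetaSpace_of_generator (fun h hh => ?_) hψ
    obtain ⟨c, hc⟩ := L.slashOne_S_thetaFun hh
    rw [hc]
    exact Submodule.sum_mem _ fun q _ => Submodule.smul_mem _ _ (thetaFun_mem (L.isDual_dvec _).neg)
  have hT : ∀ n : ℤ, ∀ ψ ∈ L.thetaSpace, slashOne (T ^ n) ψ ∈ L.thetaSpace := fun n ψ hψ => by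
    refine slashOne_mem_thetaSpace_of_generator (fun h hh => ?_) hψ
    rw [slashOne_T_thetaFun hh]
    exact Submodule.smul_mem _ _ (thetaFun_mem hh)
  have hSinv : ModularGroup.S⁻¹ = ModularGroup.S * ModularGroup.S * ModularGroup.S := by
    rw [inv_eq_iff_mul_eq_one]
    decide
  have hmem : γ ∈ Subgroup.closure {ModularGroup.S, T} := by
    simp [SpecialLinearGroup.SL2Z_generators]
  suffices h : (∀ ψ ∈ L.thetaSpace, slashOne γ ψ ∈ L.thetaSpace) ∧
      ∀ ψ ∈ L.thetaSpace, slashOne γ⁻¹ ψ ∈ L.thetaSpace from h.1 ψ hψ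
  induction hmem using Subgroup.closure_induction with
  | mem x hx =>
    rcases hx with rfl | rfl
    · refine ⟨hS, fun ψ hψ => ?_⟩
      rw [hSinv, slashOne_mul, slashOne_mul]
      exact hS _ (hS _ (hS _ hψ))
    · exact ⟨fun ψ hψ => by simpa using hT 1 ψ hψ, fun ψ hψ => by simpa using hT (-1) ψ hψ⟩
  | one => simp [slashOne_one]
  | mul x y _ _ hx hy =>
    refine ⟨fun ψ hψ => ?_, fun ψ hψ => ?_⟩
    · rw [slashOne_mul]
      exact hy.1 _ (hx.1 _ hψ)
    · rw [mul_inv_rev, slashOne_mul]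
      exact hx.2 _ (hy.2 _ hψ)
  | inv x _ hx => exact ⟨hx.2, by simpa using hx.1⟩

end NormLattice

end Slash

/-! ### From primes to `Γ₀(N)`, and polynomial weights -/

section GammaZero

open ModularGroup (T)

namespace NormLattice

variable (L : NormLattice)

/-- Dirichlet's theorem for the progression `d + cℤ`. -/
theorem exists_prime_add_mul {c d : ℤ} (hc : c ≠ 0) (h : IsCoprime d c) (M : ℕ) :
    ∃ (p : ℕ) (j : ℤ), p.Prime ∧ M < p ∧ (p : ℤ) = d + c * j := by
  have : NeZero c.natAbs := ⟨Int.natAbs_ne_zero.2 hc⟩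
  have hu : IsUnit (d : ZMod c.natAbs) := by
    obtain ⟨a, b, hab⟩ := h
    refine IsUnit.of_mul_eq_one (a : ZMod c.natAbs) ?_
    have h1 := congrArg (fun x : ℤ => (x : ZMod c.natAbs)) hab
    have h2 : (c : ZMod c.natAbs) = 0 := by
      rw [ZMod.intCast_zmod_eq_zero_iff_dvd, Int.natCast_natAbs, abs_dvd]
    simp only [Int.cast_add, Int.cast_mul, h2, mul_zero, add_zero, Int.cast_one] at h1
    rw [mul_comm]
    exact h1
  obtain ⟨p, hMp, hp, hpd⟩ := Nat.forall_exists_prime_gt_and_eq_mod hu M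
  have h1 : ((p - d : ℤ) : ZMod c.natAbs) = 0 := by
    push_cast
    rw [hpd, sub_self]
  rw [ZMod.intCast_zmod_eq_zero_iff_dvd, Int.natCast_natAbs, abs_dvd] at h1
  obtain ⟨j, hj⟩ := h1
  exact ⟨p, j, hp, hMp, by linarith⟩

variable {L}

theorem slashOne_neg_one_thetaFun (h : ℂ) : slashOne (-1) (L.thetaFun h) = -L.thetaFun (-h) := by
  funext u u' τ
  have h1 : autFactor (-1) τ = -1 := by simp [autFactor]
  rw [slashOne, h1, ModularGroup.SL_neg_smul, one_smul]
  simp only [thetaFun, Pi.neg_apply, ← theta_neg]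
  simp [e_zero, div_neg]

/-- Multiplying by `T^j` on the right moves `d` to an odd prime `d + cj`, and powers of `T` fix the
theta series of `Ah`, whose norm is integral. The character is needed only through its agreement
with the Legendre symbol at such primes. -/
theorem slashOne_gamma0_thetaFun_of_pos {N : ℕ} {χ : ℤ → ℤ}
    (hdual : ∀ m, L.disc ∣ N * L.dualForm m)
    (hdisc : ∀ p : ℕ, p.Prime → (p : ℤ) ∣ L.disc → p ∣ N) (hχ1 : χ 1 = 1)
    (hχ : ∀ d : ℤ, 0 < d → ∀ (p : ℕ) [Fact p.Prime], p ≠ 2 → (N : ℤ) ∣ p - d →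
      IsCoprime d N → χ d = legendreSym p (-L.disc))
    {h : ℂ} (hN : ∃ j : ℤ, h * conj h = j) (hB : L.IsDual h) (hNh : ∃ n, (N : ℂ) * h = L.vec n)
    {γ : SL(2, ℤ)} (hγ : (N : ℤ) ∣ γ 1 0) (hd : 0 < γ 1 1) :
    slashOne γ (L.thetaFun h) = (χ (γ 1 1) : ℂ) • L.thetaFun ((γ 0 0 : ℤ) * h) := by
  have hdet := det_eq γ
  obtain ⟨j₁, hj₁⟩ := hN
  have hTinv : ∀ (A : ℤ) (n : ℤ), slashOne (T ^ n) (L.thetaFun (A * h)) = L.thetaFun (A * h) := by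
    intro A n
    rw [slashOne_T_thetaFun (hB.intCast_mul A)]
    have : (A : ℂ) * h * conj ((A : ℂ) * h) * n = ((A ^ 2 * j₁ * n : ℤ) : ℂ) := by
      push_cast
      rw [← hj₁, map_mul, map_intCast]
      ring
    rw [this, e_intCast, one_smul]
  -- For `c = 0` there is no progression to use, but then `d = 1` and `γ` is a power of `T`.
  by_cases hc : γ 1 0 = 0
  · rw [hc, mul_zero, sub_zero] at hdet
    have h1 : γ 1 1 = 1 := by
      rcases Int.isUnit_iff.1 (IsUnit.of_mul_eq_one_right _ hdet) with h | h <;> omega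
    have h0 : γ 0 0 = 1 := by rw [h1, mul_one] at hdet; exact hdet
    have hT : γ = T ^ (γ 0 1) := by
      ext i j
      rw [ModularGroup.coe_T_zpow]
      fin_cases i <;> fin_cases j <;> simp [hc, h1, h0]
    rw [h1, h0, hχ1, Int.cast_one, one_smul]
    conv_lhs => rw [hT]
    simpa using hTinv 1 (γ 0 1)
  · have hcop : IsCoprime (γ 1 1) (γ 1 0) := ⟨γ 0 0, -γ 0 1, by linarith⟩
    -- The bound `2` makes the residue characteristic of the Gauss sums odd.
    obtain ⟨p, j, hp, hMp, hpj⟩ := exists_prime_add_mul hc hcop 2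
    have : Fact p.Prime := ⟨hp⟩
    have hp2 : p ≠ 2 := by omega
    obtain ⟨c', hc'⟩ := hγ
    have hpd : ¬ (p : ℤ) ∣ L.disc := by
      intro hdvd
      have h1 : (p : ℤ) ∣ γ 1 0 := (Int.natCast_dvd_natCast.2 (hdisc p hp hdvd)).trans ⟨c', hc'⟩
      have h2 : (p : ℤ) ∣ γ 1 1 := by
        have : γ 1 1 = p - γ 1 0 * j := by linarith
        rw [this]
        exact dvd_sub dvd_rfl (h1.mul_right j)
      have h3 : (p : ℤ) ∣ 1 := by
        rw [← hdet]
        exact dvd_sub (h2.mul_left _) (h1.mul_left _)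
      exact hp.one_lt.ne' (by exact_mod_cast Int.eq_one_of_dvd_one (by positivity) h3)
    have hγT : γ = γ * T ^ j * T ^ (-j) := by rw [mul_assoc, ← zpow_add]; simp
    have hmul : slashOne (γ * T ^ j) (L.thetaFun h) =
        (χ (γ 1 1) : ℂ) • L.thetaFun ((γ 0 0 : ℤ) * h) := by
      have e10 : (γ * T ^ j) 1 0 = γ 1 0 := by
        rw [mul_entry, ModularGroup.coe_T_zpow]; simp
      have e11 : (γ * T ^ j) 1 1 = p := by
        rw [mul_entry, ModularGroup.coe_T_zpow, hpj]; simp; ring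
      have e00 : (γ * T ^ j) 0 0 = γ 0 0 := by
        rw [mul_entry, ModularGroup.coe_T_zpow]; simp
      have hdet' := det_eq (γ * T ^ j)
      rw [e10, e11, e00] at hdet'
      funext u u' τ
      have key := L.theta_smul_prime hp2 (γ 0 0) ((γ * T ^ j) 0 1) (γ 1 0) hdet' ⟨j₁, hj₁⟩ hB
        (by
          obtain ⟨n, hn⟩ := hNh
          refine ⟨c' • n, ?_⟩
          rw [vec_smul, ← hn, hc']
          push_cast
          ring)
        (fun m => by rw [hc', mul_right_comm]; exact (hdual m).mul_right c') hpd u u' τ.im_pos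
      have hJ : autFactor (γ * T ^ j) τ = (γ 1 0 : ℤ) * (τ : ℂ) + p := by
        rw [autFactor, e10, e11]
        simp
      have hJ0 := autFactor_ne_zero (γ * T ^ j) τ
      have hχd := hχ (γ 1 1) hd p hp2 ⟨c' * j, by rw [hpj, hc']; ring⟩ (by
        rw [hc'] at hcop
        exact hcop.of_mul_right_left)
      rw [slashOne, thetaFun, coe_smul_eq, e10, e00, hJ, key, hχd]
      rw [hJ] at hJ0
      simp only [Pi.smul_apply, smul_eq_mul, thetaFun]
      rw [e_neg]
      have := e_ne_zero ((γ 1 0 : ℤ) * (u * u') / ((γ 1 0 : ℤ) * (τ : ℂ) + p))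
      generalize e ((γ 1 0 : ℤ) * (u * u') / ((γ 1 0 : ℤ) * (τ : ℂ) + p)) = X at this ⊢
      field_simp
    conv_lhs => rw [hγT]
    rw [slashOne_mul, hmul, slashOne_smul, hTinv]

/-- The transformation law of the theta series of a coset under `Γ₀(N)`. -/
theorem slashOne_gamma0_thetaFun {N : ℕ} {χ : ℤ → ℤ} (hN1 : 1 < N)
    (hdual : ∀ m, L.disc ∣ N * L.dualForm m)
    (hdisc : ∀ p : ℕ, p.Prime → (p : ℤ) ∣ L.disc → p ∣ N) (hχ1 : χ 1 = 1)
    (hχneg : ∀ d : ℤ, 0 < d → χ (-d) = -χ d)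
    (hχ : ∀ d : ℤ, 0 < d → ∀ (p : ℕ) [Fact p.Prime], p ≠ 2 → (N : ℤ) ∣ p - d →
      IsCoprime d N → χ d = legendreSym p (-L.disc))
    {h : ℂ} (hN : ∃ j : ℤ, h * conj h = j) (hB : L.IsDual h) (hNh : ∃ n, (N : ℂ) * h = L.vec n)
    {γ : SL(2, ℤ)} (hγ : (N : ℤ) ∣ γ 1 0) :
    slashOne γ (L.thetaFun h) = (χ (γ 1 1) : ℂ) • L.thetaFun ((γ 0 0 : ℤ) * h) := by
  rcases lt_trichotomy (γ 1 1) 0 with hd | hd | hd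
  -- In the odd weight one, `-1` acts by a sign and by `h ↦ -h`. The sign is absorbed by `χ(-d) =
  -- -χ(d)`, and `h ↦ -h` by the sign of the upper left entry.
  · have e10 : (-γ) 1 0 = -γ 1 0 := by simp
    have e11 : (-γ) 1 1 = -γ 1 1 := by simp
    have e00 : (-γ) 0 0 = -γ 0 0 := by simp
    have key := slashOne_gamma0_thetaFun_of_pos hdual hdisc hχ1 hχ hN hB hNh (γ := -γ)
      (by rw [e10]; exact hγ.neg_right) (by rw [e11]; omega)
    have hγ' : γ = -γ * -1 := by simp
    have h2 : χ (γ 1 1) = -χ (-γ 1 1) := by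
      have := hχneg (-γ 1 1) (by omega)
      rwa [neg_neg] at this
    conv_lhs => rw [hγ']
    rw [slashOne_mul, key, slashOne_smul, slashOne_neg_one_thetaFun, e00, e11, h2]
    push_cast
    simp
  -- `d = 0` would give `-bc = 1`, impossible because `N > 1` divides `c`.
  · exfalso
    have hdet := det_eq γ
    rw [hd, mul_zero, zero_sub] at hdet
    have h1 : (N : ℤ) ∣ 1 := by
      rw [← hdet]
      exact (hγ.mul_left _).neg_right
    have := Int.le_of_dvd one_pos h1
    omega
  · exact slashOne_gamma0_thetaFun_of_pos hdual hdisc hχ1 hχ hN hB hNh hγ hd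

/-- Every slash transform of a theta series is a finite combination of theta series. -/
theorem exists_slashOne_eq_sum {h : ℂ} (hh : L.IsDual h) (γ : SL(2, ℤ)) :
    ∃ (n : ℕ) (c : Fin n → ℂ) (g : Fin n → ℂ),
      slashOne γ (L.thetaFun h) = ∑ i, c i • L.thetaFun (g i) := by
  obtain ⟨n, c, g, hg⟩ := Submodule.mem_span_set'.1 (slashOne_mem_thetaSpace γ (thetaFun_mem hh))
  choose x hx using fun i => (g i).2
  exact ⟨n, c, x, by rw [← hg]; simp only [(hx _).2]⟩

/-! ### Polynomial weights -/

variable (L)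

/-- The theta series of the coset `h + L` with the weight `(x + s)^m`. -/
def wtheta (m : ℕ) (h s u u' τ : ℂ) : ℂ :=
  ∑' n : ℤ × ℤ, (h + L.vec n + s) ^ m * gterm (h + L.vec n) u u' τ

/-- The domination required for comparing moments: powers and exponentials of `|a(x + s)|` are
absorbed into one exponential weight in `|x|`. -/
theorem summable_gterm_moments (h s a : ℂ) (u u' : ℂ) {τ : ℂ} (hτ : 0 < τ.im) (m : ℕ) (r : ℝ) :
    Summable fun n : ℤ × ℤ => ‖gterm (h + L.vec n) u u' τ‖ * ‖a * (h + L.vec n + s)‖ ^ m *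
      Real.exp (r * ‖a * (h + L.vec n + s)‖) := by
  refine Summable.of_nonneg_of_le (fun _ => by positivity) (fun n => ?_)
    ((L.summable_weighted_gterm h 0 ((|r| + 1) * ‖a‖) u u' hτ).mul_left
      (m.factorial * Real.exp ((|r| + 1) * ‖a‖ * ‖s‖)))
  set y := ‖a * (h + L.vec n + s)‖ with hy
  have hy0 : 0 ≤ y := norm_nonneg _
  have h1 : y ^ m ≤ m.factorial * Real.exp y := by
    have := Real.pow_div_factorial_le_exp y hy0 m
    rwa [div_le_iff₀' (by positivity)] at this
  have h2 : y ≤ ‖a‖ * (‖h + L.vec n‖ + ‖s‖) := by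
    rw [hy, norm_mul]
    gcongr
    exact norm_add_le _ _
  have h3 : Real.exp y * Real.exp (r * y) ≤
      Real.exp ((|r| + 1) * ‖a‖ * ‖s‖) * Real.exp ((|r| + 1) * ‖a‖ * ‖h + L.vec n‖) := by
    rw [← Real.exp_add, ← Real.exp_add]
    refine Real.exp_le_exp.2 ?_
    have : r * y ≤ |r| * y := mul_le_mul_of_nonneg_right (le_abs_self r) hy0
    have : (|r| + 1) * y ≤ (|r| + 1) * (‖a‖ * (‖h + L.vec n‖ + ‖s‖)) := by gcongr
    nlinarith
  calc _ ≤ ‖gterm (h + L.vec n) u u' τ‖ * (m.factorial * Real.exp y) * Real.exp (r * y) := by gcongr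
    _ = m.factorial * ‖gterm (h + L.vec n) u u' τ‖ * (Real.exp y * Real.exp (r * y)) := by ring
    _ ≤ m.factorial * ‖gterm (h + L.vec n) u u' τ‖ *
        (Real.exp ((|r| + 1) * ‖a‖ * ‖s‖) * Real.exp ((|r| + 1) * ‖a‖ * ‖h + L.vec n‖)) := by gcongr
    _ = _ := by ring

theorem summable_wtheta (m : ℕ) (h s u u' : ℂ) {τ : ℂ} (hτ : 0 < τ.im) :
    Summable fun n : ℤ × ℤ => (h + L.vec n + s) ^ m * gterm (h + L.vec n) u u' τ := by
  refine Summable.of_norm ((L.summable_gterm_moments h s 1 u u' hτ m 0).congr fun n => ?_)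
  simp [mul_comm]

variable {L}

/-- The transformation laws of theta series carry over to polynomial weights. -/
theorem wtheta_smul {ι : Type*} [Fintype ι] {h : ℂ} {c g : ι → ℂ} {γ : SL(2, ℤ)}
    (H : slashOne γ (L.thetaFun h) = ∑ i, c i • L.thetaFun (g i)) (m : ℕ) (s u u' : ℂ) (τ : ℍ) :
    (autFactor γ τ)⁻¹ * e (-((γ 1 0 : ℤ) * (u * u') / autFactor γ τ)) *
      L.wtheta m h (autFactor γ τ * s - (γ 1 0 : ℤ) * u) (u / autFactor γ τ) (u' / autFactor γ τ)
        (γ • τ : ℍ) = autFactor γ τ ^ m * ∑ i, c i * L.wtheta m (g i) s u u' τ := by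
  obtain ⟨j, hj⟩ : ∃ j, j = autFactor γ τ := ⟨_, rfl⟩
  obtain ⟨C, hC⟩ : ∃ C : ℂ, C = (γ 1 0 : ℤ) := ⟨_, rfl⟩
  obtain ⟨τ', hτ'⟩ : ∃ τ', τ' = γ • τ := ⟨_, rfl⟩
  have hj0 : j ≠ 0 := hj ▸ autFactor_ne_zero γ τ
  -- The identity is needed at every second argument `v` with `u` fixed; the second argument will
  -- carry the generating parameter.
  have hH : ∀ v : ℂ, j⁻¹ * e (-(C * (u * v) / j)) * L.theta h (u / j) (v / j) τ' =
      ∑ i, c i * L.theta (g i) u v τ := fun v => by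
    have := congr_fun (congr_fun (congr_fun H u) v) τ
    simpa [slashOne, thetaFun, hj, hC, hτ'] using this
  rw [← hj, ← hC, ← hτ']
  obtain ⟨κ, hκ⟩ : ∃ κ : ℂ, κ = 2 * Real.pi * Complex.I := ⟨_, rfl⟩
  have hκ0 : κ ≠ 0 := by rw [hκ]; simp [Real.pi_ne_zero]
  have heκ : ∀ y : ℂ, e y = Complex.exp (κ * y) := fun y => by rw [e, hκ]
  have hs1 : ∀ (m : ℕ) (r : ℝ), Summable fun n : ℤ × ℤ =>
      ‖j⁻¹ * e (-(C * (u * u') / j)) * gterm (h + L.vec n) (u / j) (u' / j) τ'‖ *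
        ‖κ / j * (h + L.vec n + (j * s - C * u))‖ ^ m *
        Real.exp (r * ‖κ / j * (h + L.vec n + (j * s - C * u))‖) := fun m r => by
    refine ((L.summable_gterm_moments h (j * s - C * u) (κ / j) (u / j) (u' / j) τ'.im_pos m
      r).mul_left ‖j⁻¹ * e (-(C * (u * u') / j))‖).congr fun n => ?_
    rw [norm_mul (j⁻¹ * _)]
    ring
  have hs2 : ∀ (m : ℕ) (r : ℝ), Summable fun q : ι × (ℤ × ℤ) =>
      ‖c q.1 * gterm (g q.1 + L.vec q.2) u u' τ‖ * ‖κ * (g q.1 + L.vec q.2 + s)‖ ^ m *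
        Real.exp (r * ‖κ * (g q.1 + L.vec q.2 + s)‖) := fun m r => by
    rw [summable_prod_of_nonneg (fun _ => by positivity)]
    refine ⟨fun i => ((L.summable_gterm_moments (g i) s κ u u' τ.im_pos m r).mul_left
      ‖c i‖).congr fun n => ?_, Summable.of_finite⟩
    rw [norm_mul (c i)]
    ring
  -- Put `v = u' + t` and multiply by `e(s t)`: the frequencies in `t` are `(x + js - Cu)/j` on the
  -- left and `y + s` on the right, up to the common factor `κ = 2πi`. Equality for all `t` gives
  -- equality of the `m`-th moments.
  have key := tsum_mul_pow_eq_of_tsum_exp_eq hs1 hs2 (fun t => ?_) m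
  · have hs3 : Summable fun q : ι × (ℤ × ℤ) =>
        c q.1 * gterm (g q.1 + L.vec q.2) u u' τ * (κ * (g q.1 + L.vec q.2 + s)) ^ m := by
      refine Summable.of_norm ((hs2 m 0).congr fun q => ?_)
      rw [norm_mul (c q.1 * _), norm_pow]
      simp
    rw [hs3.tsum_prod, tsum_fintype (β := ι)] at key
    have hl : ∀ n : ℤ × ℤ, j⁻¹ * e (-(C * (u * u') / j)) *
        gterm (h + L.vec n) (u / j) (u' / j) τ' * (κ / j * (h + L.vec n + (j * s - C * u))) ^ m =
        (κ / j) ^ m * (j⁻¹ * e (-(C * (u * u') / j))) *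
          ((h + L.vec n + (j * s - C * u)) ^ m * gterm (h + L.vec n) (u / j) (u' / j) τ') :=
      fun n => by rw [mul_pow]; ring
    have hr : ∀ (i : ι) (n : ℤ × ℤ), c i * gterm (g i + L.vec n) u u' τ *
        (κ * (g i + L.vec n + s)) ^ m =
        κ ^ m * c i * ((g i + L.vec n + s) ^ m * gterm (g i + L.vec n) u u' τ) :=
      fun i n => by rw [mul_pow]; ring
    simp_rw [hl, hr] at key
    rw [tsum_mul_left] at key
    simp_rw [tsum_mul_left] at key
    simp_rw [mul_assoc (κ ^ m)] at key
    rw [← Finset.mul_sum, div_pow] at key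
    have hκm : κ ^ m ≠ 0 := pow_ne_zero _ hκ0
    have hjm : j ^ m ≠ 0 := pow_ne_zero _ hj0
    have key2 := congrArg (fun x => j ^ m / κ ^ m * x) key
    simp only [wtheta]
    refine Eq.trans ?_ (key2.trans ?_)
    · field_simp
    · field_simp
  · have ht := congrArg (fun x => e (s * t) * x) (hH (u' + t))
    simp only [theta] at ht
    have hs4 : Summable fun q : ι × (ℤ × ℤ) => c q.1 * gterm (g q.1 + L.vec q.2) u u' τ *
        Complex.exp (t * (κ * (g q.1 + L.vec q.2 + s))) := by
      refine Summable.of_norm_bounded (hs2 0 ‖t‖) fun q => ?_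
      rw [norm_mul, pow_zero, mul_one]
      refine mul_le_mul_of_nonneg_left ((Complex.norm_exp_le_exp_norm _).trans ?_) (norm_nonneg _)
      rw [norm_mul]
    rw [hs4.tsum_prod, tsum_fintype (β := ι)]
    refine Eq.trans ?_ (ht.trans ?_)
    · rw [← tsum_mul_left, ← tsum_mul_left]
      refine tsum_congr fun n => ?_
      rw [add_div, gterm_add_right]
      have h1 : t * (κ / j * (h + L.vec n + (j * s - C * u))) =
          κ * (t * (h + L.vec n + (j * s - C * u)) / j) := by ring
      rw [h1, ← heκ]
      have h2 : e (s * t) * (e (-(C * (u * (u' + t)) / j)) * e ((h + L.vec n) * (t / j))) =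
          e (-(C * (u * u') / j)) * e (t * (h + L.vec n + (j * s - C * u)) / j) := by
        rw [← e_add, ← e_add, ← e_add]
        congr 1
        field_simp
        ring
      linear_combination (-(j⁻¹ * gterm (h + L.vec n) (u / j) (u' / j) τ')) * h2
    · rw [Finset.mul_sum]
      refine Finset.sum_congr rfl fun i _ => ?_
      rw [← mul_assoc, ← tsum_mul_left]
      refine tsum_congr fun n => ?_
      have h1 : t * (κ * (g i + L.vec n + s)) = κ * (s * t + (g i + L.vec n) * t) := by ring
      rw [gterm_add_right, h1, ← heκ, e_add]
      ring

end NormLattice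

end GammaZero

/-! ### Imaginary quadratic fields -/

section Imaginary

variable {K : Type*} [Field K] [NumberField K]

/-- The sign of the discriminant is `(-1)^r₂`, so `r₂ ≠ 0`, and `r₁ + 2r₂ = 2` leaves `r₁ = 0`. -/
theorem isTotallyComplex_of_discr_neg (hK : Module.finrank ℚ K = 2) (hD : discr K < 0) :
    IsTotallyComplex K := by
  have h1 := InfinitePlace.card_add_two_mul_card_eq_rank K
  have h2 := sign_discr K
  rw [Int.sign_eq_neg_one_of_neg hD] at h2
  rw [← nrRealPlaces_eq_zero_iff]
  rw [hK] at h1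
  have h3 : InfinitePlace.nrComplexPlaces K ≠ 0 := by
    intro h0
    rw [h0] at h2
    norm_num at h2
  omega

theorem exists_equiv_embeddings (hK : Module.finrank ℚ K = 2) (hD : discr K < 0) (σ : K →+* ℂ) :
    ∃ E : Fin 2 ≃ (K →ₐ[ℚ] ℂ), ∀ x, E 0 x = σ x ∧ E 1 x = conj (σ x) := by
  have := isTotallyComplex_of_discr_neg hK hD
  have hne : (ComplexEmbedding.conjugate σ) ≠ σ := fun h =>
    IsTotallyComplex.complexEmbedding_not_isReal σ (ComplexEmbedding.isReal_iff.2 h)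
  have hbij : Function.Bijective
      (![σ.toRatAlgHom, (ComplexEmbedding.conjugate σ).toRatAlgHom] : Fin 2 → (K →ₐ[ℚ] ℂ)) := by
    rw [Fintype.bijective_iff_injective_and_card]
    refine ⟨?_, by rw [AlgHom.card, hK, Fintype.card_fin]⟩
    have hne' : σ.toRatAlgHom ≠ (ComplexEmbedding.conjugate σ).toRatAlgHom := by
      intro h
      refine hne (RingHom.ext fun x => ?_)
      exact (congrArg (fun f : K →ₐ[ℚ] ℂ => f x) h).symm
    intro i j hij
    fin_cases i <;> fin_cases j <;> simp_all
  exact ⟨Equiv.ofBijective _ hbij, fun x => ⟨rfl, rfl⟩⟩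

theorem norm_eq_mul_conj (hK : Module.finrank ℚ K = 2) (hD : discr K < 0) (σ : K →+* ℂ) (x : K) :
    ((Algebra.norm ℚ x : ℚ) : ℂ) = σ x * conj (σ x) := by
  obtain ⟨E, hE⟩ := exists_equiv_embeddings hK hD σ
  have h := Algebra.norm_eq_prod_embeddings ℚ ℂ x
  rw [← E.prod_comp, Fin.prod_univ_two, (hE x).1, (hE x).2] at h
  rw [← h]
  rfl

theorem absNorm_span_eq (hK : Module.finrank ℚ K = 2) (hD : discr K < 0) (σ : K →+* ℂ) (x : 𝓞 K) :
    (Ideal.absNorm (Ideal.span {x}) : ℂ) = σ x * conj (σ x) := by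
  have h := norm_eq_mul_conj hK hD σ x
  have h1 : (Algebra.norm ℚ (x : K)) = ((Algebra.norm ℤ x : ℤ) : ℚ) :=
    (Algebra.coe_norm_int x).symm
  rw [h1, Rat.cast_intCast] at h
  have hnn : 0 ≤ Algebra.norm ℤ x := by
    have h2 : ((Algebra.norm ℤ x : ℤ) : ℂ) = ((Complex.normSq (σ x) : ℝ) : ℂ) := by
      rw [h, Complex.mul_conj]
    have h3 : ((Algebra.norm ℤ x : ℤ) : ℝ) = Complex.normSq (σ x) := by exact_mod_cast h2
    have h4 : (0 : ℝ) ≤ (Algebra.norm ℤ x : ℤ) := h3 ▸ Complex.normSq_nonneg _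
    exact_mod_cast h4
  rw [Ideal.absNorm_span_singleton, ← h]
  have : ((Algebra.norm ℤ x).natAbs : ℤ) = Algebra.norm ℤ x := Int.natAbs_of_nonneg hnn
  rw [← Int.cast_natCast, this]

/-- `(x) ⊆ I`, so `N(I)` divides `N(x)`. -/
theorem mul_conj_eq_of_mem (hK : Module.finrank ℚ K = 2) (hD : discr K < 0) (σ : K →+* ℂ)
    {I : Ideal (𝓞 K)} {x : 𝓞 K} (hx : x ∈ I) :
    ∃ j : ℤ, σ x * conj (σ x) = (j : ℂ) * Ideal.absNorm I := by
  obtain ⟨j, hj⟩ := Ideal.absNorm_dvd_absNorm_of_le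
    ((Ideal.span_singleton_le_iff_mem I).2 hx)
  refine ⟨j, ?_⟩
  rw [← absNorm_span_eq hK hD, hj]
  push_cast
  ring

/-- Polarisation of `mul_conj_eq_of_mem`. -/
theorem trace_eq_of_mem (hK : Module.finrank ℚ K = 2) (hD : discr K < 0) (σ : K →+* ℂ)
    {I : Ideal (𝓞 K)} {x y : 𝓞 K} (hx : x ∈ I) (hy : y ∈ I) :
    ∃ j : ℤ, σ x * conj (σ y) + conj (σ x) * σ y = (j : ℂ) * Ideal.absNorm I := by
  obtain ⟨j₁, h₁⟩ := mul_conj_eq_of_mem hK hD σ hx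
  obtain ⟨j₂, h₂⟩ := mul_conj_eq_of_mem hK hD σ hy
  obtain ⟨j₃, h₃⟩ := mul_conj_eq_of_mem hK hD σ (I.add_mem hx hy)
  refine ⟨j₃ - j₁ - j₂, ?_⟩
  push_cast at h₃ ⊢
  rw [sub_mul, sub_mul, ← h₁, ← h₂, ← h₃, map_add, map_add]
  ring

/-- A `ℤ`-basis of the ring of integers indexed by `Fin 2`. -/
def ringBasis (hK : Module.finrank ℚ K = 2) : Module.Basis (Fin 2) ℤ (𝓞 K) :=
  (RingOfIntegers.basis K).reindex (Fintype.equivFinOfCardEq (by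
    rw [← Module.finrank_eq_card_chooseBasisIndex, RingOfIntegers.rank, hK]))

theorem ringBasis_disc (hK : Module.finrank ℚ K = 2) (hD : discr K < 0) (σ : K →+* ℂ) :
    (σ (ringBasis hK 0) * conj (σ (ringBasis hK 1)) -
      conj (σ (ringBasis hK 0)) * σ (ringBasis hK 1)) ^ 2 = (discr K : ℂ) := by
  obtain ⟨E, hE⟩ := exists_equiv_embeddings hK hD σ
  have h0 : Algebra.discr ℚ (fun i => ((ringBasis hK i : 𝓞 K) : K)) = (discr K : ℚ) := by
    rw [coe_discr, ← Algebra.discr_reindex ℚ (integralBasis K) (Fintype.equivFinOfCardEq (by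
      rw [← Module.finrank_eq_card_chooseBasisIndex, RingOfIntegers.rank, hK]))]
    congr 1
    funext i
    simp [ringBasis, integralBasis_apply]
  have h1 := Algebra.discr_eq_det_embeddingsMatrixReindex_pow_two ℚ ℂ
    (fun i => ((ringBasis hK i : 𝓞 K) : K)) E
  rw [h0, Matrix.det_fin_two] at h1
  simp only [Algebra.embeddingsMatrixReindex, Matrix.reindex_apply, Matrix.submatrix_apply,
    Algebra.embeddingsMatrix_apply, Equiv.refl_symm, Equiv.refl_apply, Equiv.symm_symm,
    (hE _).1, (hE _).2] at h1
  have h2 : algebraMap ℚ ℂ (discr K : ℚ) = (discr K : ℂ) := by simp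
  rw [← h2, h1]

/-- Passing from a basis of the ring to a basis of `I` multiplies the determinant of the two
embeddings by `±N(I)`. -/
theorem basis_disc (hK : Module.finrank ℚ K = 2) (hD : discr K < 0) (σ : K →+* ℂ)
    {I : Ideal (𝓞 K)} (b : Module.Basis (Fin 2) ℤ I) :
    (σ (b 0 : 𝓞 K) * conj (σ (b 1 : 𝓞 K)) - conj (σ (b 0 : 𝓞 K)) * σ (b 1 : 𝓞 K)) ^ 2 =
      (discr K : ℂ) * (Ideal.absNorm I : ℂ) ^ 2 := by
  have hdet := Ideal.natAbs_det_basis_change (ringBasis hK) I b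
  rw [Module.Basis.det_apply, Matrix.det_fin_two] at hdet
  simp only [Module.Basis.toMatrix_apply, Function.comp] at hdet
  set M : Fin 2 → Fin 2 → ℤ := fun i j => (ringBasis hK).repr (b j : 𝓞 K) i with hM
  have hb : ∀ j, σ (b j : 𝓞 K) = M 0 j * σ (ringBasis hK 0) + M 1 j * σ (ringBasis hK 1) := by
    intro j
    have h := (ringBasis hK).sum_repr (b j : 𝓞 K)
    rw [Fin.sum_univ_two] at h
    conv_lhs => rw [← h]
    simp [hM]
  have hsq : (Ideal.absNorm I : ℂ) ^ 2 = (M 0 0 * M 1 1 - M 0 1 * M 1 0 : ℂ) ^ 2 := by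
    have : ((Ideal.absNorm I : ℤ)) ^ 2 = (M 0 0 * M 1 1 - M 0 1 * M 1 0) ^ 2 := by
      rw [← hdet]
      exact Int.natAbs_sq _
    exact_mod_cast this
  rw [hsq, ← ringBasis_disc hK hD σ, hb, hb]
  simp only [map_add, map_mul, map_intCast]
  ring

/-- The norm form of an ideal, divided by the norm of the ideal, is an integral form of
discriminant `D`. -/
theorem exists_form (hK : Module.finrank ℚ K = 2) (hD : discr K < 0) (σ : K →+* ℂ)
    {I : Ideal (𝓞 K)} (hI : I ≠ ⊥) (b : Module.Basis (Fin 2) ℤ I) :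
    ∃ P R S : ℤ, σ (b 0 : 𝓞 K) * conj (σ (b 0 : 𝓞 K)) = P * (Ideal.absNorm I : ℂ) ∧
      σ (b 0 : 𝓞 K) * conj (σ (b 1 : 𝓞 K)) + conj (σ (b 0 : 𝓞 K)) * σ (b 1 : 𝓞 K) =
        R * (Ideal.absNorm I : ℂ) ∧
      σ (b 1 : 𝓞 K) * conj (σ (b 1 : 𝓞 K)) = S * (Ideal.absNorm I : ℂ) ∧
      R ^ 2 - 4 * P * S = discr K ∧ 0 < P := by
  obtain ⟨P, hP⟩ := mul_conj_eq_of_mem hK hD σ (b 0).2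
  obtain ⟨R, hR⟩ := trace_eq_of_mem hK hD σ (b 0).2 (b 1).2
  obtain ⟨S, hS⟩ := mul_conj_eq_of_mem hK hD σ (b 1).2
  have hN : (Ideal.absNorm I : ℂ) ≠ 0 := by
    exact_mod_cast Ideal.absNorm_ne_zero_iff_mem_nonZeroDivisors.2
      (mem_nonZeroDivisors_iff_ne_zero.2 hI)
  have hdisc : R ^ 2 - 4 * P * S = discr K := by
    have h := basis_disc hK hD σ b
    have h1 : ((R : ℂ) ^ 2 - 4 * P * S) * (Ideal.absNorm I : ℂ) ^ 2 =
        (discr K : ℂ) * (Ideal.absNorm I : ℂ) ^ 2 := by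
      rw [← h]
      have : ((R : ℂ) ^ 2 - 4 * P * S) * (Ideal.absNorm I : ℂ) ^ 2 =
          (R * (Ideal.absNorm I : ℂ)) ^ 2 - 4 * (P * (Ideal.absNorm I : ℂ)) *
            (S * (Ideal.absNorm I : ℂ)) := by ring
      rw [this, ← hP, ← hR, ← hS]
      ring
    exact_mod_cast mul_right_cancel₀ (pow_ne_zero 2 hN) h1
  refine ⟨P, R, S, hP, hR, hS, hdisc, ?_⟩
  have h2 : (Complex.normSq (σ (b 0 : 𝓞 K)) : ℝ) = P * (Ideal.absNorm I : ℝ) := by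
    rw [Complex.mul_conj] at hP
    exact_mod_cast hP
  have h3 : (0 : ℝ) < Complex.normSq (σ (b 0 : 𝓞 K)) := by
    refine Complex.normSq_pos.2 ?_
    rw [Ne, map_eq_zero]
    intro h0
    have : (b 0 : 𝓞 K) = 0 := by exact_mod_cast h0
    exact b.ne_zero 0 (Subtype.ext this)
  rw [h2] at h3
  have h4 : (0 : ℝ) < P := pos_of_mul_pos_left h3 (by positivity)
  exact_mod_cast h4

/-- A basis of a nonzero ideal of an imaginary quadratic field, as a lattice in `ℂ`. -/
theorem exists_normLattice (hK : Module.finrank ℚ K = 2) (hD : discr K < 0) (σ : K →+* ℂ)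
    {I : Ideal (𝓞 K)} (hI : I ≠ ⊥) (b : Module.Basis (Fin 2) ℤ I) {M : ℕ} {N₀ : ℝ} (hN₀ : 0 < N₀)
    (hM : 0 < M) (hI' : (Ideal.absNorm I : ℝ) = M * N₀) :
    ∃ L : NormLattice, L.w₁ = σ (b 0 : 𝓞 K) / (Real.sqrt N₀ : ℝ) ∧
      L.w₂ = σ (b 1 : 𝓞 K) / (Real.sqrt N₀ : ℝ) ∧ L.disc = -discr K * M ^ 2 ∧
      ∀ m, L.disc ∣ ((discr K).natAbs * M : ℕ) * L.dualForm m := by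
  obtain ⟨P, R, S, hP, hR, hS, hdisc, -⟩ := exists_form hK hD σ hI b
  have hs : ((Real.sqrt N₀ : ℝ) : ℂ) ^ 2 = N₀ := by
    rw [← Complex.ofReal_pow, Real.sq_sqrt hN₀.le]
  have hs0 : ((Real.sqrt N₀ : ℝ) : ℂ) ≠ 0 := by exact_mod_cast (Real.sqrt_pos.2 hN₀).ne'
  have hI'' : (Ideal.absNorm I : ℂ) = M * ((Real.sqrt N₀ : ℝ) : ℂ) ^ 2 := by
    rw [hs]
    exact_mod_cast hI'
  rw [hI''] at hP hR hS
  -- In the application `I = 𝔪𝔞₀`, `N₀ = N(𝔞₀)` and `M = N(𝔪)`. Scaling by `√N₀` leaves `M` times a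
  -- form of discriminant `D`, so the discriminant of the lattice acquires `M²` while the level
  -- acquires only `M`.
  refine ⟨⟨σ (b 0 : 𝓞 K) / (Real.sqrt N₀ : ℝ), σ (b 1 : 𝓞 K) / (Real.sqrt N₀ : ℝ), M * P, M * R,
    M * S, ?_, ?_, ?_, ?_⟩, rfl, rfl, ?_, fun m => ?_⟩
  · rw [map_div₀, Complex.conj_ofReal, div_mul_div_comm, hP]
    field_simp
    push_cast
    ring
  · rw [map_div₀, map_div₀, Complex.conj_ofReal, div_mul_div_comm, div_mul_div_comm, ← add_div, hR]
    field_simp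
    push_cast
    ring
  · rw [map_div₀, Complex.conj_ofReal, div_mul_div_comm, hS]
    field_simp
    push_cast
    ring
  · have h1 : 4 * ((M : ℤ) * P) * (M * S) - (M * R) ^ 2 = -discr K * M ^ 2 := by
      rw [← hdisc]; ring
    rw [h1]
    have hM' : (0 : ℤ) < M := by exact_mod_cast hM
    exact mul_pos (by omega) (by positivity)
  · simp only [NormLattice.disc]
    rw [← hdisc]; ring
  · have hab : ((discr K).natAbs : ℤ) = -discr K := by
      rw [Int.ofNat_natAbs_of_nonpos hD.le]
    simp only [NormLattice.disc, NormLattice.dualForm]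
    refine ⟨S * m.1 ^ 2 - R * (m.1 * m.2) + P * m.2 ^ 2, ?_⟩
    push_cast
    rw [← Int.natCast_natAbs, hab, ← hdisc]
    ring

end Imaginary

/-! ### The finite part of a Hecke character -/

section Hecke

open IsDedekindDomain

theorem infType_mul (m : ℕ) (x y : ℂ) : infType m (x * y) = infType m x * infType m y := by
  rw [infType, infType, infType, ← mul_pow, norm_mul, Complex.ofReal_mul, mul_div_mul_comm]

theorem infType_ne_zero (m : ℕ) {x : ℂ} (hx : x ≠ 0) : infType m x ≠ 0 :=
  pow_ne_zero _ (div_ne_zero hx (by simpa using hx))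

theorem infType_div (m : ℕ) (x : ℂ) {y : ℂ} (hy : y ≠ 0) :
    infType m (x / y) = infType m x / infType m y := by
  rw [eq_div_iff (infType_ne_zero m hy), ← infType_mul, div_mul_cancel₀ _ hy]

theorem eq_top_of_isUnit_zero {R : Type*} [CommRing R] {I : Ideal R}
    (h : IsUnit (Ideal.Quotient.mk I (0 : R))) : I = ⊤ := by
  rw [map_zero, isUnit_zero_iff] at h
  exact Ideal.Quotient.subsingleton_iff.1 (subsingleton_of_zero_eq_one h)

variable {K : Type*} [Field K] [NumberField K] {𝔪 : Ideal (𝓞 K)}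

theorem notMem_of_isUnit_mk {α : 𝓞 K} (hα : IsUnit (Ideal.Quotient.mk 𝔪 α))
    {v : HeightOneSpectrum (𝓞 K)} (hv : v.asIdeal ∣ 𝔪) : α ∉ v.asIdeal := by
  intro hmem
  obtain ⟨β, hβ⟩ := hα.exists_right_inv
  obtain ⟨β, rfl⟩ := Ideal.Quotient.mk_surjective β
  rw [← map_mul, ← map_one (Ideal.Quotient.mk 𝔪), Ideal.Quotient.eq] at hβ
  have h1 : α * β - 1 ∈ v.asIdeal := Ideal.dvd_iff_le.1 hv hβ
  have h2 : (1 : 𝓞 K) ∈ v.asIdeal := by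
    have := v.asIdeal.sub_mem (v.asIdeal.mul_mem_right β hmem) h1
    rwa [sub_sub_cancel] at this
  exact v.isPrime.ne_top ((Ideal.eq_top_iff_one _).2 h2)

theorem toPrincipalIdeal_mem_idealGroup {α : 𝓞 K} (hα : IsUnit (Ideal.Quotient.mk 𝔪 α))
    (h0 : (α : K) ≠ 0) : toPrincipalIdeal (𝓞 K) K (Units.mk0 (α : K) h0) ∈ idealGroup 𝔪 := by
  intro v hv
  have h1 : ((toPrincipalIdeal (𝓞 K) K (Units.mk0 (α : K) h0) : (FractionalIdeal (𝓞 K)⁰ K)ˣ) :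
      FractionalIdeal (𝓞 K)⁰ K) = ((Ideal.span {α} : Ideal (𝓞 K)) : FractionalIdeal (𝓞 K)⁰ K) := by
    rw [coe_toPrincipalIdeal, FractionalIdeal.coeIdeal_span_singleton]
    rfl
  have hα0 : Ideal.span {α} ≠ (0 : Ideal (𝓞 K)) := by
    rw [Ne, Ideal.zero_eq_bot, Ideal.span_singleton_eq_bot]
    rintro rfl
    simp at h0
  rw [h1, FractionalIdeal.count_coe K v hα0]
  by_contra h
  have h2 : (Associates.mk v.asIdeal).count (Associates.mk (Ideal.span {α})).factors ≠ 0 := by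
    exact_mod_cast h
  rw [Associates.count_ne_zero_iff_dvd hα0 v.irreducible, Ideal.dvd_span_singleton] at h2
  exact notMem_of_isUnit_mk hα hv h2

/-- `β` is a unit at each prime dividing `𝔪`, so `α/β - 1` has the same valuation there as `α - β`.
-/
theorem congrOne_div {α β : 𝓞 K} (hβ : IsUnit (Ideal.Quotient.mk 𝔪 β)) (hβ0 : (β : K) ≠ 0)
    (h : α - β ∈ 𝔪) : CongrOne 𝔪 ((α : K) / β) := by
  intro v n hn hv
  have h1 : (α : K) / β - 1 = algebraMap (𝓞 K) K (α - β) / algebraMap (𝓞 K) K β := by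
    rw [map_sub, sub_div, div_self hβ0]
  have h2 : v.intValuation β = 1 :=
    HeightOneSpectrum.intValuation_eq_one_iff.2
      (notMem_of_isUnit_mk hβ ((dvd_pow_self _ hn.ne').trans hv))
  rw [h1, map_div₀, HeightOneSpectrum.valuation_of_algebraMap,
    HeightOneSpectrum.valuation_of_algebraMap, h2, div_one]
  rw [HeightOneSpectrum.intValuation_le_pow_iff_dvd, Ideal.dvd_span_singleton]
  exact Ideal.dvd_iff_le.1 hv h

theorem congrOne_top (x : K) : CongrOne (⊤ : Ideal (𝓞 K)) x := by
  intro v n hn hv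
  exact absurd ((dvd_pow_self _ hn.ne').trans hv) fun h =>
    v.isPrime.ne_top (top_le_iff.1 (Ideal.dvd_iff_le.1 h))

namespace HeckeChar

variable {σ : K →+* ℂ} {m : ℕ} (ξ : HeckeChar σ 𝔪 m)

theorem value_mul {I J : (FractionalIdeal (𝓞 K)⁰ K)ˣ} (hI : I ∈ idealGroup 𝔪)
    (hJ : J ∈ idealGroup 𝔪) : ξ.value (I * J) = ξ.value I * ξ.value J := by
  rw [value, value, value, dif_pos hI, dif_pos hJ, dif_pos (mul_mem hI hJ)]
  have : (⟨I * J, mul_mem hI hJ⟩ : idealGroup 𝔪) = ⟨I, hI⟩ * ⟨J, hJ⟩ := rfl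
  rw [this, map_mul, Units.val_mul]

theorem finitePart_of_not_isUnit {α : 𝓞 K} (hα : ¬ IsUnit (Ideal.Quotient.mk 𝔪 α)) :
    ξ.finitePart α = 0 := by
  rw [finitePart, if_neg hα]

theorem finitePart_of_ne_zero {α : 𝓞 K} (hα : IsUnit (Ideal.Quotient.mk 𝔪 α))
    (h0 : (α : K) ≠ 0) : ξ.finitePart α =
      ξ.value (toPrincipalIdeal (𝓞 K) K (Units.mk0 (α : K) h0)) / infType m (σ α) := by
  rw [finitePart, if_pos hα, dif_neg h0]

/-- For `𝔪 = 𝓞 K` the congruence condition is empty, so `ξ(α 𝓞 K) = ξ_∞(α)` for all nonzero `α`;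
this is consistent with the value `1` assigned at `0`. -/
theorem finitePart_eq_one_of_top (h : 𝔪 = ⊤) (α : 𝓞 K) : ξ.finitePart α = 1 := by
  have hα : IsUnit (Ideal.Quotient.mk 𝔪 α) := by
    subst h
    exact isUnit_of_subsingleton _
  by_cases h0 : (α : K) = 0
  · rw [finitePart, if_pos hα, dif_pos h0]
  · have hmem := toPrincipalIdeal_mem_idealGroup hα h0
    have h1 := ξ.map_principal (Units.mk0 (α : K) h0) hmem (by rw [h]; exact congrOne_top _)
    rw [ξ.finitePart_of_ne_zero hα h0, value, dif_pos hmem, h1, Units.val_mk0]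
    exact div_self (infType_ne_zero m (by simpa using h0))

/-- Both `ξ` and `ξ_∞` are multiplicative. The case `𝔪 = 𝓞 K` is separate because there `0` is a
unit modulo `𝔪`; otherwise units modulo `𝔪` are nonzero. -/
theorem finitePart_mul (α β : 𝓞 K) : ξ.finitePart (α * β) = ξ.finitePart α * ξ.finitePart β := by
  by_cases h : IsUnit (Ideal.Quotient.mk 𝔪 α) ∧ IsUnit (Ideal.Quotient.mk 𝔪 β)
  · obtain ⟨hα, hβ⟩ := h
    have hαβ : IsUnit (Ideal.Quotient.mk 𝔪 (α * β)) := by rw [map_mul]; exact hα.mul hβ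
    by_cases ht : 𝔪 = ⊤
    · rw [ξ.finitePart_eq_one_of_top ht, ξ.finitePart_eq_one_of_top ht,
        ξ.finitePart_eq_one_of_top ht, one_mul]
    · have hα0 : (α : K) ≠ 0 := fun h0 => ht (eq_top_of_isUnit_zero (by
        have : α = 0 := by exact_mod_cast h0
        rwa [this] at hα))
      have hβ0 : (β : K) ≠ 0 := fun h0 => ht (eq_top_of_isUnit_zero (by
        have : β = 0 := by exact_mod_cast h0
        rwa [this] at hβ))
      have h0 : ((α * β : 𝓞 K) : K) ≠ 0 := by
        push_cast
        exact mul_ne_zero hα0 hβ0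
      rw [ξ.finitePart_of_ne_zero hα hα0, ξ.finitePart_of_ne_zero hβ hβ0,
        ξ.finitePart_of_ne_zero hαβ h0]
      have h1 : Units.mk0 ((α * β : 𝓞 K) : K) h0 = Units.mk0 (α : K) hα0 * Units.mk0 (β : K) hβ0 := by
        ext
        simp
      rw [h1, map_mul, ξ.value_mul (toPrincipalIdeal_mem_idealGroup hα hα0)
        (toPrincipalIdeal_mem_idealGroup hβ hβ0)]
      push_cast
      rw [map_mul, infType_mul, mul_div_mul_comm]
  · have hαβ : ¬ IsUnit (Ideal.Quotient.mk 𝔪 (α * β)) := by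
      rwa [map_mul, IsUnit.mul_iff]
    rw [ξ.finitePart_of_not_isUnit hαβ]
    rw [not_and_or] at h
    rcases h with h | h
    · rw [ξ.finitePart_of_not_isUnit h, zero_mul]
    · rw [ξ.finitePart_of_not_isUnit h, mul_zero]

/-- For units modulo `𝔪` the quotient satisfies `α/β ≡* 1`, and there `ξ` is prescribed by `ξ_∞`. -/
theorem finitePart_congr {α β : 𝓞 K} (h : α - β ∈ 𝔪) : ξ.finitePart α = ξ.finitePart β := by
  have hmk : Ideal.Quotient.mk 𝔪 α = Ideal.Quotient.mk 𝔪 β := Ideal.Quotient.eq.2 h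
  by_cases hβ : IsUnit (Ideal.Quotient.mk 𝔪 β)
  · have hα : IsUnit (Ideal.Quotient.mk 𝔪 α) := hmk ▸ hβ
    by_cases ht : 𝔪 = ⊤
    · rw [ξ.finitePart_eq_one_of_top ht, ξ.finitePart_eq_one_of_top ht]
    · have hα0 : (α : K) ≠ 0 := fun h0 => ht (eq_top_of_isUnit_zero (by
        have : α = 0 := by exact_mod_cast h0
        rwa [this] at hα))
      have hβ0 : (β : K) ≠ 0 := fun h0 => ht (eq_top_of_isUnit_zero (by
        have : β = 0 := by exact_mod_cast h0
        rwa [this] at hβ))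
      have hmα := toPrincipalIdeal_mem_idealGroup hα hα0
      have hmβ := toPrincipalIdeal_mem_idealGroup hβ hβ0
      set q : Kˣ := Units.mk0 (α : K) hα0 / Units.mk0 (β : K) hβ0 with hq
      have hqv : (q : K) = (α : K) / β := by rw [hq]; simp
      have hmq : toPrincipalIdeal (𝓞 K) K q ∈ idealGroup 𝔪 := by
        rw [hq, map_div]
        exact div_mem hmα hmβ
      have h1 := ξ.map_principal q hmq (by rw [hqv]; exact congrOne_div hβ hβ0 h)
      have h2 : Units.mk0 (α : K) hα0 = q * Units.mk0 (β : K) hβ0 := by rw [hq, div_mul_cancel]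
      have hσβ : σ (β : K) ≠ 0 := by simpa using hβ0
      have hσα : σ (α : K) ≠ 0 := by simpa using hα0
      have h3 : ξ.value (toPrincipalIdeal (𝓞 K) K q) = infType m (σ α) / infType m (σ β) := by
        rw [value, dif_pos hmq, h1, hqv, map_div₀, infType_div _ _ hσβ]
      have := infType_ne_zero m hσα
      rw [ξ.finitePart_of_ne_zero hα hα0, ξ.finitePart_of_ne_zero hβ hβ0, h2, map_mul,
        ξ.value_mul hmq hmβ, h3]
      field_simp
  · rw [ξ.finitePart_of_not_isUnit hβ, ξ.finitePart_of_not_isUnit (hmk ▸ hβ)]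

end HeckeChar

end Hecke

/-! ### The Kronecker symbol -/

section Kronecker

theorem kronecker_one (D : ℤ) : kronecker D 1 = 1 := by
  simp [kronecker]

theorem kronecker_neg {D d : ℤ} (hD : D < 0) (hd : 0 < d) : kronecker D (-d) = -kronecker D d := by
  rw [kronecker, kronecker, if_neg (by omega), if_neg hd.ne', if_pos ⟨by omega, hD⟩,
    if_neg (by rintro ⟨h, -⟩; omega), Int.natAbs_neg]
  ring

theorem kronecker_of_odd (D : ℤ) {n : ℕ} (hn : Odd n) : kronecker D n = jacobiSym D n := by
  have h0 : n ≠ 0 := by rintro rfl; simp at hn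
  have h1 : padicValNat 2 n = 0 := padicValNat.eq_zero_of_not_dvd hn.not_two_dvd_nat
  rw [kronecker, if_neg (by exact_mod_cast h0), if_neg (by rintro ⟨h, -⟩; omega), Int.natAbs_natCast,
    h1]
  simp

theorem kronecker_prime (D : ℤ) {p : ℕ} [Fact p.Prime] (hp : p ≠ 2) :
    kronecker D p = legendreSym p D := by
  rw [kronecker_of_odd D ((Fact.out : p.Prime).odd_of_ne_two hp), jacobiSym.legendreSym.to_jacobiSym]

/-- For `D ≡ 1 (mod 4)` the Kronecker symbol is a Jacobi symbol in the lower argument. -/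
theorem kronecker_eq_jacobiSym {D : ℤ} (hD : D < 0) (hD4 : D % 4 = 1) {n : ℕ} (hn : n ≠ 0) :
    kronecker D n = jacobiSym n D.natAbs := by
  have hodd : Odd D.natAbs := by
    rw [Int.natAbs_odd]
    exact Int.odd_iff.2 (by omega)
  have hab : (D.natAbs : ℤ) = -D := Int.ofNat_natAbs_of_nonpos hD.le
  have hab4 : D.natAbs % 4 = 3 := by omega
  have hDn : D = -1 * (D.natAbs : ℤ) := by rw [hab]; ring
  -- Here `D = -|D|` with `|D| ≡ 3` modulo `4`: the sign of quadratic reciprocity and the value of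
  -- the symbol at `-1` cancel.
  have hoddn : ∀ t : ℕ, Odd t → jacobiSym D t = jacobiSym t D.natAbs := by
    intro t ht
    conv_lhs => rw [hDn]
    rw [jacobiSym.mul_left, jacobiSym.at_neg_one ht, jacobiSym.quadratic_reciprocity' hodd ht, qrSign]
    rcases Nat.odd_mod_four_iff.1 (Nat.odd_iff.1 ht) with h | h
    · rw [ZMod.χ₄_nat_one_mod_four h, jacobiSym.one_left, one_mul, one_mul]
    · rw [ZMod.χ₄_nat_three_mod_four h, jacobiSym.at_neg_one hodd, ZMod.χ₄_nat_three_mod_four hab4]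
      ring
  obtain ⟨k, t, ht, rfl⟩ := Nat.exists_eq_two_pow_mul_odd hn
  have ht0 : t ≠ 0 := by rintro rfl; simp at ht
  have hk : padicValNat 2 (2 ^ k * t) = k := by
    rw [padicValNat.mul (by positivity) ht0, padicValNat.prime_pow,
      padicValNat.eq_zero_of_not_dvd ht.not_two_dvd_nat, add_zero]
  rw [kronecker, if_neg (by exact_mod_cast hn), if_neg (by rintro ⟨h, -⟩; omega),
    Int.natAbs_natCast, hk, Nat.mul_div_cancel_left _ (by positivity), one_mul, hoddn t ht]
  push_cast
  rw [jacobiSym.mul_left, jacobiSym.pow_left, jacobiSym.at_two hodd]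
  congr 2
  have h2 : ((D.natAbs : ℕ) : ZMod 8) = -(D : ZMod 8) := by
    have : ((D.natAbs : ℤ) : ZMod 8) = ((-D : ℤ) : ZMod 8) := by rw [hab]
    rwa [Int.cast_natCast, Int.cast_neg] at this
  rw [h2]
  -- `χ₈` is even, so `D` and `|D|` give the same factor at the prime `2`.
  have h3 : ∀ x : ZMod 8, ZMod.χ₈ x = ZMod.χ₈ (-x) := by decide
  exact h3 _

/-- The Kronecker symbol of a discriminant is periodic. -/
theorem kronecker_eq_legendreSym {D : ℤ} (hD : D < 0) (hD4 : D % 4 = 0 ∨ D % 4 = 1) {d : ℤ}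
    (hd : 0 < d) {p : ℕ} [Fact p.Prime] (hp : p ≠ 2) (hpd : D ∣ p - d) (hcop : IsCoprime d D) :
    kronecker D d = legendreSym p D := by
  obtain ⟨n, rfl⟩ : ∃ n : ℕ, d = n := ⟨d.toNat, by omega⟩
  have hn0 : n ≠ 0 := by omega
  have hab : (D.natAbs : ℤ) = -D := Int.ofNat_natAbs_of_nonpos hD.le
  have hpodd := (Fact.out : p.Prime).odd_of_ne_two hp
  have hmod : p ≡ n [MOD D.natAbs] := by
    rw [← Int.natCast_modEq_iff, hab]
    refine (Int.modEq_iff_dvd.2 ?_).symm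
    rwa [neg_dvd]
  rw [← kronecker_prime D hp]
  rcases hD4 with hD4 | hD4
  -- For `4 ∣ D` coprimality makes `d` odd. With `D = 4E` the square factor drops out, and the
  -- Jacobi symbol of `E` has period `4|E| = |D|` in its odd lower argument.
  · have hnodd : Odd n := by
      rw [← Nat.not_even_iff_odd]
      intro hev
      have h2n : (2 : ℤ) ∣ n := by exact_mod_cast hev.two_dvd
      have h2D : (2 : ℤ) ∣ D := by omega
      have := hcop.isUnit_of_dvd' h2n h2D
      exact absurd (Int.isUnit_iff.1 this) (by omega)
    rw [kronecker_of_odd D hnodd, kronecker_of_odd D hpodd]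
    obtain ⟨E, rfl⟩ : ∃ E, D = 4 * E := ⟨D / 4, by omega⟩
    have h4 : ∀ t : ℕ, Odd t → jacobiSym (4 * E) t = jacobiSym E t := by
      intro t ht
      have : (4 : ℤ) * E = 2 ^ 2 * E := by ring
      rw [this, jacobiSym.mul_left, jacobiSym.sq_one' (by
        rw [Int.gcd_comm]
        have := ht.coprime_two_right
        exact_mod_cast this), one_mul]
    rw [h4 n hnodd, h4 p hpodd, jacobiSym.mod_right E hnodd, jacobiSym.mod_right E hpodd]
    congr 1
    have : (4 * E).natAbs = 4 * E.natAbs := by rw [Int.natAbs_mul]; rfl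
    rw [← this]
    exact hmod.symm
  -- For `D ≡ 1` modulo `4` the symbol has become `(·/|D|)`, visibly of period `|D|`.
  · rw [kronecker_eq_jacobiSym hD hD4 hn0,
      kronecker_eq_jacobiSym hD hD4 (Fact.out : p.Prime).ne_zero, jacobiSym.mod_left,
      jacobiSym.mod_left p]
    congr 1
    exact_mod_cast (Int.natCast_modEq_iff.2 hmod).symm

end Kronecker

/-! ### Coordinates on based ideals -/

theorem finiteIndex_comap {G G' : Type*} [AddCommGroup G] [AddCommGroup G'] (H : AddSubgroup G')
    [H.FiniteIndex] (f : G →+ G') : (H.comap f).FiniteIndex :=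
  ⟨by
    rw [AddSubgroup.index_comap]
    have := AddSubgroup.isFiniteRelIndex_of_finiteIndex (H := H) (K := f.range)
    exact AddSubgroup.IsFiniteRelIndex.relIndex_ne_zero⟩

namespace BasedIdeal

variable {K : Type*} [Field K] [NumberField K] (σ : K →+* ℂ) (A : BasedIdeal K)

theorem ideal_ne_bot : (A.ideal : Ideal (𝓞 K)) ≠ ⊥ := nonZeroDivisors.coe_ne_zero A.ideal

theorem norm_pos : 0 < A.norm := by
  have h := Ideal.absNorm_ne_zero_of_nonZeroDivisors A.ideal
  rw [norm]
  exact_mod_cast Nat.pos_of_ne_zero h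

/-- The square root of the norm of the ideal. -/
def root : ℂ := (Real.sqrt A.norm : ℝ)

theorem root_ne_zero : A.root ≠ 0 := by
  rw [root]
  exact_mod_cast (Real.sqrt_pos.2 A.norm_pos).ne'

theorem root_sq : A.root ^ 2 = A.norm := by
  rw [root, ← Complex.ofReal_pow, Real.sq_sqrt A.norm_pos.le]

theorem conj_root : conj A.root = A.root := Complex.conj_ofReal _

/-- The linear form `z₁ w₁ + z₂ w₂`, normalised by `√N(𝔞₀)`. -/
def lin (z : Fin 2 → ℂ) : ℂ := (A.w σ 0 * z 0 + A.w σ 1 * z 1) / A.root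

/-- The conjugate linear form. -/
def colin (z : Fin 2 → ℂ) : ℂ := (conj (A.w σ 0) * z 0 + conj (A.w σ 1) * z 1) / A.root

/-- The normalised image of `α` in `ℂ`. -/
def pt (α : (A.ideal : Ideal (𝓞 K))) : ℂ := σ (α : 𝓞 K) / A.root

/-- Over `ℂ` the norm form is a product of two conjugate linear forms, which serve as the
coordinates `u`, `u'` of the lattice theta series. -/
theorem quad_eq (z : Fin 2 → ℂ) : A.quad σ z = A.lin σ z * A.colin σ z := by
  have h := A.root_ne_zero
  rw [quad, lin, colin, ← A.root_sq]
  simp only [Complex.star_def]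
  field_simp
  ring

theorem lin_add (z z' : Fin 2 → ℂ) : A.lin σ (z + z') = A.lin σ z + A.lin σ z' := by
  simp only [lin, Pi.add_apply]; ring

theorem colin_add (z z' : Fin 2 → ℂ) : A.colin σ (z + z') = A.colin σ z + A.colin σ z' := by
  simp only [colin, Pi.add_apply]; ring

theorem lin_smul (c : ℂ) (z : Fin 2 → ℂ) : A.lin σ (c • z) = c * A.lin σ z := by
  simp only [lin, Pi.smul_apply, smul_eq_mul]; ring

theorem colin_smul (c : ℂ) (z : Fin 2 → ℂ) : A.colin σ (c • z) = c * A.colin σ z := by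
  simp only [colin, Pi.smul_apply, smul_eq_mul]; ring

theorem colin_toC (a : Fin 2 → ℝ) : A.colin σ (toC a) = conj (A.lin σ (toC a)) := by
  simp [lin, colin, toC, conj_root]

theorem polar_quad (z z' : Fin 2 → ℂ) : polar (A.quad σ) z z' =
    A.lin σ z * A.colin σ z' + A.colin σ z * A.lin σ z' := by
  rw [polar, quad_eq, quad_eq, quad_eq, lin_add, colin_add]; ring

theorem apply_eq_sum_repr (α : (A.ideal : Ideal (𝓞 K))) :
    σ (α : 𝓞 K) = (A.basis.repr α 0 : ℤ) * A.w σ 0 + (A.basis.repr α 1 : ℤ) * A.w σ 1 := by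
  have h := A.basis.sum_repr α
  rw [Fin.sum_univ_two] at h
  conv_lhs => rw [← h]
  simp [w]

theorem lin_coord (α : (A.ideal : Ideal (𝓞 K))) : A.lin σ (A.coord α) = A.pt σ α := by
  rw [lin, pt, apply_eq_sum_repr]; simp only [coord]; ring

theorem colin_coord (α : (A.ideal : Ideal (𝓞 K))) : A.colin σ (A.coord α) = conj (A.pt σ α) := by
  rw [colin, pt, apply_eq_sum_repr]
  simp [coord, conj_root]; ring

theorem shift_eq (α : (A.ideal : Ideal (𝓞 K))) (a : Fin 2 → ℝ) :
    A.shift σ α a = A.root * (A.pt σ α + A.lin σ (toC a)) := by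
  have h := A.root_ne_zero
  rw [shift, Fin.sum_univ_two, pt, apply_eq_sum_repr, lin]
  simp only [toC]
  field_simp
  ring

theorem pt_add (α β : (A.ideal : Ideal (𝓞 K))) : A.pt σ (α + β) = A.pt σ α + A.pt σ β := by
  simp [pt, add_div]

theorem pt_zsmul (n : ℤ) (α : (A.ideal : Ideal (𝓞 K))) : A.pt σ (n • α) = n * A.pt σ α := by
  simp [pt, mul_div_assoc]

/-- The element of the ideal with given integral coordinates. -/
def elt (l : Fin 2 → ℤ) : (A.ideal : Ideal (𝓞 K)) := ∑ i, l i • A.basis i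

theorem coord_elt (l : Fin 2 → ℤ) : A.coord (A.elt l) = intToC l := by
  funext i
  rw [coord, elt, intToC, Module.Basis.repr_sum_self]

theorem lin_intToC (l : Fin 2 → ℤ) : A.lin σ (intToC l) = A.pt σ (A.elt l) := by
  rw [← A.coord_elt, lin_coord]

theorem colin_intToC (l : Fin 2 → ℤ) : A.colin σ (intToC l) = conj (A.pt σ (A.elt l)) := by
  rw [← A.coord_elt, colin_coord]

-- In the normalised coordinates `α + a` is `√N(𝔞₀)` times `pt α + lin a`, and the two exponentials
-- merge into one `gterm`. This is the bridge from ideals to lattices in `ℂ`.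
variable {σ A} in
theorem _root_.CMJacobi.cmTerm_eq (k : ℕ) (f : 𝓞 K → ℂ) (z : Fin 2 → ℂ) (τ : ℍ)
    (α : (A.ideal : Ideal (𝓞 K))) : cmTerm σ A k f z τ α =
      A.root ^ (k - 1) * (f α * ((A.pt σ α + A.lin σ (toC (aPart z τ))) ^ (k - 1) *
        gterm (A.pt σ α) (A.lin σ z) (A.colin σ z) τ)) := by
  rw [cmTerm, shift_eq, polar_quad, quad_eq, lin_coord, colin_coord, mul_pow, gterm, e_add, e_add, e_add]
  ring

theorem pt_mul_conj (hK : Module.finrank ℚ K = 2) (hD : discr K < 0)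
    (α : (A.ideal : Ideal (𝓞 K))) : ∃ j : ℤ, A.pt σ α * conj (A.pt σ α) = j := by
  have h := A.root_ne_zero
  obtain ⟨j, hj⟩ := mul_conj_eq_of_mem hK hD σ α.2
  refine ⟨j, ?_⟩
  have hn : (Ideal.absNorm (A.ideal : Ideal (𝓞 K)) : ℂ) = A.root ^ 2 := by
    rw [root_sq, norm]; simp
  rw [pt, map_div₀, conj_root, div_mul_div_comm, hj, hn]
  field_simp

theorem pt_pairing (hK : Module.finrank ℚ K = 2) (hD : discr K < 0)
    (α β : (A.ideal : Ideal (𝓞 K))) :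
    ∃ j : ℤ, A.pt σ α * conj (A.pt σ β) + conj (A.pt σ α) * A.pt σ β = j := by
  have h := A.root_ne_zero
  obtain ⟨j, hj⟩ := trace_eq_of_mem hK hD σ α.2 β.2
  refine ⟨j, ?_⟩
  have hn : (Ideal.absNorm (A.ideal : Ideal (𝓞 K)) : ℂ) = A.root ^ 2 := by
    rw [root_sq, norm]; simp
  rw [pt, pt, map_div₀, map_div₀, conj_root, div_mul_div_comm, div_mul_div_comm, ← add_div, hj, hn]
  field_simp

/-- The sublattice `𝔪𝔞₀` of `𝔞₀`. -/
def periods (𝔪 : Ideal (𝓞 K)) : AddSubgroup (A.ideal : Ideal (𝓞 K)) :=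
  (𝔪 * (A.ideal : Ideal (𝓞 K))).toAddSubgroup.comap
    (Submodule.subtype (A.ideal : Ideal (𝓞 K))).toAddMonoidHom

theorem mem_periods {𝔪 : Ideal (𝓞 K)} {α : (A.ideal : Ideal (𝓞 K))} :
    α ∈ A.periods 𝔪 ↔ (α : 𝓞 K) ∈ 𝔪 * (A.ideal : Ideal (𝓞 K)) := Iff.rfl

theorem absNorm_zsmul_mem_periods (𝔪 : Ideal (𝓞 K)) {n : ℤ} (hn : (Ideal.absNorm 𝔪 : ℤ) ∣ n)
    (α : (A.ideal : Ideal (𝓞 K))) : n • α ∈ A.periods 𝔪 := by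
  obtain ⟨t, rfl⟩ := hn
  rw [mem_periods]
  have : (((Ideal.absNorm 𝔪 * t : ℤ) • α : (A.ideal : Ideal (𝓞 K))) : 𝓞 K) =
      ((Ideal.absNorm 𝔪 : 𝓞 K) * t) * α := by simp
  rw [this]
  exact Ideal.mul_mem_mul (Ideal.mul_mem_right _ _ (Ideal.absNorm_mem 𝔪)) α.2

theorem finite_quotient_periods {𝔪 : Ideal (𝓞 K)} (h𝔪 : 𝔪 ≠ ⊥) :
    Finite ((A.ideal : Ideal (𝓞 K)) ⧸ A.periods 𝔪) := by
  have hJ : 𝔪 * (A.ideal : Ideal (𝓞 K)) ≠ ⊥ := mul_ne_zero h𝔪 A.ideal_ne_bot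
  have : Finite (𝓞 K ⧸ (𝔪 * (A.ideal : Ideal (𝓞 K)))) := Ideal.finiteQuotientOfFreeOfNeBot _ hJ
  have : (𝔪 * (A.ideal : Ideal (𝓞 K))).toAddSubgroup.FiniteIndex :=
    @AddSubgroup.finiteIndex_of_finite_quotient _ _ _ this
  have : (A.periods 𝔪).FiniteIndex := by
    exact finiteIndex_comap _ _
  exact AddSubgroup.finite_quotient_of_finiteIndex

/-- A basis of `𝔪𝔞₀` as a lattice in `ℂ`. -/
theorem exists_lattice (hK : Module.finrank ℚ K = 2) (hD : discr K < 0) {𝔪 : Ideal (𝓞 K)}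
    (h𝔪 : 𝔪 ≠ ⊥) : ∃ (L : NormLattice) (φ : ℤ × ℤ →+ (A.ideal : Ideal (𝓞 K))),
      Function.Injective φ ∧ φ.range = A.periods 𝔪 ∧ (∀ n, L.vec n = A.pt σ (φ n)) ∧
      L.disc = -discr K * (Ideal.absNorm 𝔪) ^ 2 ∧
      ∀ m, L.disc ∣ ((discr K).natAbs * Ideal.absNorm 𝔪 : ℕ) * L.dualForm m := by
  obtain ⟨J, hJ⟩ : ∃ J, J = 𝔪 * (A.ideal : Ideal (𝓞 K)) := ⟨_, rfl⟩
  have hJ0 : J ≠ ⊥ := hJ ▸ mul_ne_zero h𝔪 A.ideal_ne_bot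
  have hJA : J ≤ (A.ideal : Ideal (𝓞 K)) := hJ ▸ Ideal.mul_le_right
  obtain ⟨b⟩ : Nonempty (Module.Basis (Fin 2) ℤ J) := ⟨Ideal.selfBasis (ringBasis hK) _ hJ0⟩
  have hM : 0 < Ideal.absNorm 𝔪 := Nat.pos_of_ne_zero
    (Ideal.absNorm_ne_zero_iff_mem_nonZeroDivisors.2 (mem_nonZeroDivisors_iff_ne_zero.2 h𝔪))
  obtain ⟨L, h1, h2, h3, h4⟩ := exists_normLattice hK hD σ hJ0 b A.norm_pos hM (by
    rw [hJ, map_mul, norm]; push_cast; ring)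
  let φ : ℤ × ℤ →+ (A.ideal : Ideal (𝓞 K)) :=
    { toFun := fun n => ⟨((n.1 • b 0 + n.2 • b 1 : J) : 𝓞 K), hJA (Subtype.coe_prop _)⟩
      map_zero' := by ext; simp
      map_add' := fun n n' => Subtype.ext (by
        have : (n + n').1 • b 0 + (n + n').2 • b 1 =
            (n.1 • b 0 + n.2 • b 1) + (n'.1 • b 0 + n'.2 • b 1) := by
          rw [Prod.fst_add, Prod.snd_add]; module
        simp only [this]
        rfl) }
  have hφ : ∀ n, ((φ n : (A.ideal : Ideal (𝓞 K))) : 𝓞 K) =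
      ((n.1 • b 0 + n.2 • b 1 : J) : 𝓞 K) := fun _ => rfl
  refine ⟨L, φ, ?_, ?_, fun n => ?_, h3, h4⟩
  · intro n n' h
    have h5 : n.1 • b 0 + n.2 • b 1 = n'.1 • b 0 + n'.2 • b 1 := Subtype.ext (by
      rw [← hφ, ← hφ, h])
    have h6 : ∀ m : ℤ × ℤ, b.repr (m.1 • b 0 + m.2 • b 1) = Finsupp.single 0 m.1 +
        Finsupp.single 1 m.2 := fun m => by simp
    have h7 := congrArg b.repr h5
    rw [h6, h6] at h7
    ext
    · simpa using DFunLike.congr_fun h7 0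
    · simpa using DFunLike.congr_fun h7 1
  · ext α
    rw [AddMonoidHom.mem_range, mem_periods, ← hJ]
    constructor
    · rintro ⟨n, rfl⟩
      rw [hφ]
      exact Subtype.coe_prop _
    · intro hα
      refine ⟨(b.repr ⟨α, hα⟩ 0, b.repr ⟨α, hα⟩ 1), Subtype.ext ?_⟩
      rw [hφ]
      have := b.sum_repr ⟨α, hα⟩
      rw [Fin.sum_univ_two] at this
      rw [this]
  · rw [NormLattice.vec, h1, h2, pt, hφ, root]
    simp
    ring

end BasedIdeal

section Cosets

/-! ### Characteristics -/

theorem eq_smul_aPart_add_bPart (z : Fin 2 → ℂ) (τ : ℍ) :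
    z = (τ : ℂ) • toC (aPart z τ) + toC (bPart z τ) := by
  have h := τ.im_pos.ne'
  funext i
  apply Complex.ext
  · simp [toC, bPart]
    ring
  · simp [toC, aPart]
    field_simp

theorem aPart_smul_add (a b : Fin 2 → ℝ) (τ : ℍ) :
    aPart ((τ : ℂ) • toC a + toC b) τ = a := by
  have h := τ.im_pos.ne'
  funext i
  simp only [aPart, toC, Pi.add_apply, Pi.smul_apply, smul_eq_mul, Complex.add_im, Complex.mul_im,
    Complex.ofReal_im, Complex.ofReal_re, mul_zero, zero_add, add_zero]
  rw [UpperHalfPlane.coe_im]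
  field_simp

/-- The new `a` is `d a - c b`, which equals `(cτ + d) a - c (aτ + b)`. Under `lin` it becomes
exactly the shift that occurs in `wtheta_smul`. -/
theorem toC_aPart_smul (γ : SL(2, ℤ)) (z : Fin 2 → ℂ) (τ : ℍ) :
    toC (aPart ((autFactor γ τ)⁻¹ • z) (γ • τ)) =
      autFactor γ τ • toC (aPart z τ) - ((γ 1 0 : ℤ) : ℂ) • z := by
  obtain ⟨a, ha⟩ : ∃ a, a = aPart z τ := ⟨_, rfl⟩
  obtain ⟨b, hb⟩ : ∃ b, b = bPart z τ := ⟨_, rfl⟩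
  have hz := eq_smul_aPart_add_bPart z τ
  rw [← ha, ← hb] at hz
  have hj := autFactor_ne_zero γ τ
  have hdet : ((γ 0 0 : ℤ) : ℂ) * (γ 1 1 : ℤ) - (γ 0 1 : ℤ) * (γ 1 0 : ℤ) = 1 := by
    exact_mod_cast det_eq γ
  have key : (autFactor γ τ)⁻¹ • z = ((γ • τ : ℍ) : ℂ) •
      toC (fun i => (γ 1 1 : ℤ) * a i - (γ 1 0 : ℤ) * b i) +
      toC (fun i => (γ 0 0 : ℤ) * b i - (γ 0 1 : ℤ) * a i) := by
    rw [hz, coe_smul_eq]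
    funext i
    simp only [toC, Pi.smul_apply, Pi.add_apply, smul_eq_mul]
    field_simp
    rw [autFactor]
    push_cast
    linear_combination (-(τ : ℂ) * a i - b i) * hdet
  rw [key, aPart_smul_add, ← ha]
  funext i
  rw [hz]
  simp only [toC, Pi.smul_apply, Pi.add_apply, Pi.sub_apply, smul_eq_mul, autFactor]
  push_cast
  ring

namespace NormLattice

theorem wtheta_add_vec (L : NormLattice) (m : ℕ) (h : ℂ) (n : ℤ × ℤ) (s u u' τ : ℂ) :
    L.wtheta m (h + L.vec n) s u u' τ = L.wtheta m h s u u' τ := by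
  rw [wtheta, wtheta, ← (Equiv.addLeft n).tsum_eq
    (fun n => (h + L.vec n + s) ^ m * gterm (h + L.vec n) u u' τ)]
  refine tsum_congr fun m => ?_
  rw [Equiv.coe_addLeft, vec_add, ← add_assoc]

end NormLattice

variable {K : Type*} [Field K] [NumberField K] {σ : K →+* ℂ} {A : BasedIdeal K}

theorem exists_norm_le_of_periodic {𝔪 : Ideal (𝓞 K)} (h𝔪 : 𝔪 ≠ ⊥) {f : 𝓞 K → ℂ}
    (hf : ∀ α β, α - β ∈ 𝔪 → f α = f β) : ∃ C, ∀ α, ‖f α‖ ≤ C := by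
  have : Finite (𝓞 K ⧸ 𝔪) := Ideal.finiteQuotientOfFreeOfNeBot _ h𝔪
  obtain ⟨C, hC⟩ := (Set.finite_range fun q : 𝓞 K ⧸ 𝔪 => ‖f (Quotient.out q)‖).bddAbove
  refine ⟨C, fun α => ?_⟩
  have h : f α = f (Quotient.out (Ideal.Quotient.mk 𝔪 α)) :=
    hf _ _ (Ideal.Quotient.eq.1 (Ideal.Quotient.mk_out _).symm)
  rw [h]
  exact hC ⟨_, rfl⟩

theorem BasedIdeal.exists_lattice_equiv (σ : K →+* ℂ) (A : BasedIdeal K)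
    (hK : Module.finrank ℚ K = 2) (hD : discr K < 0) :
    ∃ (L : NormLattice) (E : ℤ × ℤ ≃ (A.ideal : Ideal (𝓞 K))), ∀ n, L.vec n = A.pt σ (E n) := by
  obtain ⟨L, φ, hφ, hφr, hL, -⟩ := A.exists_lattice (σ := σ) hK hD (𝔪 := ⊤) top_ne_bot
  refine ⟨L, Equiv.ofBijective φ ⟨hφ, ?_⟩, hL⟩
  rw [← AddMonoidHom.range_eq_top, hφr, eq_top_iff]
  intro α _
  rw [BasedIdeal.mem_periods, Ideal.top_mul]
  exact α.2

theorem summable_cmTerm (hK : Module.finrank ℚ K = 2) (hD : discr K < 0) (k : ℕ) {f : 𝓞 K → ℂ}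
    {C : ℝ} (hC : ∀ α, ‖f α‖ ≤ C) (z : Fin 2 → ℂ) (τ : ℍ) : Summable (cmTerm σ A k f z τ) := by
  obtain ⟨L, E, hL⟩ := A.exists_lattice_equiv σ hK hD
  rw [← E.summable_iff]
  refine Summable.of_norm_bounded (((L.summable_wtheta (k - 1) 0 (A.lin σ (toC (aPart z τ)))
    (A.lin σ z) (A.colin σ z) τ.im_pos).norm).mul_left (‖A.root‖ ^ (k - 1) * C)) fun n => ?_
  change ‖cmTerm σ A k f z τ (E n)‖ ≤ _
  rw [cmTerm_eq, ← hL, zero_add, norm_mul, norm_pow, norm_mul, mul_assoc]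
  gcongr
  exact hC _

/-- Along a coset of `𝔪𝔞₀` the factor `f` is constant, and what remains is the weighted theta series
of that coset. -/
theorem cmSeries_eq_sum (hK : Module.finrank ℚ K = 2) (hD : discr K < 0) {𝔪 : Ideal (𝓞 K)}
    (h𝔪 : 𝔪 ≠ ⊥) (k : ℕ) {f : 𝓞 K → ℂ} (hf : ∀ α β, α - β ∈ 𝔪 → f α = f β)
    {L : NormLattice} {φ : ℤ × ℤ →+ (A.ideal : Ideal (𝓞 K))} (hφ : Function.Injective φ)
    (hφr : φ.range = A.periods 𝔪) (hL : ∀ n, L.vec n = A.pt σ (φ n))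
    [Fintype ((A.ideal : Ideal (𝓞 K)) ⧸ φ.range)] (z : Fin 2 → ℂ) (τ : ℍ) :
    cmSeries σ A k f z τ = A.root ^ (k - 1) * ∑ q : (A.ideal : Ideal (𝓞 K)) ⧸ φ.range,
      f (q.out : (A.ideal : Ideal (𝓞 K))) * L.wtheta (k - 1) (A.pt σ q.out)
        (A.lin σ (toC (aPart z τ))) (A.lin σ z) (A.colin σ z) τ := by
  obtain ⟨C, hC⟩ := exists_norm_le_of_periodic h𝔪 hf
  rw [cmSeries, tsum_eq_sum_quotient φ hφ (summable_cmTerm hK hD k hC z τ), Finset.mul_sum]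
  refine Finset.sum_congr rfl fun q _ => ?_
  rw [NormLattice.wtheta, ← tsum_mul_left, ← tsum_mul_left]
  refine tsum_congr fun n => ?_
  have h1 : f ((q.out + φ n : (A.ideal : Ideal (𝓞 K))) : 𝓞 K) =
      f (q.out : (A.ideal : Ideal (𝓞 K))) := by
    refine hf _ _ ?_
    rw [Submodule.coe_add, add_sub_cancel_left]
    have : φ n ∈ A.periods 𝔪 := hφr ▸ ⟨n, rfl⟩
    exact Ideal.mul_le_right (I := (A.ideal : Ideal (𝓞 K))) (by
      rw [mul_comm]; exact this)
  rw [cmTerm_eq, h1, A.pt_add, ← hL]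

/-- The weighted theta series of a coset under the slash operator of weight `k`. -/
theorem wtheta_slash {k : ℕ} (hk : 1 ≤ k) {L : NormLattice} {γ : SL(2, ℤ)} {ι : Type*} [Fintype ι]
    {h : ℂ} {c g : ι → ℂ} (H : slashOne γ (L.thetaFun h) = ∑ i, c i • L.thetaFun (g i))
    (z : Fin 2 → ℂ) (τ : ℍ) :
    (autFactor γ τ ^ k)⁻¹ * e (-(((γ 1 0 : ℤ) : ℂ) * A.quad σ z / autFactor γ τ)) *
      L.wtheta (k - 1) h (A.lin σ (toC (aPart ((autFactor γ τ)⁻¹ • z) (γ • τ))))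
        (A.lin σ ((autFactor γ τ)⁻¹ • z)) (A.colin σ ((autFactor γ τ)⁻¹ • z)) (γ • τ : ℍ) =
      ∑ i, c i * L.wtheta (k - 1) (g i) (A.lin σ (toC (aPart z τ))) (A.lin σ z)
        (A.colin σ z) τ := by
  have hj := autFactor_ne_zero γ τ
  have h1 : A.lin σ (toC (aPart ((autFactor γ τ)⁻¹ • z) (γ • τ))) =
      autFactor γ τ * A.lin σ (toC (aPart z τ)) - ((γ 1 0 : ℤ) : ℂ) * A.lin σ z := by
    rw [toC_aPart_smul]
    simp only [BasedIdeal.lin, Pi.sub_apply, Pi.smul_apply, smul_eq_mul]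
    ring
  have h2 := NormLattice.wtheta_smul H (k - 1) (A.lin σ (toC (aPart z τ))) (A.lin σ z)
    (A.colin σ z) τ
  rw [h1, A.lin_smul, A.colin_smul, inv_mul_eq_div _ (A.lin σ z), inv_mul_eq_div _ (A.colin σ z),
    A.quad_eq]
  -- One automorphy factor belongs to the theta series, the other `k - 1` to the polynomial weight.
  obtain ⟨m, rfl⟩ : ∃ m, k = m + 1 := ⟨k - 1, by omega⟩
  rw [Nat.add_sub_cancel] at h2 ⊢
  rw [pow_succ, mul_inv, mul_assoc _ _ (e _), mul_assoc, h2, inv_mul_cancel_left₀ (pow_ne_zero _ hj)]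

/-- `D = R² - 4PS` for an integral norm form, and squares are `0` or `1` modulo `4`. -/
theorem discr_emod_four (hK : Module.finrank ℚ K = 2) (hD : discr K < 0) (σ : K →+* ℂ) :
    discr K % 4 = 0 ∨ discr K % 4 = 1 := by
  obtain ⟨P, R, S, -, -, -, h, -⟩ := exists_form hK hD σ (I := ⊤) top_ne_bot
    (Ideal.selfBasis (ringBasis hK) _ top_ne_bot)
  rw [← h]
  have h1 : (R ^ 2 - 4 * P * S) % 4 = R ^ 2 % 4 := by
    rw [mul_assoc, Int.sub_mul_emod_self_left]
  rw [h1]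
  rcases Int.even_or_odd' R with ⟨t, rfl | rfl⟩
  · left; ring_nf; omega
  · right; ring_nf; omega

theorem one_lt_natAbs_discr (hK : Module.finrank ℚ K = 2) : 1 < (discr K).natAbs := by
  have := abs_discr_gt_two (K := K) (by omega)
  rw [← Int.natCast_natAbs] at this
  omega

/-- The transformation law of the theta series of a coset of `𝔪𝔞₀` in `𝔞₀`. -/
theorem slashOne_thetaFun_pt (hK : Module.finrank ℚ K = 2) (hD : discr K < 0) {𝔪 : Ideal (𝓞 K)}
    (h𝔪 : 𝔪 ≠ ⊥) {L : NormLattice} {φ : ℤ × ℤ →+ (A.ideal : Ideal (𝓞 K))}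
    (hφr : φ.range = A.periods 𝔪) (hL : ∀ n, L.vec n = A.pt σ (φ n))
    (hdisc : L.disc = -discr K * (Ideal.absNorm 𝔪) ^ 2)
    (hdual : ∀ m, L.disc ∣ ((discr K).natAbs * Ideal.absNorm 𝔪 : ℕ) * L.dualForm m)
    (α : (A.ideal : Ideal (𝓞 K))) {γ : SL(2, ℤ)}
    (hγ : (((discr K).natAbs * Ideal.absNorm 𝔪 : ℕ) : ℤ) ∣ γ 1 0) :
    slashOne γ (L.thetaFun (A.pt σ α)) =
      (kronecker (discr K) (γ 1 1) : ℂ) • L.thetaFun (A.pt σ (γ 0 0 • α)) := by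
  have hM : 0 < Ideal.absNorm 𝔪 := Nat.pos_of_ne_zero
    (Ideal.absNorm_ne_zero_iff_mem_nonZeroDivisors.2 (mem_nonZeroDivisors_iff_ne_zero.2 h𝔪))
  rw [A.pt_zsmul]
  refine NormLattice.slashOne_gamma0_thetaFun ?_ hdual (fun p hp hpd => ?_) (kronecker_one _)
    (fun d hd => kronecker_neg hD hd) (fun d hd p _ hp hpd hcop => ?_) (A.pt_mul_conj σ hK hD α)
    (fun n => ?_) ?_ hγ
  · exact lt_of_lt_of_le (one_lt_natAbs_discr hK) (Nat.le_mul_of_pos_right _ hM)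
  · rw [hdisc, neg_mul, dvd_neg] at hpd
    rcases (Nat.prime_iff_prime_int.1 hp).dvd_or_dvd hpd with h | h
    · exact (Int.natCast_dvd.1 h).mul_right _
    · exact (Int.natCast_dvd_natCast.1 ((Nat.prime_iff_prime_int.1 hp).dvd_of_dvd_pow h)).mul_left _
  -- As `-disc L = D N(𝔪)²`, its Legendre symbol is that of `D` once `p ∤ N(𝔪)`, which holds because
  -- `p ≡ d` modulo the level and `d` is coprime to the level.
  · have hD' : discr K ∣ (((discr K).natAbs * Ideal.absNorm 𝔪 : ℕ) : ℤ) := by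
      push_cast
      exact Dvd.dvd.mul_right ((dvd_abs _ _).2 dvd_rfl) _
    have hM' : (Ideal.absNorm 𝔪 : ℤ) ∣ (((discr K).natAbs * Ideal.absNorm 𝔪 : ℕ) : ℤ) := by
      push_cast
      exact dvd_mul_left _ _
    rw [hdisc, neg_mul, neg_neg, legendreSym.mul, legendreSym.sq_one', mul_one]
    · exact kronecker_eq_legendreSym hD (discr_emod_four hK hD σ) hd hp (hD'.trans hpd)
        (hcop.of_isCoprime_of_dvd_right hD')
    · intro h0
      have h1 : (p : ℤ) ∣ (Ideal.absNorm 𝔪 : ℤ) := (ZMod.intCast_zmod_eq_zero_iff_dvd _ _).1 h0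
      have h2 : (p : ℤ) ∣ d := by
        have := (h1.trans hM').trans hpd
        exact (dvd_sub_right dvd_rfl).1 this
      have h3 := hcop.isUnit_of_dvd' h2 (h1.trans hM')
      exact (Nat.prime_iff_prime_int.1 (Fact.out : p.Prime)).not_isUnit h3
  · rw [hL]
    exact A.pt_pairing σ hK hD α (φ n)
  · have : (((discr K).natAbs * Ideal.absNorm 𝔪 : ℕ) : ℤ) • α ∈ φ.range := by
      rw [hφr]
      refine A.absNorm_zsmul_mem_periods 𝔪 ?_ α
      push_cast
      exact dvd_mul_left _ _
    obtain ⟨n, hn⟩ := this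
    refine ⟨n, ?_⟩
    rw [hL, hn, A.pt_zsmul, Int.cast_natCast]

end Cosets

section Transformation

variable {K : Type*} [Field K] [NumberField K] {σ : K →+* ℂ} {A : BasedIdeal K}

/-! ### The modular transformation law -/

theorem slash_cmSeries (hK : Module.finrank ℚ K = 2) (hD : discr K < 0) {𝔪 : Ideal (𝓞 K)}
    (h𝔪 : 𝔪 ≠ ⊥) (k : ℕ) {f : 𝓞 K → ℂ} (hf : ∀ α β, α - β ∈ 𝔪 → f α = f β)
    {L : NormLattice} {φ : ℤ × ℤ →+ (A.ideal : Ideal (𝓞 K))} (hφ : Function.Injective φ)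
    (hφr : φ.range = A.periods 𝔪) (hL : ∀ n, L.vec n = A.pt σ (φ n))
    [Fintype ((A.ideal : Ideal (𝓞 K)) ⧸ φ.range)] (γ : SL(2, ℤ)) (z : Fin 2 → ℂ) (τ : ℍ) :
    slash k (A.quad σ) γ (cmSeries σ A k f) z τ =
      A.root ^ (k - 1) * ∑ q : (A.ideal : Ideal (𝓞 K)) ⧸ φ.range,
        f (q.out : (A.ideal : Ideal (𝓞 K))) * ((autFactor γ τ ^ k)⁻¹ *
          e (-(((γ 1 0 : ℤ) : ℂ) * A.quad σ z / autFactor γ τ)) *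
          L.wtheta (k - 1) (A.pt σ q.out)
            (A.lin σ (toC (aPart ((autFactor γ τ)⁻¹ • z) (γ • τ))))
            (A.lin σ ((autFactor γ τ)⁻¹ • z)) (A.colin σ ((autFactor γ τ)⁻¹ • z))
            (γ • τ : ℍ)) := by
  rw [slash, cmSeries_eq_sum hK hD h𝔪 k hf hφ hφr hL, mul_left_comm, Finset.mul_sum]
  congr 1
  refine Finset.sum_congr rfl fun q _ => ?_
  ring

theorem BasedIdeal.mem_of_mem_periods {𝔪 : Ideal (𝓞 K)} {α : (A.ideal : Ideal (𝓞 K))}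
    (h : α ∈ A.periods 𝔪) : (α : 𝓞 K) ∈ 𝔪 :=
  Ideal.mul_le_left h

/-- The coset `q` goes to `aq` with the factor `χ_D(d)`. Since `ad ≡ 1` modulo `c` and `c`
annihilates `𝔞₀/𝔪𝔞₀`, the map `q ↦ aq` is a permutation with inverse `q ↦ dq`, and `ξ_𝔪(q) = ξ_𝔪(d)
ξ_𝔪(aq)` supplies the remaining factor of the character. -/
theorem slash_phi (hK : Module.finrank ℚ K = 2) (hD : discr K < 0) {𝔪 : Ideal (𝓞 K)}
    (h𝔪 : 𝔪 ≠ ⊥) {k : ℕ} (hk : 1 ≤ k) (ξ : HeckeChar σ 𝔪 (k - 1)) {γ : SL(2, ℤ)}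
    (hγ : (((discr K).natAbs * Ideal.absNorm 𝔪 : ℕ) : ℤ) ∣ γ 1 0) (z : Fin 2 → ℂ) (τ : ℍ) :
    slash k (A.quad σ) γ (phi ξ A) z τ = ξ.nebentypus (γ 1 1) * phi ξ A z τ := by
  obtain ⟨L, φ, hφ, hφr, hL, hdisc, hdual⟩ := A.exists_lattice (σ := σ) hK hD h𝔪
  have hfin : Finite ((A.ideal : Ideal (𝓞 K)) ⧸ φ.range) := hφr ▸ A.finite_quotient_periods h𝔪
  have := Fintype.ofFinite ((A.ideal : Ideal (𝓞 K)) ⧸ φ.range)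
  have hf : ∀ α β, α - β ∈ 𝔪 → ξ.finitePart α = ξ.finitePart β := fun α β h =>
    ξ.finitePart_congr h
  have h1 : ∀ {α : (A.ideal : Ideal (𝓞 K))} {n : ℤ}, γ 1 0 ∣ n → n • α ∈ φ.range :=
    fun {α n} hn => by
      rw [hφr]
      refine A.absNorm_zsmul_mem_periods 𝔪 ((Dvd.dvd.trans ?_ hγ).trans hn) α
      push_cast
      exact dvd_mul_left _ _
  have hdet : γ 1 1 * γ 0 0 - 1 = γ 0 1 * γ 1 0 := by linarith [det_eq γ]
  have hmk : ∀ q : (A.ideal : Ideal (𝓞 K)) ⧸ φ.range, ∃ n,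
      (γ 0 0 • q).out = γ 0 0 • q.out + φ n := fun q => by
    have : ((γ 0 0 • q.out : (A.ideal : Ideal (𝓞 K))) : (A.ideal : Ideal (𝓞 K)) ⧸ φ.range) =
        ((γ 0 0 • q).out : (A.ideal : Ideal (𝓞 K))) := by
      rw [QuotientAddGroup.out_eq', QuotientAddGroup.mk_zsmul, QuotientAddGroup.out_eq']
    obtain ⟨n, hn⟩ := QuotientAddGroup.eq.1 this
    exact ⟨n, by rw [hn]; abel⟩
  have hinj : Function.LeftInverse (fun q : (A.ideal : Ideal (𝓞 K)) ⧸ φ.range => γ 1 1 • q)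
      (fun q => γ 0 0 • q) := fun q => by
    induction q using QuotientAddGroup.induction_on with
    | H α =>
      change ((γ 1 1 • γ 0 0 • α : (A.ideal : Ideal (𝓞 K))) : (A.ideal : Ideal (𝓞 K)) ⧸ φ.range) = α
      rw [eq_comm, QuotientAddGroup.eq]
      have h2 : -α + γ 1 1 • γ 0 0 • α = (γ 1 1 * γ 0 0 - 1) • α := by module
      rw [h2, hdet]
      exact h1 (dvd_mul_left _ _)
  have hbij : Function.Bijective fun q : (A.ideal : Ideal (𝓞 K)) ⧸ φ.range => γ 0 0 • q :=
    Finite.injective_iff_bijective.1 hinj.injective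
  have hphi : phi ξ A = cmSeries σ A k ξ.finitePart := rfl
  rw [hphi, slash_cmSeries hK hD h𝔪 k hf hφ hφr hL, cmSeries_eq_sum hK hD h𝔪 k hf hφ hφr hL,
    mul_left_comm, ← hbij.sum_comp (g := fun q => ξ.finitePart
      ((q.out : (A.ideal : Ideal (𝓞 K))) : 𝓞 K) * L.wtheta (k - 1) (A.pt σ q.out)
        (A.lin σ (toC (aPart z τ))) (A.lin σ z) (A.colin σ z) τ)]
  congr 1
  rw [Finset.mul_sum]
  refine Finset.sum_congr rfl fun q _ => ?_
  have H := slashOne_thetaFun_pt hK hD h𝔪 hφr hL hdisc hdual q.out hγ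
  rw [wtheta_slash (ι := Unit) (c := fun _ => (kronecker (discr K) (γ 1 1) : ℂ))
    (g := fun _ => A.pt σ (γ 0 0 • q.out)) hk (by rw [H]; simp), Fintype.sum_unique]
  obtain ⟨n, hn⟩ := hmk q
  rw [hn, A.pt_add, ← hL, NormLattice.wtheta_add_vec, HeckeChar.nebentypus]
  have h2 : ξ.finitePart (γ 1 1 : 𝓞 K) *
      ξ.finitePart ((γ 0 0 • q.out + φ n : (A.ideal : Ideal (𝓞 K))) : 𝓞 K) =
        ξ.finitePart (q.out : (A.ideal : Ideal (𝓞 K))) := by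
    rw [← ξ.finitePart_mul]
    refine ξ.finitePart_congr ?_
    have h3 : (γ 1 1 • (γ 0 0 • q.out + φ n) - q.out : (A.ideal : Ideal (𝓞 K))) ∈ A.periods 𝔪 := by
      have h4 : (γ 1 1 • (γ 0 0 • q.out + φ n) - q.out : (A.ideal : Ideal (𝓞 K))) =
          (γ 1 1 * γ 0 0 - 1) • q.out + γ 1 1 • φ n := by module
      rw [h4, ← hφr, hdet]
      exact add_mem (h1 (dvd_mul_left _ _)) (zsmul_mem (AddMonoidHom.mem_range.2 ⟨n, rfl⟩) _)
    simpa [mul_add] using BasedIdeal.mem_of_mem_periods h3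
  rw [← h2]
  ring

/-! ### Boundedness at the cusps -/

/-- Complete the square: with `y = x + s` the prefactor turns each term into `y^m e(|y|²τ)` times a
number of modulus one, dominated for `Im τ ≥ 1` by its size at `Im τ = 1`. -/
theorem NormLattice.exists_norm_wtheta_le (L : NormLattice) (m : ℕ) (h s t : ℂ) :
    ∃ M : ℝ, ∀ τ : ℂ, 1 ≤ τ.im →
      ‖e (s * conj s * τ) * L.wtheta m h s (τ * s + t) (τ * conj s + conj t) τ‖ ≤ M := by
  have hπ := Real.pi_pos
  have hs := L.summable_norm_pow_mul_exp (h + s) m 0 (c := 2 * Real.pi) (by positivity)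
  refine ⟨∑' n, ‖h + s + L.vec n‖ ^ m *
    Real.exp (0 * ‖h + s + L.vec n‖ - 2 * Real.pi * ‖h + s + L.vec n‖ ^ 2), fun τ hτ => ?_⟩
  rw [NormLattice.wtheta, ← tsum_mul_left]
  refine tsum_of_norm_bounded hs.hasSum fun n => ?_
  obtain ⟨y, hy⟩ : ∃ y, y = h + s + L.vec n := ⟨_, rfl⟩
  have hx : h + L.vec n = y - s := by rw [hy]; ring
  have h1 : e (s * conj s * τ) * ((y - s + s) ^ m *
      gterm (y - s) (τ * s + t) (τ * conj s + conj t) τ) =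
      y ^ m * e ((y - s) * conj t + conj (y - s) * t) * e (y * conj y * τ) := by
    rw [gterm, sub_add_cancel, mul_left_comm, ← e_add, mul_assoc (y ^ m), ← e_add]
    congr 2
    rw [map_sub]
    ring
  rw [hx, h1, ← hy, norm_mul, norm_mul, NormLattice.norm_e_add_conj, mul_one, norm_pow, norm_e,
    Complex.mul_conj, Complex.im_ofReal_mul, Complex.normSq_eq_norm_sq]
  gcongr
  rw [zero_mul, zero_sub, mul_assoc]
  have : ‖y‖ ^ 2 * 1 ≤ ‖y‖ ^ 2 * τ.im := by gcongr
  rw [mul_one] at this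
  have : 2 * Real.pi * ‖y‖ ^ 2 ≤ 2 * Real.pi * (‖y‖ ^ 2 * τ.im) := by gcongr
  linarith

/-- By stability of `thetaSpace`, each coset series becomes a finite combination of theta series.
`wtheta_slash` carries the same combination over to polynomial weights, and every summand is bounded
by `exists_norm_wtheta_le`. -/
theorem isBoundedAtImInfty_slash_cmSeries (hK : Module.finrank ℚ K = 2) (hD : discr K < 0)
    {𝔪 : Ideal (𝓞 K)} (h𝔪 : 𝔪 ≠ ⊥) {k : ℕ} (hk : 1 ≤ k) {f : 𝓞 K → ℂ}
    (hf : ∀ α β, α - β ∈ 𝔪 → f α = f β) (γ : SL(2, ℤ)) (a b : Fin 2 → ℝ) :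
    IsBoundedAtImInfty (fun τ : ℍ => e (A.quad σ (toC a) * (τ : ℂ)) *
      slash k (A.quad σ) γ (cmSeries σ A k f) ((τ : ℂ) • toC a + toC b) τ) := by
  obtain ⟨L, φ, hφ, hφr, hL, -, -⟩ := A.exists_lattice (σ := σ) hK hD h𝔪
  have hfin : Finite ((A.ideal : Ideal (𝓞 K)) ⧸ φ.range) := hφr ▸ A.finite_quotient_periods h𝔪
  have := Fintype.ofFinite ((A.ideal : Ideal (𝓞 K)) ⧸ φ.range)
  have hdual : ∀ α : (A.ideal : Ideal (𝓞 K)), L.IsDual (A.pt σ α) := fun α n => by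
    rw [hL]
    exact A.pt_pairing σ hK hD α (φ n)
  choose n c g H using fun q : (A.ideal : Ideal (𝓞 K)) ⧸ φ.range =>
    NormLattice.exists_slashOne_eq_sum (hdual q.out) γ
  choose M hM using fun h => L.exists_norm_wtheta_le (k - 1) h (A.lin σ (toC a)) (A.lin σ (toC b))
  rw [isBoundedAtImInfty_iff]
  refine ⟨‖A.root ^ (k - 1)‖ * ∑ q : (A.ideal : Ideal (𝓞 K)) ⧸ φ.range,
    ‖f (q.out : (A.ideal : Ideal (𝓞 K)))‖ * ∑ i, ‖c q i‖ * M (g q i), 1, fun τ hτ => ?_⟩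
  rw [slash_cmSeries hK hD h𝔪 k hf hφ hφr hL, mul_left_comm, norm_mul]
  gcongr
  rw [Finset.mul_sum]
  refine norm_sum_le_of_le _ fun q _ => ?_
  rw [wtheta_slash hk (H q), mul_left_comm, norm_mul]
  gcongr
  rw [Finset.mul_sum]
  refine norm_sum_le_of_le _ fun i _ => ?_
  rw [mul_left_comm, norm_mul]
  gcongr
  rw [aPart_smul_add, A.quad_eq, A.lin_add, A.colin_add, A.lin_smul, A.colin_smul, A.colin_toC,
    A.colin_toC]
  exact hM _ _ hτ

/-! ### The elliptic transformation law -/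

/-- Translation by `λτ` replaces `a` by `a + λ`, so `α + a` becomes `(α + λ) + a`. The exponents
match by completing the square, up to the integer `B(α, μ)`. -/
theorem cmTerm_add (k : ℕ) (f : 𝓞 K → ℂ) (l : Fin 2 → ℤ) (μ : Fin 2 → ℝ)
    (hμ : ∀ n : Fin 2 → ℤ, ∃ j : ℤ, polar (A.quad σ) (intToC n) (toC μ) = (j : ℂ))
    (z : Fin 2 → ℂ) (τ : ℍ) (α : (A.ideal : Ideal (𝓞 K))) :
    cmTerm σ A k f (z + (τ : ℂ) • intToC l + toC μ) τ α =
      e (-(polar (A.quad σ) z (intToC l))) * e (-(A.quad σ (intToC l) * (τ : ℂ))) *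
        cmTerm σ A k (fun α => f (α - A.elt l)) z τ (α + A.elt l) := by
  have ha : toC (aPart (z + (τ : ℂ) • intToC l + toC μ) τ) = toC (aPart z τ) + intToC l := by
    have h1 : z + (τ : ℂ) • intToC l + toC μ =
        (τ : ℂ) • toC (aPart z τ + fun i => (l i : ℝ)) + toC (bPart z τ + μ) := by
      conv_lhs => rw [eq_smul_aPart_add_bPart z τ]
      funext i
      simp only [toC, intToC, Pi.add_apply, Pi.smul_apply, smul_eq_mul]
      push_cast
      ring
    rw [h1, aPart_smul_add]
    funext i
    simp [toC, intToC]
  obtain ⟨j, hj⟩ := hμ (fun i => A.basis.repr α i)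
  have hj' : A.pt σ α * A.colin σ (toC μ) + conj (A.pt σ α) * A.lin σ (toC μ) = j := by
    rw [← hj, A.polar_quad]
    change _ = A.lin σ (A.coord α) * _ + A.colin σ (A.coord α) * _
    rw [A.lin_coord, A.colin_coord]
  rw [cmTerm_eq, cmTerm_eq, ha, A.lin_add, A.lin_intToC, A.lin_add, A.lin_add, A.colin_add,
    A.colin_add, A.lin_smul, A.colin_smul, A.lin_intToC, A.colin_intToC, A.polar_quad, A.quad_eq,
    A.lin_intToC, A.colin_intToC, A.pt_add, Submodule.coe_add, add_sub_cancel_right]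
  have hg : gterm (A.pt σ α) (A.lin σ z + τ * A.pt σ (A.elt l) + A.lin σ (toC μ))
      (A.colin σ z + τ * conj (A.pt σ (A.elt l)) + A.colin σ (toC μ)) τ =
      e (-(A.lin σ z * conj (A.pt σ (A.elt l)) + A.colin σ z * A.pt σ (A.elt l))) *
        e (-(A.pt σ (A.elt l) * conj (A.pt σ (A.elt l)) * τ)) *
        gterm (A.pt σ α + A.pt σ (A.elt l)) (A.lin σ z) (A.colin σ z) τ := by
    rw [gterm, gterm, ← e_add, ← e_add]
    refine e_eq_of_sub_eq_intCast j ?_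
    rw [← hj', map_add]
    ring
  rw [hg]
  ring

theorem cmSeries_add (k : ℕ) (f : 𝓞 K → ℂ) (l : Fin 2 → ℤ) (μ : Fin 2 → ℝ)
    (hμ : ∀ n : Fin 2 → ℤ, ∃ j : ℤ, polar (A.quad σ) (intToC n) (toC μ) = (j : ℂ))
    (z : Fin 2 → ℂ) (τ : ℍ) : cmSeries σ A k f (z + (τ : ℂ) • intToC l + toC μ) τ =
      e (-(polar (A.quad σ) z (intToC l))) * e (-(A.quad σ (intToC l) * (τ : ℂ))) *
        cmSeries σ A k (fun α => f (α - A.elt l)) z τ := by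
  rw [cmSeries, cmSeries, ← tsum_mul_left, ← (Equiv.addRight (A.elt l)).tsum_eq (fun α =>
    e (-(polar (A.quad σ) z (intToC l))) * e (-(A.quad σ (intToC l) * (τ : ℂ))) *
      cmTerm σ A k (fun α => f (α - A.elt l)) z τ α)]
  exact tsum_congr fun α => cmTerm_add k f l μ hμ z τ α

/-! ### The index -/

theorem quad_eq_form (hK : Module.finrank ℚ K = 2) (hD : discr K < 0) :
    ∃ p r s : ℤ, 0 < p ∧ r ^ 2 < 4 * p * s ∧
      ∀ z, A.quad σ z = (p : ℂ) * z 0 ^ 2 + (r : ℂ) * (z 0 * z 1) + (s : ℂ) * z 1 ^ 2 := by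
  obtain ⟨P, R, S, hP, hR, hS, hdisc, hpos⟩ := exists_form hK hD σ A.ideal_ne_bot A.basis
  refine ⟨P, R, S, hpos, by omega, fun z => ?_⟩
  have h0 : (A.norm : ℂ) ≠ 0 := by exact_mod_cast A.norm_pos.ne'
  have hn : (Ideal.absNorm (A.ideal : Ideal (𝓞 K)) : ℂ) = A.norm := by simp [BasedIdeal.norm]
  rw [hn] at hP hR hS
  rw [BasedIdeal.quad, div_eq_iff h0]
  simp only [BasedIdeal.w, Complex.star_def]
  rw [hP, hR, hS]
  ring

theorem sublattice_finiteIndex {𝔪 : Ideal (𝓞 K)} (h𝔪 : 𝔪 ≠ ⊥) :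
    (A.sublattice 𝔪).FiniteIndex := by
  have := A.finite_quotient_periods h𝔪
  have : (A.periods 𝔪).FiniteIndex := AddSubgroup.finiteIndex_of_finite_quotient
  let η : (Fin 2 → ℤ) →+ (A.ideal : Ideal (𝓞 K)) :=
    { toFun := A.elt
      map_zero' := by simp [BasedIdeal.elt]
      map_add' := fun l l' => by
        simp [BasedIdeal.elt, add_smul, Finset.sum_add_distrib] }
  exact finiteIndex_comap (A.periods 𝔪) η

end Transformation

section Holomorphy

/-! ### Holomorphy -/

/-- The linear form in the exponent of `gterm x`. -/
def gtermExponent (x : ℂ) : ℂ × ℂ × ℂ →L[ℂ] ℂ :=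
  (2 * Real.pi * Complex.I) • (conj x • ContinuousLinearMap.fst ℂ ℂ (ℂ × ℂ) +
    x • (ContinuousLinearMap.fst ℂ ℂ ℂ).comp (ContinuousLinearMap.snd ℂ ℂ (ℂ × ℂ)) +
    (x * conj x) • (ContinuousLinearMap.snd ℂ ℂ ℂ).comp (ContinuousLinearMap.snd ℂ ℂ (ℂ × ℂ)))

theorem gtermExponent_apply (x : ℂ) (p : ℂ × ℂ × ℂ) : gtermExponent x p =
    2 * Real.pi * Complex.I * (x * p.2.1 + conj x * p.1 + x * conj x * p.2.2) := by
  simp [gtermExponent]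
  ring

theorem norm_gtermExponent_le (x : ℂ) :
    ‖gtermExponent x‖ ≤ 2 * Real.pi * (2 * ‖x‖ + ‖x‖ ^ 2) := by
  refine ContinuousLinearMap.opNorm_le_bound _ (by positivity) fun p => ?_
  have h1 : ‖p.1‖ ≤ ‖p‖ := norm_fst_le p
  have h2 : ‖p.2.1‖ ≤ ‖p‖ := (norm_fst_le p.2).trans (norm_snd_le p)
  have h3 : ‖p.2.2‖ ≤ ‖p‖ := (norm_snd_le p.2).trans (norm_snd_le p)
  have h0 : ‖(2 * Real.pi * Complex.I : ℂ)‖ = 2 * Real.pi := by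
    simp [abs_of_pos Real.pi_pos]
  have hx : ‖conj x‖ = ‖x‖ := Complex.norm_conj x
  rw [gtermExponent_apply, norm_mul, h0, mul_assoc (2 * Real.pi)]
  refine mul_le_mul_of_nonneg_left ?_ (by positivity)
  calc ‖x * p.2.1 + conj x * p.1 + x * conj x * p.2.2‖
      ≤ ‖x * p.2.1‖ + ‖conj x * p.1‖ + ‖x * conj x * p.2.2‖ := norm_add₃_le
    _ = ‖x‖ * ‖p.2.1‖ + ‖x‖ * ‖p.1‖ + ‖x‖ * ‖x‖ * ‖p.2.2‖ := by
        rw [norm_mul, norm_mul, norm_mul, norm_mul, hx]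
    _ ≤ ‖x‖ * ‖p‖ + ‖x‖ * ‖p‖ + ‖x‖ * ‖x‖ * ‖p‖ := by gcongr
    _ = _ := by ring

theorem hasFDerivAt_gterm (x : ℂ) (p : ℂ × ℂ × ℂ) :
    HasFDerivAt (fun p : ℂ × ℂ × ℂ => gterm x p.1 p.2.1 p.2.2)
      (gterm x p.1 p.2.1 p.2.2 • gtermExponent x) p := by
  have h : (fun p : ℂ × ℂ × ℂ => gterm x p.1 p.2.1 p.2.2) =
      fun p => Complex.exp (gtermExponent x p) := by
    funext p
    rw [gtermExponent_apply, gterm, e]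
  rw [h, show gterm x p.1 p.2.1 p.2.2 = Complex.exp (gtermExponent x p) from congrFun h p]
  exact (gtermExponent x).hasFDerivAt.cexp

/-- The exponent is linear in `(u, u', τ)`, so differentiation brings down a factor at most
quadratic in `|x|`. On a ball of radius half the imaginary part of `τ` at its centre, one Gaussian
dominates all terms. -/
theorem NormLattice.differentiableOn_tsum_gterm (L : NormLattice) {c : ℤ × ℤ → ℂ} {C : ℝ} {r : ℕ}
    (hc : ∀ n, ‖c n‖ ≤ C * ‖L.vec n‖ ^ r) :
    DifferentiableOn ℂ (fun p : ℂ × ℂ × ℂ => ∑' n, c n * gterm (L.vec n) p.1 p.2.1 p.2.2)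
      {p | 0 < p.2.2.im} := by
  have hπ := Real.pi_pos
  intro p₀ hp₀
  have hp₀ : 0 < p₀.2.2.im := hp₀
  set δ := p₀.2.2.im / 2 with hδ
  have hδ0 : 0 < δ := half_pos hp₀
  set R := ‖p₀‖ + δ with hR
  have hball : ∀ p ∈ Metric.ball p₀ δ, ‖p‖ ≤ R ∧ δ ≤ p.2.2.im := by
    intro p hp
    have h1 : ‖p - p₀‖ < δ := mem_ball_iff_norm.1 hp
    refine ⟨?_, ?_⟩
    · have := norm_le_norm_add_norm_sub' p p₀
      linarith
    · have h2 : ‖p.2.2 - p₀.2.2‖ ≤ ‖p - p₀‖ :=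
        (norm_snd_le (p - p₀).2).trans (norm_snd_le (p - p₀))
      have h3 : |p.2.2.im - p₀.2.2.im| ≤ ‖p.2.2 - p₀.2.2‖ := by
        rw [← Complex.sub_im]
        exact Complex.abs_im_le_norm _
      have h4 := (abs_le.1 (h3.trans h2)).1
      linarith
  set E : ℤ × ℤ → ℝ := fun n =>
    Real.exp (2 * Real.pi * (R + R) * ‖L.vec n‖ - 2 * Real.pi * δ * ‖L.vec n‖ ^ 2) with hE
  have hS : ∀ j : ℕ, Summable fun n => ‖L.vec n‖ ^ j * E n := fun j => by
    have := L.summable_norm_pow_mul_exp 0 j (2 * Real.pi * (R + R)) (c := 2 * Real.pi * δ)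
      (by positivity)
    simpa only [zero_add] using this
  have hg : ∀ n, ∀ p ∈ Metric.ball p₀ δ, ‖gterm (L.vec n) p.1 p.2.1 p.2.2‖ ≤ E n := by
    intro n p hp
    obtain ⟨h1, h2⟩ := hball p hp
    have h3 : ‖p.1‖ ≤ R := (norm_fst_le p).trans h1
    have h4 : ‖p.2.1‖ ≤ R := ((norm_fst_le p.2).trans (norm_snd_le p)).trans h1
    refine (norm_gterm_le _ _ _ _).trans (Real.exp_le_exp.2 ?_)
    gcongr
  have hu : Summable fun n => C * ‖L.vec n‖ ^ r * (E n * (2 * Real.pi *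
      (2 * ‖L.vec n‖ + ‖L.vec n‖ ^ 2))) := by
    refine (((hS (r + 1)).mul_left (4 * Real.pi * C)).add
      ((hS (r + 2)).mul_left (2 * Real.pi * C))).congr fun n => ?_
    ring
  refine (hasFDerivAt_tsum_of_isPreconnected hu Metric.isOpen_ball
    (convex_ball p₀ δ).isPreconnected (fun n p _ => (hasFDerivAt_gterm (L.vec n) p).const_mul (c n))
    (fun n p hp => ?_) (Metric.mem_ball_self hδ0) ?_
    (Metric.mem_ball_self hδ0)).differentiableAt.differentiableWithinAt
  · have hcn := hc n
    rw [norm_smul, norm_smul]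
    gcongr
    · exact (norm_nonneg _).trans hcn
    · exact hg n p hp
    · exact norm_gtermExponent_le _
  · refine Summable.of_norm_bounded ((hS r).mul_left C) fun n => ?_
    rw [norm_mul, ← mul_assoc]
    have hcn := hc n
    gcongr
    · exact (norm_nonneg _).trans hcn
    · exact hg n p₀ (Metric.mem_ball_self hδ0)

/-- The ranges `k` and `k - i` encode total degree at most `k - 1` in `(x, y)`, the shape demanded
by `IsJacobiForm.almostHolomorphic`. -/
theorem add_add_pow_eq_sum (x y t : ℂ) {k : ℕ} (hk : 1 ≤ k) : (t + (x + y)) ^ (k - 1) =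
    ∑ i ∈ Finset.range k, ∑ j ∈ Finset.range (k - i), x ^ i * y ^ j *
      ((((k - 1).choose i * (k - 1 - i).choose j : ℕ) : ℂ) * t ^ (k - 1 - i - j)) := by
  obtain ⟨m, rfl⟩ : ∃ m, k = m + 1 := ⟨k - 1, by omega⟩
  rw [Nat.add_sub_cancel, add_comm t, add_assoc, add_pow]
  refine Finset.sum_congr rfl fun i hi => ?_
  have hi : i ≤ m := by simpa [Nat.lt_succ_iff] using hi
  rw [add_pow, Finset.mul_sum, Finset.sum_mul, show m + 1 - i = m - i + 1 by omega]
  refine Finset.sum_congr rfl fun j _ => ?_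
  push_cast
  ring

variable {K : Type*} [Field K] [NumberField K] {σ : K →+* ℂ} {A : BasedIdeal K}

/-- The only non-holomorphic ingredient is `a` in `(α + a)^(k-1)`; once this is expanded, the
coefficients are series in `u`, `u'`, `τ` with monomial weights in `x`. -/
theorem cmSeries_almostHolomorphic (hK : Module.finrank ℚ K = 2) (hD : discr K < 0) {k : ℕ}
    (hk : 1 ≤ k) {f : 𝓞 K → ℂ} {C : ℝ} (hC : ∀ α, ‖f α‖ ≤ C) :
    ∃ F : ℕ → ℕ → (Fin 2 → ℂ) × ℂ → ℂ, (∀ i j, DifferentiableOn ℂ (F i j) {p | 0 < p.2.im}) ∧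
      ∀ (z : Fin 2 → ℂ) (τ : ℍ), cmSeries σ A k f z τ =
        ∑ i ∈ Finset.range k, ∑ j ∈ Finset.range (k - i),
          (aPart z τ 0 : ℂ) ^ i * (aPart z τ 1 : ℂ) ^ j * F i j (z, (τ : ℂ)) := by
  obtain ⟨L, E, hL⟩ := A.exists_lattice_equiv σ hK hD
  have hr := A.root_ne_zero
  set c : ℕ → ℕ → ℂ := fun i j => A.root ^ (k - 1) * (A.w σ 0 / A.root) ^ i *
    (A.w σ 1 / A.root) ^ j * ((k - 1).choose i * (k - 1 - i).choose j : ℕ) with hcdef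
  set G : ℕ → ℂ × ℂ × ℂ → ℂ := fun r p =>
    ∑' n, f (E n) * L.vec n ^ r * gterm (L.vec n) p.1 p.2.1 p.2.2 with hG
  have hb : ∀ r n, ‖f (E n) * L.vec n ^ r‖ ≤ C * ‖L.vec n‖ ^ r := fun r n => by
    rw [norm_mul, norm_pow]
    gcongr
    exact hC _
  refine ⟨fun i j p => c i j * G (k - 1 - i - j) (A.lin σ p.1, A.colin σ p.1, p.2),
    fun i j => ?_, fun z τ => ?_⟩
  · refine DifferentiableOn.const_mul ((L.differentiableOn_tsum_gterm
      (hb (k - 1 - i - j))).comp (g := G (k - 1 - i - j))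
      (f := fun p : (Fin 2 → ℂ) × ℂ => (A.lin σ p.1, A.colin σ p.1, p.2)) ?_ fun p hp => hp) _
    refine Differentiable.differentiableOn ?_
    simp only [BasedIdeal.lin, BasedIdeal.colin]
    fun_prop
  · have hs : ∀ r, Summable fun n => f (E n) * L.vec n ^ r *
        gterm (L.vec n) (A.lin σ z) (A.colin σ z) τ := fun r => by
      refine Summable.of_norm_bounded ((L.summable_weighted_gterm 0 r 0 (A.lin σ z) (A.colin σ z)
        τ.im_pos).mul_left C) fun n => ?_
      rw [norm_mul, zero_mul, Real.exp_zero, mul_one, zero_add, mul_comm ‖gterm _ _ _ _‖,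
        ← mul_assoc]
      gcongr
      exact hb r n
    have ht : ∀ n, cmTerm σ A k f z τ (E n) =
        ∑ i ∈ Finset.range k, ∑ j ∈ Finset.range (k - i),
          (aPart z τ 0 : ℂ) ^ i * (aPart z τ 1 : ℂ) ^ j * c i j * (f (E n) *
            L.vec n ^ (k - 1 - i - j) * gterm (L.vec n) (A.lin σ z) (A.colin σ z) τ) := fun n => by
      have hlin : A.lin σ (toC (aPart z τ)) =
          A.w σ 0 / A.root * aPart z τ 0 + A.w σ 1 / A.root * aPart z τ 1 := by
        rw [BasedIdeal.lin]
        simp only [toC]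
        ring
      rw [cmTerm_eq, ← hL, hlin, add_add_pow_eq_sum _ _ _ hk, Finset.sum_mul, Finset.mul_sum,
        Finset.mul_sum]
      refine Finset.sum_congr rfl fun i _ => ?_
      rw [Finset.sum_mul, Finset.mul_sum, Finset.mul_sum]
      refine Finset.sum_congr rfl fun j _ => ?_
      rw [hcdef]
      ring
    rw [cmSeries, ← E.tsum_eq]
    simp_rw [ht]
    rw [Summable.tsum_finsetSum fun i _ => summable_sum fun j _ => (hs _).mul_left _]
    refine Finset.sum_congr rfl fun i _ => ?_
    rw [Summable.tsum_finsetSum fun j _ => (hs _).mul_left _]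
    refine Finset.sum_congr rfl fun j _ => ?_
    rw [tsum_mul_left, mul_assoc]

end Holomorphy

section HeckeTheta

/-! ### Jacobi forms -/

theorem IsJacobiForm.const_mul {k N : ℕ} {χ : ℤ → ℂ} {Q : (Fin 2 → ℂ) → ℂ}
    {Λ : AddSubgroup (Fin 2 → ℤ)} {φ : (Fin 2 → ℂ) → ℍ → ℂ} (h : IsJacobiForm k N χ Q Λ φ) (c : ℂ) :
    IsJacobiForm k N χ Q Λ (fun z τ => c * φ z τ) where
  index_posDef := h.index_posDef
  finiteIndex := h.finiteIndex
  modular γ hγ z τ := by rw [h.modular γ hγ]; ring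
  elliptic l hl μ hμ z τ := by rw [h.elliptic l hl μ hμ]; ring
  almostHolomorphic := by
    obtain ⟨f, hf, hφ⟩ := h.almostHolomorphic
    refine ⟨fun i j p => c * f i j p, fun i j => (hf i j).const_mul c, fun z τ => ?_⟩
    rw [hφ, Finset.mul_sum]
    refine Finset.sum_congr rfl fun i _ => ?_
    rw [Finset.mul_sum]
    exact Finset.sum_congr rfl fun j _ => by ring
  cusps γ a b := by
    obtain ⟨M, B, hM⟩ := isBoundedAtImInfty_iff.1 (h.cusps γ a b)
    refine isBoundedAtImInfty_iff.2 ⟨‖c‖ * M, B, fun τ hτ => ?_⟩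
    have : e (Q (toC a) * (τ : ℂ)) *
        slash k Q γ (fun z τ => c * φ z τ) ((τ : ℂ) • toC a + toC b) τ =
        c * (e (Q (toC a) * (τ : ℂ)) * slash k Q γ φ ((τ : ℂ) • toC a + toC b) τ) := by
      rw [slash, slash]; ring
    rw [this, norm_mul]
    exact mul_le_mul_of_nonneg_left (hM τ hτ) (norm_nonneg c)

variable {K : Type*} [Field K] [NumberField K] {σ : K →+* ℂ}

theorem isJacobiForm_phi (hK : Module.finrank ℚ K = 2) (hD : discr K < 0) {𝔪 : Ideal (𝓞 K)}
    (h𝔪 : 𝔪 ≠ ⊥) {k : ℕ} (hk : 1 ≤ k) (ξ : HeckeChar σ 𝔪 (k - 1)) (A : BasedIdeal K) :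
    IsJacobiForm k ((discr K).natAbs * Ideal.absNorm 𝔪) ξ.nebentypus (A.quad σ) (A.sublattice 𝔪)
      (phi ξ A) where
  index_posDef := quad_eq_form hK hD
  finiteIndex := sublattice_finiteIndex h𝔪
  modular γ hγ z τ := by
    have hj := pow_ne_zero k (autFactor_ne_zero γ τ)
    have h := slash_phi (A := A) hK hD h𝔪 hk ξ
      ((ZMod.intCast_zmod_eq_zero_iff_dvd _ _).1 (CongruenceSubgroup.Gamma0_mem.1 hγ)) z τ
    rw [slash, e_neg] at h
    have he := e_ne_zero (((γ 1 0 : ℤ) : ℂ) * A.quad σ z / autFactor γ τ)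
    rw [← mul_inv, inv_mul_eq_iff_eq_mul₀ (mul_ne_zero hj he)] at h
    rw [h]
    ring
  elliptic l hl μ hμ z τ := by
    have hphi : phi ξ A = cmSeries σ A k ξ.finitePart := rfl
    rw [hphi, cmSeries_add k ξ.finitePart l μ hμ z τ]
    congr 2
    funext α
    refine ξ.finitePart_congr ?_
    rw [sub_sub_cancel_left, neg_mem_iff]
    exact BasedIdeal.mem_of_mem_periods (A := A) (α := A.elt l) hl
  almostHolomorphic := by
    obtain ⟨C, hC⟩ := exists_norm_le_of_periodic h𝔪 (f := ξ.finitePart)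
      fun α β h => ξ.finitePart_congr h
    exact cmSeries_almostHolomorphic hK hD hk hC
  cusps γ a b := isBoundedAtImInfty_slash_cmSeries hK hD h𝔪 hk (f := ξ.finitePart)
    (fun α β h => ξ.finitePart_congr h) γ a b

/-! ### The theta series of a Hecke character -/

section Theta

variable {A : BasedIdeal K}

theorem BasedIdeal.exists_span_eq (α : (A.ideal : Ideal (𝓞 K))) :
    ∃ 𝔞 : Ideal (𝓞 K), Ideal.span {(α : 𝓞 K)} = 𝔞 * (A.ideal : Ideal (𝓞 K)) := by
  obtain ⟨𝔞, h⟩ := Ideal.dvd_iff_le.2 ((Ideal.span_singleton_le_iff_mem _).2 α.2)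
  exact ⟨𝔞, by rw [h, mul_comm]⟩

/-- The integral ideal `α𝔞₀⁻¹`. -/
def BasedIdeal.quotientIdeal (A : BasedIdeal K) (α : (A.ideal : Ideal (𝓞 K))) : Ideal (𝓞 K) :=
  (BasedIdeal.exists_span_eq α).choose

theorem BasedIdeal.span_eq_iff (α : (A.ideal : Ideal (𝓞 K))) (𝔞 : Ideal (𝓞 K)) :
    Ideal.span {(α : 𝓞 K)} = 𝔞 * (A.ideal : Ideal (𝓞 K)) ↔ A.quotientIdeal α = 𝔞 := by
  have h : _ = A.quotientIdeal α * _ := (BasedIdeal.exists_span_eq α).choose_spec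
  rw [h]
  exact ⟨fun h' => mul_right_cancel₀ A.ideal_ne_bot h', fun h' => by rw [h']⟩

/-- All generators of `I` have the same norm, so infinitely many of them would contribute infinitely
many equal positive terms to a convergent Gaussian sum. -/
theorem BasedIdeal.finite_span_eq (hK : Module.finrank ℚ K = 2) (hD : discr K < 0)
    (σ : K →+* ℂ) (A : BasedIdeal K) (I : Ideal (𝓞 K)) :
    Finite {α : (A.ideal : Ideal (𝓞 K)) // Ideal.span {(α : 𝓞 K)} = I} := by
  obtain ⟨L, E, hL⟩ := A.exists_lattice_equiv σ hK hD
  have hs : Summable fun α : (A.ideal : Ideal (𝓞 K)) => Real.exp (-(1 * ‖A.pt σ α‖ ^ 2)) := by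
    rw [← E.summable_iff]
    refine (L.summable_exp_neg_norm_sq 0 one_pos).congr fun n => ?_
    rw [zero_add, hL]
    rfl
  by_contra h
  rw [not_finite_iff_infinite] at h
  have hs' : Summable fun _ : {α : (A.ideal : Ideal (𝓞 K)) // Ideal.span {(α : 𝓞 K)} = I} =>
      Real.exp (-(1 * (Ideal.absNorm I / A.norm))) := by
    refine (hs.subtype {α | Ideal.span {(α : 𝓞 K)} = I}).congr fun α => ?_
    have h1 := absNorm_span_eq hK hD σ (α.1 : 𝓞 K)
    have h2 : Ideal.span {(α.1 : 𝓞 K)} = I := α.2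
    rw [h2, Complex.mul_conj, Complex.normSq_eq_norm_sq] at h1
    have h3 : (Ideal.absNorm I : ℝ) = ‖σ (α.1 : 𝓞 K)‖ ^ 2 := by exact_mod_cast h1
    have h4 : ‖A.root‖ ^ 2 = A.norm := by
      rw [← norm_pow, A.root_sq, Complex.norm_real, Real.norm_of_nonneg A.norm_pos.le]
    rw [h3, Function.comp, BasedIdeal.pt, norm_div, div_pow, h4]
  rw [summable_const_iff] at hs'
  exact (Real.exp_pos _).ne' hs'

/-- The phase `(s/|s|)^m` times `|s|^m` is the polynomial `s^m`, also for `s = 0`; only the power of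
`N` survives as a constant. -/
theorem infType_mul_rpow (m : ℕ) (s : ℂ) {N : ℝ} (hN : 0 < N) :
    infType m s * (((‖s‖ ^ 2 / N) ^ ((m : ℝ) / 2) : ℝ) : ℂ) =
      ((N ^ (-(m : ℝ) / 2) : ℝ) : ℂ) * s ^ m := by
  have h1 : (‖s‖ ^ 2 / N) ^ ((m : ℝ) / 2) = N ^ (-(m : ℝ) / 2) * ‖s‖ ^ m := by
    rw [Real.div_rpow (by positivity) hN.le, neg_div, Real.rpow_neg hN.le, ← Real.rpow_natCast ‖s‖ 2,
      ← Real.rpow_mul (norm_nonneg s), div_eq_inv_mul]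
    congr 1
    rw [← Real.rpow_natCast]
    congr 1
    push_cast
    ring
  rw [h1, infType]
  push_cast
  rw [mul_left_comm, ← mul_pow]
  congr 2
  by_cases hs : s = 0
  · simp [hs]
  · exact div_mul_cancel₀ _ (by simpa using hs)

/-- `N(𝔞) = Q_C(α)` because `(α) = 𝔞𝔞₀`, and `z = aτ + b` splits `B_C(α, z)` into the two exponents.
The constant does not depend on `α`. -/
theorem theta_summand_eq (hK : Module.finrank ℚ K = 2) (hD : discr K < 0) {𝔪 : Ideal (𝓞 K)}
    {k : ℕ} (hk : 1 ≤ k) (ξ : HeckeChar σ 𝔪 (k - 1)) (z : Fin 2 → ℂ) (τ : ℍ) {𝔞 : Ideal (𝓞 K)}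
    {α : (A.ideal : Ideal (𝓞 K))} (hα : Ideal.span {(α : 𝓞 K)} = 𝔞 * (A.ideal : Ideal (𝓞 K))) :
    shiftedChar ξ A α (aPart z τ) *
      ((shiftedNorm σ A α (aPart z τ) ^ (((k : ℝ) - 1) / 2) : ℝ) : ℂ) *
      e (polar (A.quad σ) (A.coord α) (toC (bPart z τ))) *
      e (((Ideal.absNorm 𝔞 : ℂ) + polar (A.quad σ) (A.coord α) (toC (aPart z τ))) * (τ : ℂ)) =
    (ξ.value (FractionalIdeal.mk0 K A.ideal))⁻¹ * ((A.norm ^ ((1 - (k : ℝ)) / 2) : ℝ) : ℂ) *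
      cmTerm σ A k ξ.finitePart z τ α := by
  have hN : (A.norm : ℂ) ≠ 0 := by exact_mod_cast A.norm_pos.ne'
  have hr := A.root_ne_zero
  have hk1 : (((k - 1 : ℕ) : ℝ)) = (k : ℝ) - 1 := by push_cast [Nat.cast_sub hk]; ring
  have hk2 : (1 - (k : ℝ)) = -((k - 1 : ℕ) : ℝ) := by rw [hk1]; ring
  have h1 : (Ideal.absNorm 𝔞 : ℂ) = A.quad σ (A.coord α) := by
    have h2 := absNorm_span_eq hK hD σ (α : 𝓞 K)
    have h3 : ((Ideal.absNorm (A.ideal : Ideal (𝓞 K)) : ℕ) : ℂ) = A.root ^ 2 := by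
      rw [A.root_sq]
      simp [BasedIdeal.norm]
    rw [hα, map_mul, Nat.cast_mul, h3] at h2
    rw [A.quad_eq, A.lin_coord, A.colin_coord, BasedIdeal.pt, map_div₀, A.conj_root,
      div_mul_div_comm, ← h2]
    field_simp
  have h4 := infType_mul_rpow (k - 1) (A.shift σ α (aPart z τ)) A.norm_pos
  have h5 : polar (A.quad σ) (A.coord α) z = τ * polar (A.quad σ) (A.coord α) (toC (aPart z τ)) +
      polar (A.quad σ) (A.coord α) (toC (bPart z τ)) := by
    conv_lhs => rw [eq_smul_aPart_add_bPart z τ]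
    simp only [A.polar_quad, A.lin_add, A.colin_add, A.lin_smul, A.colin_smul]
    ring
  rw [shiftedChar, shiftedNorm, cmTerm, h5, h1, ← hk1, hk2, add_mul, e_add, e_add,
    mul_comm (τ : ℂ)]
  linear_combination ((ξ.value (FractionalIdeal.mk0 K A.ideal))⁻¹ * ξ.finitePart (α : 𝓞 K) *
    e (polar (A.quad σ) (A.coord α) (toC (bPart z τ))) * (e (A.quad σ (A.coord α) * (τ : ℂ)) *
      e (polar (A.quad σ) (A.coord α) (toC (aPart z τ)) * τ))) * h4

/-- For each class, the absolutely convergent series over `α ∈ 𝔞₀` is summed along the fibres of `α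
↦ α𝔞₀⁻¹`. The fibres are finite, so the `finsum` in `thetaTerm` is the sum over the fibre. -/
theorem hasSum_thetaTerm (hK : Module.finrank ℚ K = 2) (hD : discr K < 0) {𝔪 : Ideal (𝓞 K)}
    (h𝔪 : 𝔪 ≠ ⊥) {k : ℕ} (hk : 1 ≤ k) (ξ : HeckeChar σ 𝔪 (k - 1))
    (A : ClassGroup (𝓞 K) → BasedIdeal K) (z : Fin 2 → ℂ) (τ : ℍ) :
    HasSum (thetaTerm ξ A z τ) (∑ C, ((Units.torsionOrder K : ℕ) : ℂ)⁻¹ *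
      (ξ.value (FractionalIdeal.mk0 K (A C).ideal))⁻¹ *
      (((A C).norm ^ ((1 - (k : ℝ)) / 2) : ℝ) : ℂ) * phi ξ (A C) z τ) := by
  obtain ⟨M, hM⟩ := exists_norm_le_of_periodic h𝔪 (f := ξ.finitePart)
    fun α β h => ξ.finitePart_congr h
  have h1 : ∀ C, HasSum (fun 𝔞 : Ideal (𝓞 K) =>
      ∑' α : (A C).quotientIdeal ⁻¹' {𝔞}, ((Units.torsionOrder K : ℕ) : ℂ)⁻¹ *
        (ξ.value (FractionalIdeal.mk0 K (A C).ideal))⁻¹ *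
        (((A C).norm ^ ((1 - (k : ℝ)) / 2) : ℝ) : ℂ) * cmTerm σ (A C) k ξ.finitePart z τ α)
      (((Units.torsionOrder K : ℕ) : ℂ)⁻¹ * (ξ.value (FractionalIdeal.mk0 K (A C).ideal))⁻¹ *
        (((A C).norm ^ ((1 - (k : ℝ)) / 2) : ℝ) : ℂ) * phi ξ (A C) z τ) := fun C =>
    HasSum.tsum_fiberwise ((summable_cmTerm hK hD k hM z τ).hasSum.mul_left _) _
  refine (hasSum_sum fun C (_ : C ∈ Finset.univ) => h1 C).congr_fun fun 𝔞 => ?_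
  rw [thetaTerm, Finset.mul_sum]
  refine Finset.sum_congr rfl fun C _ => ?_
  have hfin := (A C).finite_span_eq hK hD σ (𝔞 * ((A C).ideal : Ideal (𝓞 K)))
  let ε : {α : ((A C).ideal : Ideal (𝓞 K)) // Ideal.span {(α : 𝓞 K)} = 𝔞 * (A C).ideal} ≃
      (A C).quotientIdeal ⁻¹' {𝔞} :=
    Equiv.subtypeEquivRight fun α => BasedIdeal.span_eq_iff α 𝔞
  rw [← tsum_eq_finsum (L := SummationFilter.unconditional _) (Set.toFinite _), ← tsum_mul_left]
  refine Eq.trans (tsum_congr fun α => ?_) (ε.tsum_eq _)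
  rw [theta_summand_eq hK hD hk ξ z τ α.2, ← mul_assoc, ← mul_assoc]
  rfl

end Theta

end HeckeTheta

end

end CMJacobi

/-! ### The theorem -/

open CMJacobi
theorem theorem1p2 {K : Type*} [Field K] [NumberField K]
    (hK : Module.finrank ℚ K = 2) (hD : discr K < 0) (σ : K →+* ℂ)
    (𝔪 : Ideal (𝓞 K)) (h𝔪 : 𝔪 ≠ ⊥) (k : ℕ) (hk : 1 ≤ k) (ξ : HeckeChar σ 𝔪 (k - 1))
    (A : ClassGroup (𝓞 K) → BasedIdeal K)
    (hA : ∀ C, ClassGroup.mk0 (A C).ideal = C)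
    (hcop : ∀ C, IsCoprime ((A C).ideal : Ideal (𝓞 K)) 𝔪) :
    -- the series converge absolutely
    (∀ z τ, Summable (thetaTerm ξ A z τ)) ∧
    (∀ C z τ, Summable (cmTerm σ (A C) k ξ.finitePart z τ)) ∧
    -- `θ_ξ` is a linear combination of the functions `φ_{ξ,C}`
    (∀ z τ, theta ξ A z τ = ∑ C, ((Units.torsionOrder K : ℕ) : ℂ)⁻¹ *
      (ξ.value (FractionalIdeal.mk0 K (A C).ideal))⁻¹ *
      (((A C).norm ^ ((1 - (k : ℝ)) / 2) : ℝ) : ℂ) * phi ξ (A C) z τ) ∧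
    -- each `φ_{ξ,C}` is a Jacobi form of lattice index `(ℤ², Q_C)`
    (∀ C, IsJacobiForm k ((discr K).natAbs * Ideal.absNorm 𝔪) ξ.nebentypus ((A C).quad σ)
      ((A C).sublattice 𝔪) (phi ξ (A C))) ∧
    -- translations by the full lattice `ℤ²` shift the argument of `ξ_𝔪`
    (∀ C (l : Fin 2 → ℤ) (μ : Fin 2 → ℝ),
      (∀ n : Fin 2 → ℤ, ∃ j : ℤ, polar ((A C).quad σ) (intToC n) (toC μ) = (j : ℂ)) →
      ∀ (z : Fin 2 → ℂ) (τ : ℍ), phi ξ (A C) (z + (τ : ℂ) • intToC l + toC μ) τ =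
        e (-(polar ((A C).quad σ) z (intToC l))) * e (-((A C).quad σ (intToC l) * (τ : ℂ))) *
          cmSeries σ (A C) k
            (fun α => ξ.finitePart (α - ((∑ i, l i • (A C).basis i :
              ((A C).ideal : Ideal (𝓞 K))) : 𝓞 K))) z τ) ∧
    -- if the class number is one, then `θ_ξ` itself is a Jacobi form of index `(ℤ², Q_C)`
    (classNumber K = 1 → ∀ C, IsJacobiForm k ((discr K).natAbs * Ideal.absNorm 𝔪) ξ.nebentypus
      ((A C).quad σ) ((A C).sublattice 𝔪) (theta ξ A)) := by
  have hsum := fun z τ => hasSum_thetaTerm hK hD h𝔪 hk ξ A z τ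
  have hjac := fun C => isJacobiForm_phi hK hD h𝔪 hk ξ (A C)
  obtain ⟨M, hM⟩ := exists_norm_le_of_periodic h𝔪 (f := ξ.finitePart)
    fun α β h => ξ.finitePart_congr h
  refine ⟨fun z τ => (hsum z τ).summable, fun C z τ => summable_cmTerm hK hD k hM z τ,
    fun z τ => (hsum z τ).tsum_eq, hjac,
    fun C l μ hμ z τ => cmSeries_add k ξ.finitePart l μ hμ z τ, fun hcl C => ?_⟩
  have hsub : Subsingleton (ClassGroup (𝓞 K)) := by
    rw [classNumber] at hcl
    exact Fintype.card_le_one_iff_subsingleton.1 hcl.le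
  -- With a single class the sum has one term, so `θ_ξ` is a constant multiple of `φ_{ξ,C}`.
  have hθ : theta ξ A = fun z τ => ((Units.torsionOrder K : ℕ) : ℂ)⁻¹ *
      (ξ.value (FractionalIdeal.mk0 K (A C).ideal))⁻¹ *
      (((A C).norm ^ ((1 - (k : ℝ)) / 2) : ℝ) : ℂ) * phi ξ (A C) z τ := by
    funext z τ
    exact ((hsum z τ).tsum_eq).trans (Fintype.sum_subsingleton _ C)
  rw [hθ]
  exact (hjac C).const_mul _
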